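/- An instance of the single-level improvable knapsack problem with continuous improvements, (iK-cs), consists of $n$ items with profits $p_i\in\mathbb{R}$, weights $w_i$, maximal weight reductions $\overline{w}_i$ and improvement costs $c_i$ ($i=1,\dots,n$), a knapsack budget $B$ and an improvement budget $C$, where $B,C\ge 0$, $c_i\ge 0$ and $0\le\overline{w}_i\le w_i$ for all $i$ (so the fully improved weight $w_i-\overline{w}_i$ lies between $0$ and $w_i$). The problem is $$\max \sum_{i=1}^n p_ix_i\quad\text{s.t.}\quad \sum_{i=1}^n w_ix_i-\sum_{i=1}^n\overline{w}_iy_i\le B,\quad \sum_{i=1}^n c_iy_i\le C,\quad 0\le y_i\le x_i,\quad x_i\in\{0,1\}\quad(i=1,\dots,n).$$ Theorem. There exists a polynomial-time approximation scheme (PTAS) for (iK-cs). That is, for every fixed $\varepsilon>0$ there is an algorithm which, given any instance, returns a feasible solution $(x,y)$ with $\sum_i p_ix_i\ge(1-\varepsilon)\,\mathrm{OPT}$, where $\mathrm{OPT}$ is the optimal value (which is attained), and which runs in polynomial time. Here an algorithm is a single program, independent of $n$ and of the data, for a random access machine that handles array indices (natural numbers with addition, truncated subtraction and comparison) and numbers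 (with $+,-,\cdot,/$, comparison and conversion of indices to numbers), with indirect addressing, conditionals and loops. Polynomial time means that the same program satisfies both of the following: (i) on instances with real data, the number of elementary operations is at most a polynomial in $n$; (ii) on instances with rational data, where the program computes with rational numbers, the total logarithmic cost (every operation is charged $1$ plus the bit length of the value it produces, if any) is at most a polynomial in the encoding length of the instance ($n$ plus the bit lengths of all data). The polynomials depend only on $\varepsilon$. -/

import Mathlib

/-! ### The improvable knapsack problem (continuous improvements, single level) -/

/-- The data of an instance with `n` items: profits `p`, unimproved weights `w`, maximal weight
reductions `wbar` (unimproved minus improved weight), improvement costs `c`, the knapsack budget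
`B` and the improvement budget `C`. -/
structure KnapsackInstance (K : Type) (n : ℕ) where
  p : Fin n → K
  w : Fin n → K
  wbar : Fin n → K
  c : Fin n → K
  B : K
  C : K

namespace KnapsackInstance

/-- The standing assumptions: budgets and costs are nonnegative, and the improved weight
`w i - wbar i` is nonnegative and at most the unimproved weight. Profits are arbitrary. -/
structure Valid {K : Type} [Field K] [LinearOrder K] {n : ℕ}
    (I : KnapsackInstance K n) : Prop where
  B_nonneg : 0 ≤ I.B
  C_nonneg : 0 ≤ I.C
  c_nonneg : ∀ i, 0 ≤ I.c i
  wbar_nonneg : ∀ i, 0 ≤ I.wbar i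
  wbar_le : ∀ i, I.wbar i ≤ I.w i

/-- `(x, y)` satisfies all the constraints of the problem. -/
structure Feasible {n : ℕ} (I : KnapsackInstance ℝ n) (x y : Fin n → ℝ) : Prop where
  weight_le : ∑ i, I.w i * x i - ∑ i, I.wbar i * y i ≤ I.B
  cost_le : ∑ i, I.c i * y i ≤ I.C
  y_le : ∀ i, y i ≤ x i
  y_nonneg : ∀ i, 0 ≤ y i
  x_binary : ∀ i, x i = 0 ∨ x i = 1

/-- The objective function. -/
def profit {n : ℕ} (I : KnapsackInstance ℝ n) (x : Fin n → ℝ) : ℝ := ∑ i, I.p i * x i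

/-- The set of objective values of feasible solutions. -/
def values {n : ℕ} (I : KnapsackInstance ℝ n) : Set ℝ :=
  {v | ∃ x y, I.Feasible x y ∧ v = I.profit x}

/-- `(x, y)` is feasible, an optimal value `opt` exists, and the value of `(x, y)` is at least
`(1 - ε) * opt`. -/
def IsApproxSolution {n : ℕ} (I : KnapsackInstance ℝ n) (ε : ℝ) (x y : Fin n → ℝ) : Prop :=
  I.Feasible x y ∧ ∃ opt, IsGreatest I.values opt ∧ (1 - ε) * opt ≤ I.profit x

/-- A rational instance regarded as a real one. -/
def toReal {n : ℕ} (I : KnapsackInstance ℚ n) : KnapsackInstance ℝ n where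
  p i := (I.p i : ℝ)
  w i := (I.w i : ℝ)
  wbar i := (I.wbar i : ℝ)
  c i := (I.c i : ℝ)
  B := (I.B : ℝ)
  C := (I.C : ℝ)

end KnapsackInstance

/-! ### Random access machines over an ordered field

Memory consists of arrays of natural numbers (indices) and arrays of field elements (numbers);
array names are fixed by the program, positions are computed. Available are addition and truncated
subtraction of indices, the four field operations on numbers, comparisons, the conversion of an
index to a number, indirect addressing, conditionals and loops. There is no rounding operation and
no multiplication of indices. The program text does not depend on the field. -/

namespace RAM

/-- A memory state; arrays are indexed by name and position. -/
structure Store (K : Type) where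
  idx : ℕ → ℕ → ℕ
  num : ℕ → ℕ → K

/-- Index-valued expressions. -/
inductive IExp where
  | lit (m : ℕ)
  | read (a : ℕ) (pos : IExp)
  | plus (e f : IExp)
  | minus (e f : IExp)

/-- Number-valued expressions. -/
inductive NExp where
  | ofIdx (e : IExp)
  | read (a : ℕ) (pos : IExp)
  | plus (e f : NExp)
  | minus (e f : NExp)
  | times (e f : NExp)
  | quot (e f : NExp)

/-- Tests. -/
inductive Test where
  | idxLe (e f : IExp)
  | numLe (e f : NExp)
  | neg (b : Test)
  | conj (b d : Test)

/-- Programs. -/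
inductive Prog where
  | skip
  | setIdx (a : ℕ) (pos : IExp) (e : IExp)
  | setNum (a : ℕ) (pos : IExp) (e : NExp)
  | seq (P Q : Prog)
  | cond (b : Test) (P Q : Prog)
  | loop (b : Test) (P : Prog)

/-- A cost model charges every operation `1` plus the size of the value it produces. -/
structure CostModel (K : Type) where
  idxSize : ℕ → ℕ
  numSize : K → ℕ

/-- Unit cost: every operation costs `1`. -/
def CostModel.unit (K : Type) : CostModel K where
  idxSize _ := 0
  numSize _ := 0

/-- The bit length of a rational number: of its numerator plus that of its denominator, in lowest
terms. -/
def ratSize (r : ℚ) : ℕ := r.num.natAbs.size + r.den.size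

/-- Logarithmic cost: every operation is charged for the bit lengths of the values it handles. -/
def CostModel.bits : CostModel ℚ where
  idxSize := Nat.size
  numSize := ratSize

section Semantics

variable {K : Type} [Field K] [LinearOrder K]

def IExp.eval (s : Store K) : IExp → ℕ
  | .lit m => m
  | .read a pos => s.idx a (pos.eval s)
  | .plus e f => e.eval s + f.eval s
  | .minus e f => e.eval s - f.eval s

/-- Division by zero returns zero. -/
def NExp.eval (s : Store K) : NExp → K
  | .ofIdx e => (e.eval s : K)
  | .read a pos => s.num a (pos.eval s)
  | .plus e f => e.eval s + f.eval s
  | .minus e f => e.eval s - f.eval s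
  | .times e f => e.eval s * f.eval s
  | .quot e f => e.eval s / f.eval s

def Test.holds (s : Store K) : Test → Prop
  | .idxLe e f => e.eval s ≤ f.eval s
  | .numLe e f => e.eval s ≤ f.eval s
  | .neg b => ¬ b.holds s
  | .conj b d => b.holds s ∧ d.holds s

/-- The cost of evaluating an index expression: each node costs `1` plus the size of its value. -/
def IExp.cost (M : CostModel K) (s : Store K) : IExp → ℕ
  | .lit m => 1 + M.idxSize m
  | .read a pos => pos.cost M s + 1 + M.idxSize (s.idx a (pos.eval s))
  | .plus e f => e.cost M s + f.cost M s + 1 + M.idxSize (e.eval s + f.eval s)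
  | .minus e f => e.cost M s + f.cost M s + 1 + M.idxSize (e.eval s - f.eval s)

/-- The cost of evaluating a number expression: each node costs `1` plus the size of its value. -/
def NExp.cost (M : CostModel K) (s : Store K) : NExp → ℕ
  | .ofIdx e => e.cost M s + 1 + M.numSize (e.eval s : K)
  | .read a pos => pos.cost M s + 1 + M.numSize (s.num a (pos.eval s))
  | .plus e f => e.cost M s + f.cost M s + 1 + M.numSize (e.eval s + f.eval s)
  | .minus e f => e.cost M s + f.cost M s + 1 + M.numSize (e.eval s - f.eval s)
  | .times e f => e.cost M s + f.cost M s + 1 + M.numSize (e.eval s * f.eval s)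
  | .quot e f => e.cost M s + f.cost M s + 1 + M.numSize (e.eval s / f.eval s)

def Test.cost (M : CostModel K) (s : Store K) : Test → ℕ
  | .idxLe e f => e.cost M s + f.cost M s + 1
  | .numLe e f => e.cost M s + f.cost M s + 1
  | .neg b => b.cost M s + 1
  | .conj b d => b.cost M s + d.cost M s + 1

/-- Overwrite one index cell. -/
def Store.setIdx (s : Store K) (a i m : ℕ) : Store K where
  idx := Function.update s.idx a (Function.update (s.idx a) i m)
  num := s.num

/-- Overwrite one number cell. -/
def Store.setNum (s : Store K) (a i : ℕ) (r : K) : Store K where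
  idx := s.idx
  num := Function.update s.num a (Function.update (s.num a) i r)

/-- `Exec M P s s' t`: started in the state `s`, the program `P` halts in the state `s'`, at total
cost `t` in the cost model `M`. Execution is deterministic. -/
inductive Exec (M : CostModel K) : Prog → Store K → Store K → ℕ → Prop where
  | skip (s : Store K) : Exec M .skip s s 1
  | setIdx (s : Store K) (a : ℕ) (pos e : IExp) :
      Exec M (.setIdx a pos e) s (s.setIdx a (pos.eval s) (e.eval s))
        (pos.cost M s + e.cost M s + 1)
  | setNum (s : Store K) (a : ℕ) (pos : IExp) (e : NExp) :
      Exec M (.setNum a pos e) s (s.setNum a (pos.eval s) (e.eval s))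
        (pos.cost M s + e.cost M s + 1)
  | seq {P Q : Prog} {s s' s'' : Store K} {t t' : ℕ} :
      Exec M P s s' t → Exec M Q s' s'' t' → Exec M (.seq P Q) s s'' (t + t')
  | condTrue {b : Test} {P Q : Prog} {s s' : Store K} {t : ℕ} :
      b.holds s → Exec M P s s' t → Exec M (.cond b P Q) s s' (b.cost M s + t + 1)
  | condFalse {b : Test} {P Q : Prog} {s s' : Store K} {t : ℕ} :
      ¬ b.holds s → Exec M Q s s' t → Exec M (.cond b P Q) s s' (b.cost M s + t + 1)
  | loopTrue {b : Test} {P : Prog} {s s' s'' : Store K} {t t' : ℕ} :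
      b.holds s → Exec M P s s' t → Exec M (.loop b P) s' s'' t' →
        Exec M (.loop b P) s s'' (b.cost M s + t + t' + 1)
  | loopFalse {b : Test} {P : Prog} {s : Store K} :
      ¬ b.holds s → Exec M (.loop b P) s s (b.cost M s + 1)

end Semantics

/-- The content of a memory array that holds a finite sequence, followed by zeros. -/
def fill {K : Type} [Zero K] {n : ℕ} (f : Fin n → K) (j : ℕ) : K :=
  if h : j < n then f ⟨j, h⟩ else 0

end RAM

namespace KnapsackInstance

/-- The initial memory: index array `0` holds `n`, number array `0` holds `B, C`, and number arrays
`1, 2, 3, 4` hold `p, w, wbar, c`. All other cells are zero. -/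
def load {K : Type} [Field K] {n : ℕ} (I : KnapsackInstance K n) : RAM.Store K where
  idx
    | 0, 0 => n
    | _, _ => 0
  num
    | 0 => RAM.fill ![I.B, I.C]
    | 1 => RAM.fill I.p
    | 2 => RAM.fill I.w
    | 3 => RAM.fill I.wbar
    | 4 => RAM.fill I.c
    | _ => fun _ => 0

/-- The encoding length of a rational instance: the number of items plus the bit lengths of all
the data. -/
def bitSize {n : ℕ} (I : KnapsackInstance ℚ n) : ℕ :=
  n + ∑ i, (RAM.ratSize (I.p i) + RAM.ratSize (I.w i) + RAM.ratSize (I.wbar i)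
    + RAM.ratSize (I.c i)) + RAM.ratSize I.B + RAM.ratSize I.C

end KnapsackInstance

namespace RAM

/-- The output vector `x`: the first `n` cells of number array `5`. -/
def Store.outX {K : Type} (n : ℕ) (s : Store K) (i : Fin n) : K := s.num 5 i

/-- The output vector `y`: the first `n` cells of number array `6`. -/
def Store.outY {K : Type} (n : ℕ) (s : Store K) (i : Fin n) : K := s.num 6 i

end RAM

/-! ### Greedy orders and effective weights -/

/-! Pricing the improvement budget at `r ≥ 0` turns an item into one of effective weight `min (w i)
(w i - wb i + r * c i)`. By LP duality for the fractional knapsack in `y`, a selection `X` has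
feasible improvements if and only if its effective weights sum to at most `B + r * C` for every `r ≥
0`. Only the profitable items of an optimum matter, and they satisfy these inequalities
(`exists_profitable`). Conversely, greedy improvement in the order of `c / wb`, with at most one
fractional item, realizes any selection that satisfies them (`ItemData.exists_improvement`).

The task is therefore a knapsack problem with a continuum of constraints. Guess the `k` most
profitable items of the optimum; each other item of the optimum has profit at most `q`, the least
guessed profit. For a fixed price, greedy filling in the order of effective weight over profit loses
at most one item (`sum_lt_of_greedy`). To satisfy all prices at once, note that the excess of usage
over capacity is concave in `r`, so a selection that fits at `r` fits at all smaller or at all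
larger prices (`fitsBelow_or_fitsAbove`). The greedy order changes only at the critical prices,
which are indexed by pairs of items and a binary choice. Along the critical prices there is a place
where the maximal greedy selection switches from fitting below to fitting above. If this happens
within one order, an initial segment of it fits everywhere (`attains_of_interval`). If it happens
between two neighbouring orders at a common critical price, passing from one order to the other item
by item gives two consecutive selections of opposite type, whose common part fits everywhere
(`attains_of_orders`). At most `2 * q` is lost, and `k * q` is at most the profit of the guessed
items, so the relative loss is at most `2 / k ≤ ε`.

Everything needed is described by `18 + k` indices between `0` and `n` (`ItemData.exists_guess`):
the guessed items, the item improved fractionally, the ends of two greedy segments, the profit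
bound, and two sample prices that lie strictly between critical prices. The program tries all these
tuples in nested loops and keeps the best feasible solution.

For the running time, programs are written in a language of bounded loops with a functional
semantics `Cmd.run` and an explicit cost bound (`Cmd.exec`). Bit lengths stay polynomial because
arrays are stratified into levels: a number is computed from lower levels, or is a partial sum of
such numbers, so repetition over the guesses causes no growth (`Cmd.Leveled.safe`). Correctness is
proved over the reals and transferred to the rationals by `Cmd.run_toReal`. -/

theorem exists_crossing {P : ℕ → Prop} {T : ℕ} (h0 : P 0) (hT : ¬ P T) :
    ∃ t < T, P t ∧ ¬ P (t + 1) := by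
  induction T with
  | zero => exact absurd h0 hT
  | succ T ih =>
    by_cases h : P T
    · exact ⟨T, T.lt_succ_self, h, hT⟩
    · obtain ⟨t, ht, h'⟩ := ih h
      exact ⟨t, ht.trans T.lt_succ_self, h'⟩

namespace Greedy

/-- Item `i` comes before item `j` in the order of nondecreasing ratio `e / p`, ties being broken
by the index. -/
def Precedes (p e : ℕ → ℝ) (i j : ℕ) : Prop :=
  p j * e i ≤ p i * e j ∧ (p j * e i < p i * e j ∨ i < j)

theorem precedes_iff_toLex {p e : ℕ → ℝ} {i j : ℕ} (hi : 0 < p i) (hj : 0 < p j) :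
    Precedes p e i j ↔ toLex (e i / p i, i) < toLex (e j / p j, j) := by
  have h : e i / p i < e j / p j ↔ p j * e i < p i * e j := by
    rw [div_lt_div_iff₀ hi hj, mul_comm (e i), mul_comm (e j)]
  have h' : e i / p i = e j / p j ↔ p j * e i = p i * e j := by
    rw [div_eq_div_iff hi.ne' hj.ne', mul_comm (e i), mul_comm (e j)]
  rw [Prod.Lex.toLex_lt_toLex, h, h', Precedes, le_iff_lt_or_eq]
  tauto

/-- The rank function of a greedy order on `N`. -/
structure IsRank (p e : ℕ → ℝ) (N : Finset ℕ) (π : ℕ → ℕ) : Prop where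
  precedes_iff : ∀ i ∈ N, ∀ j ∈ N, Precedes p e i j ↔ π i < π j
  inj : ∀ i ∈ N, ∀ j ∈ N, π i = π j → i = j
  lt_card : ∀ i ∈ N, π i < N.card

/-- The rank of an item counts the items with a smaller key (ratio, index). The index component
makes the keys distinct, so the order is total. -/
theorem exists_rank {p : ℕ → ℝ} (e : ℕ → ℝ) (N : Finset ℕ) (hp : ∀ i ∈ N, 0 < p i) :
    ∃ π : ℕ → ℕ, IsRank p e N π := by
  classical
  let key : ℕ → ℝ ×ₗ ℕ := fun i => toLex (e i / p i, i)
  have hkey : Function.Injective key := fun i j h => by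
    simpa [key] using congrArg (fun x => (ofLex x).2) h
  let π : ℕ → ℕ := fun i => (N.filter fun j => key j < key i).card
  have mono : ∀ i ∈ N, ∀ j ∈ N, key i < key j → π i < π j := by
    intro i hi j hj h
    apply Finset.card_lt_card
    refine ⟨fun x hx => ?_, fun hsub => ?_⟩
    · simp only [Finset.mem_filter] at hx ⊢
      exact ⟨hx.1, hx.2.trans h⟩
    · have := hsub (Finset.mem_filter.2 ⟨hi, h⟩)
      exact lt_irrefl _ (Finset.mem_filter.1 this).2
  have iff : ∀ i ∈ N, ∀ j ∈ N, key i < key j ↔ π i < π j := by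
    intro i hi j hj
    refine ⟨mono i hi j hj, fun h => ?_⟩
    by_contra hn
    rcases (not_lt.1 hn).lt_or_eq with h' | h'
    · exact absurd (mono j hj i hi h') (by omega)
    · rw [hkey h'] at h; omega
  refine ⟨π, fun i hi j hj => ?_, fun i hi j hj h => ?_, fun i hi => ?_⟩
  · rw [precedes_iff_toLex (hp i hi) (hp j hj)]
    exact iff i hi j hj
  · rcases lt_trichotomy (key i) (key j) with h' | h' | h'
    · exact absurd (mono i hi j hj h') (by omega)
    · exact hkey h'
    · exact absurd (mono j hj i hi h') (by omega)
  · apply Finset.card_lt_card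
    refine ⟨Finset.filter_subset _ _, fun hsub => ?_⟩
    exact lt_irrefl _ (Finset.mem_filter.1 (hsub hi)).2

/-- An index that marks where the items of rank at least `t` begin. -/
theorem IsRank.exists_marker {n : ℕ} {p e : ℕ → ℝ} {N : Finset ℕ} {π : ℕ → ℕ}
    (hπ : IsRank p e N π) (hN : ∀ i ∈ N, i < n) (hpn : p n = 0) (hen : e n = 0) (t : ℕ) :
    ∃ a ≤ n, (∀ i ∈ N, Precedes p e i a ↔ π i < t) ∧ ∀ i ∈ N, π i = t → i = a := by
  classical
  by_cases h : (N.filter fun i => t ≤ π i).Nonempty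
  · obtain ⟨a, ha, hmin⟩ := Finset.exists_min_image _ π h
    simp only [Finset.mem_filter] at ha hmin
    refine ⟨a, (hN a ha.1).le, fun i hi => ?_, fun i hi hit => hπ.inj i hi a ha.1 ?_⟩
    · rw [hπ.precedes_iff i hi a ha.1]
      constructor
      · intro h1
        by_contra h2
        have := hmin i ⟨hi, by omega⟩
        omega
      · omega
    · have := hmin i ⟨hi, hit.ge⟩
      omega
  · have h1 : ∀ i ∈ N, π i < t := fun i hi => by
      by_contra h2
      exact h ⟨i, Finset.mem_filter.2 ⟨hi, by omega⟩⟩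
    refine ⟨n, le_rfl, fun i hi => ?_, fun i hi hit => absurd (h1 i hi) (by omega)⟩
    simp [Precedes, hpn, hen, hN i hi, h1 i hi]

/-- If the greedy choice `Z` followed by `b` uses more capacity than `Z'`, then it has the larger
profit. -/
theorem sum_lt_of_greedy {p ω : ℕ → ℝ} {N Z Z' : Finset ℕ} {b : ℕ} (hZ' : Z' ⊆ N)
    (hpb : 0 < p b) (hωb : 0 ≤ ω b) (hbZ : b ∉ Z)
    (hin : ∀ i ∈ Z, p b * ω i ≤ p i * ω b)
    (hout : ∀ i ∈ N, i ∉ Z → p i * ω b ≤ p b * ω i)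
    (h : ∑ i ∈ Z', ω i < ∑ i ∈ insert b Z, ω i) :
    ∑ i ∈ Z', p i < ∑ i ∈ Z, p i + p b := by
  classical
  set Y := insert b Z with hY
  -- The advantage of `i` over `b` in profit per usage. It is nonnegative on `Y` and nonpositive on
  -- the rest of `N`, so `Y` maximizes its sum among the subsets of `N`.
  let f : ℕ → ℝ := fun i => p i * ω b - p b * ω i
  have h1 := Finset.sum_inter_add_sum_sdiff Z' Y f
  have h2 := Finset.sum_inter_add_sum_sdiff Y Z' f
  have h3 : ∑ i ∈ Z' \ Y, f i ≤ 0 := Finset.sum_nonpos fun i hi => by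
    simp only [Finset.mem_sdiff, hY, Finset.mem_insert, not_or] at hi
    have := hout i (hZ' hi.1) hi.2.2
    simp only [f]; linarith
  have h4 : 0 ≤ ∑ i ∈ Y \ Z', f i := Finset.sum_nonneg fun i hi => by
    simp only [Finset.mem_sdiff, hY, Finset.mem_insert] at hi
    rcases hi.1 with rfl | h'
    · simp [f]
    · have := hin i h'
      simp only [f]; linarith
  rw [Finset.inter_comm] at h2
  have h5 : ∑ i ∈ Z', f i ≤ ∑ i ∈ Y, f i := by linarith
  simp only [f, Finset.sum_sub_distrib, ← Finset.sum_mul, ← Finset.mul_sum] at h5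
  have h6 : 0 < p b * (∑ i ∈ Y, ω i - ∑ i ∈ Z', ω i) := mul_pos hpb (by linarith)
  -- The larger usage of `Y` times `p b` is a lower bound for the gain in profit times `ω b`; as `ω
  -- b ≥ 0`, the gain itself is positive.
  have h7 : 0 < (∑ i ∈ Y, p i - ∑ i ∈ Z', p i) * ω b := by nlinarith
  have h8 := pos_of_mul_pos_left h7 hωb
  rw [hY, Finset.sum_insert hbZ] at h8
  linarith

end Greedy

namespace Greedy

/-! ### Greedy selections for a parametric knapsack constraint -/

/-- The selection `Z` respects the parametric capacity `β` at the parameter `r`. -/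
def Fits (ω : ℕ → ℝ → ℝ) (β : ℝ → ℝ) (Z : Finset ℕ) (r : ℝ) : Prop := ∑ i ∈ Z, ω i r ≤ β r

def FitsBelow (ω : ℕ → ℝ → ℝ) (β : ℝ → ℝ) (Z : Finset ℕ) (r : ℝ) : Prop :=
  ∀ r', 0 ≤ r' → r' ≤ r → Fits ω β Z r'

def FitsAbove (ω : ℕ → ℝ → ℝ) (β : ℝ → ℝ) (Z : Finset ℕ) (r : ℝ) : Prop :=
  ∀ r', r ≤ r' → Fits ω β Z r'

/-- Items `N` of profit at most `q` for a parametric knapsack problem with concave usage, and a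
selection `Z'` that respects all the capacities. -/
structure Parametric (n : ℕ) (p : ℕ → ℝ) (q : ℝ) (ω : ℕ → ℝ → ℝ) (β : ℝ → ℝ)
    (N Z' : Finset ℕ) : Prop where
  p_pos : ∀ i ∈ N, 0 < p i
  p_le : ∀ i ∈ N, p i ≤ q
  q_nonneg : 0 ≤ q
  lt : ∀ i ∈ N, i < n
  p_end : p n = 0
  ω_end : ∀ r, ω n r = 0
  ω_nonneg : ∀ i r, 0 ≤ r → 0 ≤ ω i r
  fitsBelow_or_fitsAbove : ∀ Z r, 0 ≤ r → Fits ω β Z r →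
    FitsBelow ω β Z r ∨ FitsAbove ω β Z r
  subset : Z' ⊆ N
  fits : ∀ r, 0 ≤ r → Fits ω β Z' r

/-- The ranking `π` is a greedy order at the parameter `r`. -/
def Compat (p : ℕ → ℝ) (ω : ℕ → ℝ → ℝ) (N : Finset ℕ) (π : ℕ → ℕ) (r : ℝ) : Prop :=
  ∀ i ∈ N, ∀ j ∈ N, π i < π j → p j * ω i r ≤ p i * ω j r

/-- The first `s` items in the order `π'` together with the first `t` items in the order `π`. -/
def initial (N : Finset ℕ) (π' π : ℕ → ℕ) (s t : ℕ) : Finset ℕ :=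
  N.filter fun i => π' i < s ∨ π i < t

/-- `initial N π' π s t` cannot be extended in the order `π`. -/
def Maximal (ω : ℕ → ℝ → ℝ) (β : ℝ → ℝ) (N : Finset ℕ) (π' π : ℕ → ℕ) (s t : ℕ) (r : ℝ) : Prop :=
  N ⊆ initial N π' π s t ∨ ¬ Fits ω β (initial N π' π s (t + 1)) r

/-- The union of two greedy initial segments, without one item. -/
noncomputable def union (p : ℕ → ℝ) (ω : ℕ → ℝ → ℝ) (N : Finset ℕ) (m' m : ℝ) (a b : ℕ) : Finset ℕ :=
  open Classical in
  N.filter fun i => i ≠ a ∧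
    (Precedes p (fun j => ω j m') i a ∨ Precedes p (fun j => ω j m) i b)

/-- Some union of greedy initial segments respects all the capacities and loses at most `2 * q`. -/
def Attains (n : ℕ) (p : ℕ → ℝ) (q : ℝ) (ω : ℕ → ℝ → ℝ) (β : ℝ → ℝ) (N Z' : Finset ℕ)
    (m' m : ℝ) : Prop :=
  ∃ a ≤ n, ∃ b ≤ n, (∀ r, 0 ≤ r → Fits ω β (union p ω N m' m a b) r) ∧
    ∑ i ∈ Z', p i ≤ ∑ i ∈ union p ω N m' m a b, p i + 2 * q

variable {n : ℕ} {p : ℕ → ℝ} {q : ℝ} {ω : ℕ → ℝ → ℝ} {β : ℝ → ℝ} {N Z' : Finset ℕ}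
  {π π' : ℕ → ℕ}

theorem initial_subset (s t : ℕ) : initial N π' π s t ⊆ N := Finset.filter_subset _ _

theorem initial_mono {s s' t t' : ℕ} (hs : s ≤ s') (ht : t ≤ t') :
    initial N π' π s t ⊆ initial N π' π s' t' := fun i hi => by
  simp only [initial, Finset.mem_filter] at hi ⊢
  exact ⟨hi.1, by omega⟩

theorem initial_zero_left (π'' : ℕ → ℕ) (t : ℕ) : initial N π' π 0 t = initial N π'' π 0 t := by
  ext i; simp [initial]

theorem Parametric.fits_of_subset (H : Parametric n p q ω β N Z') {Y Z : Finset ℕ} {r : ℝ}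
    (hr : 0 ≤ r) (h : Y ⊆ Z) (hZ : Fits ω β Z r) : Fits ω β Y r :=
  (Finset.sum_le_sum_of_subset_of_nonneg h fun i _ _ => H.ω_nonneg i r hr).trans hZ

theorem Parametric.sum_le_of_subset (H : Parametric n p q ω β N Z') {Y Z : Finset ℕ}
    (h : Y ⊆ Z) (hZ : Z ⊆ N) : ∑ i ∈ Y, p i ≤ ∑ i ∈ Z, p i :=
  Finset.sum_le_sum_of_subset_of_nonneg h fun i hi _ => (H.p_pos i (hZ hi)).le

/-- Increase `t` until the selection stops fitting, or until it contains all of `N`. -/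
theorem exists_maximal {r : ℝ} (s : ℕ)
    (hπ : ∀ i ∈ N, π i < N.card) (h0 : Fits ω β (initial N π' π s 0) r) :
    ∃ t, Fits ω β (initial N π' π s t) r ∧ Maximal ω β N π' π s t r := by
  by_cases h : Fits ω β (initial N π' π s N.card) r
  · exact ⟨N.card, h, Or.inl fun i hi => Finset.mem_filter.2 ⟨hi, Or.inr (hπ i hi)⟩⟩
  · obtain ⟨t, -, h1, h2⟩ := exists_crossing (P := fun t => Fits ω β (initial N π' π s t) r) h0 h
    exact ⟨t, h1, Or.inr h2⟩

/-- A maximal greedy selection loses at most the profit of one item. -/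
theorem Parametric.le_of_maximal (H : Parametric n p q ω β N Z') {r : ℝ} (hr : 0 ≤ r) {s t : ℕ}
    (hinj : ∀ i ∈ N, ∀ j ∈ N, π i = π j → i = j)
    (hπ : Compat p ω N π r) (hπ' : Compat p ω N π' r)
    (hfit : Fits ω β (initial N π' π s t) r) (hmax : Maximal ω β N π' π s t r) :
    ∑ i ∈ Z', p i ≤ ∑ i ∈ initial N π' π s t, p i + q := by
  classical
  rcases hmax with hmax | hmax
  · have := H.sum_le_of_subset (H.subset.trans hmax) (initial_subset s t)
    linarith [H.q_nonneg]
  -- The selection for `t` fits and that for `t + 1` does not, so an item is added; it is the unique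
  -- one of rank `t`.
  obtain ⟨b, hb, hb'⟩ : ∃ b ∈ initial N π' π s (t + 1), b ∉ initial N π' π s t := by
    by_contra! h
    exact hmax (H.fits_of_subset hr h hfit)
  simp only [initial, Finset.mem_filter, not_and, not_or] at hb hb'
  obtain ⟨hbs, hbt⟩ := hb' hb.1
  have hbt' : π b = t := by omega
  have hins : initial N π' π s (t + 1) = insert b (initial N π' π s t) := by
    ext i
    simp only [initial, Finset.mem_filter, Finset.mem_insert]
    constructor
    · rintro ⟨hi, h⟩
      by_cases hib : π i = t
      · exact Or.inl (hinj i hi b hb.1 (hib.trans hbt'.symm))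
      · exact Or.inr ⟨hi, by omega⟩
    · rintro (rfl | ⟨hi, h⟩)
      · exact hb
      · exact ⟨hi, by omega⟩
  -- Both orders are greedy at `r`. An item of the selection precedes `b` in one of them, and an
  -- item outside has `π`-rank at least `t = π b`.
  have key := sum_lt_of_greedy (p := p) (ω := fun i => ω i r) (N := N) (b := b)
    (Z := initial N π' π s t) H.subset (H.p_pos b hb.1) (H.ω_nonneg b r hr)
    (fun h => hbt (by simp only [initial, Finset.mem_filter] at h; omega)) ?_ ?_ ?_
  · linarith [H.p_le b hb.1]
  · intro i hi
    simp only [initial, Finset.mem_filter] at hi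
    rcases hi.2 with h | h
    · exact hπ' i hi.1 b hb.1 (by omega)
    · exact hπ i hi.1 b hb.1 (by omega)
  · intro i hi hi'
    simp only [initial, Finset.mem_filter, not_and, not_or] at hi'
    by_cases hib : π i = t
    · rw [hinj i hi b hb.1 (hib.trans hbt'.symm)]
    · exact hπ b hb.1 i hi (by have := hi' hi; omega)
  · rw [← hins]
    exact (H.fits r hr).trans_lt (not_le.1 hmax)

theorem fits_of_fitsBelow_of_fitsAbove {Y : Finset ℕ} {r : ℝ} (h1 : FitsBelow ω β Y r)
    (h2 : FitsAbove ω β Y r) (x : ℝ) (hx : 0 ≤ x) : Fits ω β Y x :=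
  (le_total x r).elim (h1 x hx) (h2 x)

/-- Initial segments of one order, as unions. -/
theorem Parametric.attains_of_initial (H : Parametric n p q ω β N Z') {m : ℝ} (m' : ℝ) {t : ℕ}
    (hπ : IsRank p (fun j => ω j m) N π)
    (hm' : m' = m)
    (hfit : ∀ r, 0 ≤ r → Fits ω β (initial N π π 0 t) r)
    (hle : ∑ i ∈ Z', p i ≤ ∑ i ∈ initial N π π 0 t, p i + q) :
    Attains n p q ω β N Z' m' m := by
  classical
  subst hm'
  obtain ⟨a, han, ha, -⟩ := hπ.exists_marker H.lt H.p_end (H.ω_end m') t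
  have : union p ω N m' m' a a = initial N π π 0 t := by
    ext i
    simp only [union, initial, Finset.mem_filter, or_self, not_lt_zero, false_or]
    refine and_congr_right fun hi => ?_
    rw [ha i hi, and_iff_right_iff_imp]
    rintro h rfl
    have := (ha i hi).2 h
    simp [Precedes] at this
  exact ⟨a, han, a, han, by rwa [this], by rw [this]; linarith [H.q_nonneg]⟩

/-- Two greedy orders at the same parameter, the first with a maximal initial segment that fits
below, the second with one that fits above. -/
theorem Parametric.attains_of_orders (H : Parametric n p q ω β N Z') {r m m' : ℝ} (hr : 0 ≤ r)
    (hπ : IsRank p (fun j => ω j m) N π) (hπ' : IsRank p (fun j => ω j m') N π')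
    (hc : Compat p ω N π r) (hc' : Compat p ω N π' r) {t s₁ : ℕ}
    (hL : FitsBelow ω β (initial N π π 0 t) r) (hLmax : Maximal ω β N π π 0 t r)
    (hR : FitsAbove ω β (initial N π' π' 0 s₁) r) (hRmax : Maximal ω β N π' π' 0 s₁ r) :
    Attains n p q ω β N Z' m' m ∨ Attains n p q ω β N Z' m' m' := by
  classical
  have hU : ∀ s, initial N π' π s 0 = initial N π' π' 0 s := fun s => by ext; simp [initial]
  have fit_self : ∀ {Z}, FitsBelow ω β Z r → Fits ω β Z r := fun h => h r hr le_rfl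
  -- Interpolate from the order `π` (at `s = 0`) to the order `π'` (at `s = s₁`) one item at a time.
  -- Each stage, filled up along `π`, is greedy at `r` and hence nearly optimal. Either the last
  -- stage fits below as well, or some step changes the side on which the selection fits.
  let P : ℕ → Prop := fun s => ∃ t, FitsBelow ω β (initial N π' π s t) r ∧ Maximal ω β N π' π s t r
  have h0 : P 0 := ⟨t, by rwa [initial_zero_left π], by
    simpa only [Maximal, initial_zero_left (π' := π') π] using hLmax⟩
  by_cases hend : P s₁
  · right
    obtain ⟨t', h1, -⟩ := hend
    have hbelow : FitsBelow ω β (initial N π' π' 0 s₁) r := fun x hx hxr => by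
      rw [← hU]
      exact H.fits_of_subset hx (initial_mono le_rfl t'.zero_le) (h1 x hx hxr)
    exact H.attains_of_initial m' hπ' rfl (fits_of_fitsBelow_of_fitsAbove hbelow hR)
      (H.le_of_maximal hr hπ'.inj hc' hc' (fit_self hbelow) hRmax)
  · left
    obtain ⟨s, hs, ⟨t₁, h1, h1max⟩, hs'⟩ := exists_crossing h0 hend
    have hfit0 : Fits ω β (initial N π' π (s + 1) 0) r := by
      rw [hU]
      exact H.fits_of_subset hr (initial_mono le_rfl hs) (hR r le_rfl)
    obtain ⟨t₂, h2, h2max⟩ := exists_maximal (s + 1) hπ.lt_card hfit0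
    have h2above : FitsAbove ω β (initial N π' π (s + 1) t₂) r :=
      (H.fitsBelow_or_fitsAbove _ r hr h2).resolve_left fun h => hs' ⟨t₂, h, h2max⟩
    -- The stages `s` and `s + 1` differ in their `π'`-part by the item of rank `s`, which can only
    -- be `a`. Without `a`, and cut at `min t₁ t₂`, the selection lies in the one that fits below
    -- and in the one that fits above.
    obtain ⟨a, han, ha, ha'⟩ := hπ'.exists_marker H.lt H.p_end (H.ω_end m') s
    obtain ⟨b, hbn, hb, -⟩ := hπ.exists_marker H.lt H.p_end (H.ω_end m) (min t₁ t₂)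
    have hun : union p ω N m' m a b = (initial N π' π s (min t₁ t₂)).erase a := by
      ext i
      simp only [union, initial, Finset.mem_filter, Finset.mem_erase]
      constructor
      · rintro ⟨hi, hia, h⟩
        rw [ha i hi, hb i hi] at h
        exact ⟨hia, hi, h⟩
      · rintro ⟨hia, hi, h⟩
        rw [← ha i hi, ← hb i hi] at h
        exact ⟨hi, hia, h⟩
    have hsub1 : union p ω N m' m a b ⊆ initial N π' π s t₁ := by
      rw [hun]
      exact (Finset.erase_subset _ _).trans (initial_mono le_rfl (min_le_left _ _))
    have hsub2 : union p ω N m' m a b ⊆ initial N π' π (s + 1) t₂ := by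
      rw [hun]
      exact (Finset.erase_subset _ _).trans (initial_mono s.le_succ (min_le_right _ _))
    refine ⟨a, han, b, hbn, fits_of_fitsBelow_of_fitsAbove (r := r)
      (fun x hx hxr => H.fits_of_subset hx hsub1 (h1 x hx hxr))
      (fun x hx => H.fits_of_subset (hr.trans hx) hsub2 (h2above x hx)), ?_⟩
    have herase : ∀ Y ⊆ N, ∑ i ∈ Y, p i ≤ ∑ i ∈ Y.erase a, p i + q := by
      intro Y hY
      by_cases h : a ∈ Y
      · rw [← Finset.sum_erase_add _ _ h]
        linarith [H.p_le a (hY h)]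
      · rw [Finset.erase_eq_of_notMem h]
        linarith [H.q_nonneg]
    rcases le_total t₁ t₂ with ht | ht
    · rw [hun, min_eq_left ht]
      have := H.le_of_maximal hr hπ.inj hc hc' (fit_self h1) h1max
      linarith [herase _ (initial_subset (N := N) (π' := π') (π := π) s t₁)]
    · have heq : (initial N π' π s t₂).erase a = (initial N π' π (s + 1) t₂).erase a := by
        ext i
        simp only [initial, Finset.mem_filter, Finset.mem_erase]
        refine and_congr_right fun hia => and_congr_right fun hi => ?_
        have : π' i ≠ s := fun h => hia (ha' i hi h)
        omega
      rw [hun, min_eq_right ht, heq]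
      have := H.le_of_maximal hr hπ.inj hc hc' h2 h2max
      linarith [herase _ (initial_subset (N := N) (π' := π') (π := π) (s + 1) t₂)]

/-- One greedy order on an interval of parameters, with a maximal initial segment that fits below
at the left end, and one that fits above at the right end. -/
theorem Parametric.attains_of_interval (H : Parametric n p q ω β N Z') {r₁ r₂ m : ℝ}
    (hr₁ : 0 ≤ r₁) (hr : r₁ ≤ r₂) (hπ : IsRank p (fun j => ω j m) N π)
    (hc : ∀ r, r₁ ≤ r → r ≤ r₂ → Compat p ω N π r) {t₁ t₂ : ℕ}
    (hL : FitsBelow ω β (initial N π π 0 t₁) r₁) (hLmax : Maximal ω β N π π 0 t₁ r₁)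
    (hR : FitsAbove ω β (initial N π π 0 t₂) r₂) (hRmax : Maximal ω β N π π 0 t₂ r₂) :
    Attains n p q ω β N Z' m m := by
  -- Take `t` with `P t` such that the segment for `t + 1` fails at some price `x`. For `x` left or
  -- right of the interval the segment for `t` contains the one for `t₁` or `t₂`; for `x` inside it
  -- is a maximal greedy selection at `x`.
  let P : ℕ → Prop := fun t => ∀ r, 0 ≤ r → Fits ω β (initial N π π 0 t) r
  have hP0 : P 0 := fun r hr' => by
    refine H.fits_of_subset hr' ?_ (H.fits r hr')
    simp [initial]
  have le₁ := H.le_of_maximal hr₁ hπ.inj (hc r₁ le_rfl hr) (hc r₁ le_rfl hr) (hL r₁ hr₁ le_rfl) hLmax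
  have le₂ := H.le_of_maximal (hr₁.trans hr) hπ.inj (hc r₂ hr le_rfl) (hc r₂ hr le_rfl)
    (hR r₂ le_rfl) hRmax
  by_cases hN : P N.card
  · refine H.attains_of_initial m hπ rfl hN ?_
    have : initial N π π 0 N.card = N := by
      ext i
      simp only [initial, Finset.mem_filter, and_iff_left_iff_imp]
      exact fun hi => Or.inr (hπ.lt_card i hi)
    rw [this]
    linarith [H.q_nonneg, H.sum_le_of_subset H.subset subset_rfl]
  obtain ⟨t, -, ht, ht'⟩ := exists_crossing hP0 hN
  refine H.attains_of_initial m hπ rfl ht ?_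
  simp only [P, not_forall] at ht'
  obtain ⟨x, hx, hxt⟩ := ht'
  have mono : ∀ {t'}, t' ≤ t → ∑ i ∈ initial N π π 0 t', p i ≤ ∑ i ∈ initial N π π 0 t, p i :=
    fun h => H.sum_le_of_subset (initial_mono le_rfl h) (initial_subset _ _)
  rcases lt_or_ge x r₁ with h1 | h1
  · have : t₁ ≤ t := by
      by_contra h
      exact hxt (H.fits_of_subset hx (initial_mono le_rfl (not_le.1 h)) (hL x hx h1.le))
    linarith [mono this]
  rcases lt_or_ge r₂ x with h2 | h2
  · have : t₂ ≤ t := by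
      by_contra h
      exact hxt (H.fits_of_subset hx (initial_mono le_rfl (not_le.1 h)) (hR x h2.le))
    linarith [mono this]
  · exact H.le_of_maximal hx hπ.inj (hc x h1 h2) (hc x h1 h2) (ht x hx) (Or.inr hxt)

end Greedy

namespace Greedy

/-! ### Effective weights -/

/-- Admissible item data, zero at the index `n`. -/
structure ItemData (n : ℕ) (p w wb c : ℕ → ℝ) : Prop where
  wb_nonneg : ∀ i, 0 ≤ wb i
  wb_le : ∀ i, wb i ≤ w i
  c_nonneg : ∀ i, 0 ≤ c i
  p_end : p n = 0
  w_end : w n = 0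
  wb_end : wb n = 0
  c_end : c n = 0

/-- The weight of an item when the improvement budget has price `r`. -/
noncomputable def effWeight (w wb c : ℕ → ℝ) (i : ℕ) (r : ℝ) : ℝ := min (w i) (w i - wb i + r * c i)

/-- The capacity left by the items in `S` when the improvement budget has price `r`. -/
noncomputable def capacity (w wb c : ℕ → ℝ) (B C : ℝ) (S : Finset ℕ) (r : ℝ) : ℝ :=
  B + r * C - ∑ i ∈ S, effWeight w wb c i r

/-- The price at which the greedy comparison of the items `i` and `j` may change: item `i` is
improved, item `j` is improved if and only if `τ = 0`. -/
noncomputable def criticalPrice (p w wb c : ℕ → ℝ) (i j τ : ℕ) : ℝ :=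
  (p i * w j - ((1 - τ : ℕ) : ℝ) * (p i * wb j) - p j * (w i - wb i)) /
    (p j * c i - ((1 - τ : ℕ) : ℝ) * (p i * c j))

/-- A price at or between two critical prices, or behind them. -/
noncomputable def samplePrice (p w wb c : ℕ → ℝ) (g : ℕ → ℕ) : ℝ :=
  (criticalPrice p w wb c (g 0) (g 1) (g 2) + criticalPrice p w wb c (g 3) (g 4) (g 5)) /
    ((2 : ℕ) : ℝ) + (g 6 : ℝ)

variable {n : ℕ} {p w wb c : ℕ → ℝ}

theorem ItemData.effWeight_nonneg (H : ItemData n p w wb c) (i : ℕ) {r : ℝ} (hr : 0 ≤ r) :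
    0 ≤ effWeight w wb c i r :=
  le_min ((H.wb_nonneg i).trans (H.wb_le i))
    (add_nonneg (sub_nonneg.2 (H.wb_le i)) (mul_nonneg hr (H.c_nonneg i)))

theorem ItemData.effWeight_end (H : ItemData n p w wb c) (r : ℝ) : effWeight w wb c n r = 0 := by
  simp [effWeight, H.w_end, H.wb_end, H.c_end]

theorem concaveOn_effWeight (i : ℕ) : ConcaveOn ℝ Set.univ (effWeight w wb c i) := by
  have h : ConcaveOn ℝ Set.univ fun r : ℝ => w i - wb i + r * c i :=
    ⟨convex_univ, fun x _ y _ a b _ _ hab => by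
      simp only [smul_eq_mul]
      nlinarith [congrArg (· * (w i - wb i)) hab]⟩
  exact (concaveOn_const (w i) convex_univ).inf h

/-- Effective weights are minima of affine functions, and the items of `S` enter with a positive
sign after subtraction of the capacity. -/
theorem concaveOn_slack (B C : ℝ) (S Z : Finset ℕ) :
    ConcaveOn ℝ Set.univ fun r => ∑ i ∈ Z, effWeight w wb c i r - capacity w wb c B C S r := by
  have hs : ∀ Y : Finset ℕ, ConcaveOn ℝ Set.univ fun r => ∑ i ∈ Y, effWeight w wb c i r := by
    classical
    intro Y
    induction Y using Finset.induction_on with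
    | empty => simpa using concaveOn_const (0 : ℝ) (convex_univ (E := ℝ))
    | insert a s ha ih =>
      simp only [Finset.sum_insert ha]
      exact (concaveOn_effWeight a).add ih
  have h : ConcaveOn ℝ Set.univ fun r : ℝ => -(B + r * C) :=
    ⟨convex_univ, fun x _ y _ a b _ _ hab => by
      simp only [smul_eq_mul]
      nlinarith [congrArg (· * B) hab]⟩
  refine (((hs Z).add (hs S)).add h).congr fun r _ => ?_
  simp only [Pi.add_apply, capacity]
  ring

/-- The prices at which a concave excess is positive form an interval. Violations on both sides of
`r` would force one at `r`. -/
theorem fitsBelow_or_fitsAbove (B C : ℝ) (S Z : Finset ℕ) {r : ℝ}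
    (h : Fits (effWeight w wb c) (capacity w wb c B C S) Z r) :
    FitsBelow (effWeight w wb c) (capacity w wb c B C S) Z r ∨
      FitsAbove (effWeight w wb c) (capacity w wb c B C S) Z r := by
  by_contra! hn
  simp only [FitsBelow, FitsAbove, not_forall] at hn
  obtain ⟨⟨r₁, -, h₁, hf₁⟩, r₂, h₂, hf₂⟩ := hn
  have := (concaveOn_slack (w := w) (wb := wb) (c := c) B C S Z).min_le_of_mem_Icc
    (Set.mem_univ r₁) (Set.mem_univ r₂) ⟨h₁, h₂⟩
  simp only [Fits, not_le] at h hf₁ hf₂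
  rcases min_le_iff.1 this with h' | h' <;> linarith

/-- The nonnegative critical prices. -/
noncomputable def criticalPrices (n : ℕ) (p w wb c : ℕ → ℝ) : Finset ℝ :=
  ((Finset.range (n + 1) ×ˢ Finset.range (n + 1) ×ˢ Finset.range 2).image
    fun x => criticalPrice p w wb c x.1 x.2.1 x.2.2).filter (0 ≤ ·)

theorem mem_criticalPrices {ρ : ℝ} : ρ ∈ criticalPrices n p w wb c ↔
    0 ≤ ρ ∧ ∃ i ≤ n, ∃ j ≤ n, ∃ τ ≤ 1, criticalPrice p w wb c i j τ = ρ := by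
  simp only [criticalPrices, Finset.mem_filter, Finset.mem_image, Finset.mem_product,
    Finset.mem_range, Prod.exists, Nat.lt_succ_iff]
  constructor
  · rintro ⟨⟨i, j, τ, ⟨hi, hj, hτ⟩, h⟩, h0⟩
    exact ⟨h0, i, hi, j, hj, τ, by omega, h⟩
  · rintro ⟨h0, i, hi, j, hj, τ, hτ, h⟩
    exact ⟨⟨i, j, τ, ⟨hi, hj, by omega⟩, h⟩, h0⟩

/-- There is no critical price strictly between `ρ` and `ρ'`. -/
def Gap (n : ℕ) (p w wb c : ℕ → ℝ) (ρ ρ' : ℝ) : Prop :=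
  0 ≤ ρ ∧ ∀ κ ∈ criticalPrices n p w wb c, κ ≤ ρ ∨ ρ' ≤ κ

theorem Gap.criticalPrice {ρ ρ' : ℝ} (h : Gap n p w wb c ρ ρ') {i j τ : ℕ} (hi : i ≤ n)
    (hj : j ≤ n) (hτ : τ ≤ 1) :
    criticalPrice p w wb c i j τ ≤ ρ ∨ ρ' ≤ criticalPrice p w wb c i j τ := by
  rcases le_total 0 (Greedy.criticalPrice p w wb c i j τ) with h0 | h0
  · exact h.2 _ (mem_criticalPrices.2 ⟨h0, i, hi, j, hj, τ, hτ, rfl⟩)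
  · exact Or.inl (h0.trans h.1)

/-- Comparing an item with itself, improved against unimproved, gives the breakpoint of its
effective weight, so breakpoints need no separate family of critical prices. -/
theorem criticalPrice_self (i : ℕ) (hp : 0 < p i) :
    criticalPrice p w wb c i i 1 = wb i / c i := by
  simp only [criticalPrice, le_refl, Nat.sub_eq_zero_of_le, Nat.cast_zero, zero_mul, sub_zero]
  rw [← mul_sub, mul_div_mul_left _ _ hp.ne']
  congr 1; ring

theorem ItemData.effWeight_eq_of_gap (H : ItemData n p w wb c) {ρ ρ' : ℝ}
    (h : Gap n p w wb c ρ ρ') {i : ℕ} (hi : i < n) (hp : 0 < p i) :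
    (∀ r, ρ ≤ r → r ≤ ρ' → effWeight w wb c i r = w i) ∨
      ∀ r, ρ ≤ r → r ≤ ρ' → effWeight w wb c i r = w i - wb i + r * c i := by
  rcases (H.c_nonneg i).eq_or_lt with hc | hc
  · refine Or.inr fun r _ _ => min_eq_right ?_
    rw [← hc]; linarith [H.wb_nonneg i]
  · have := h.criticalPrice hi.le hi.le le_rfl (i := i) (j := i)
    rw [criticalPrice_self i hp, div_le_iff₀ hc, le_div_iff₀ hc] at this
    rcases this with h' | h'
    · refine Or.inl fun r hr _ => min_eq_left ?_
      nlinarith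
    · refine Or.inr fun r _ hr => min_eq_right ?_
      nlinarith

/-- An affine function without a root strictly inside an interval keeps, on the closed interval, the
weak sign it has at an inner point. -/
theorem affine_nonpos_of_gap {A K ρ ρ' m r : ℝ} (hm₁ : ρ < m) (hm₂ : m < ρ') (hr₁ : ρ ≤ r)
    (hr₂ : r ≤ ρ') (hm : A + m * K ≤ 0) (hroot : K ≠ 0 → -A / K ≤ ρ ∨ ρ' ≤ -A / K) :
    A + r * K ≤ 0 := by
  by_contra! hr
  have hK : K ≠ 0 := by rintro rfl; linarith
  obtain ⟨x, hx⟩ : ∃ x, x = -A / K := ⟨_, rfl⟩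
  have hA : A = -(x * K) := by rw [hx]; field_simp
  have hroot := hroot hK
  rw [← hx] at hroot
  have h1 : (m - x) * K ≤ 0 := by rw [hA] at hm; linarith
  have h2 : 0 < (r - x) * K := by rw [hA] at hr; linarith
  rcases hK.lt_or_gt with hK | hK
  · have h3 : x ≤ m := by by_contra! h; nlinarith
    have h4 : r < x := by by_contra! h; nlinarith
    rcases hroot with h | h <;> linarith
  · have h3 : m ≤ x := by by_contra! h; nlinarith
    have h4 : x < r := by by_contra! h; nlinarith
    rcases hroot with h | h <;> linarith

/-- On a gap each effective weight is affine, with or without improvement. In each of the four cases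
the difference of the two sides is affine, and its root, if the slope is nonzero, is a critical
price. -/
theorem ItemData.le_of_gap (H : ItemData n p w wb c) {ρ ρ' m : ℝ} (h : Gap n p w wb c ρ ρ')
    (hm₁ : ρ < m) (hm₂ : m < ρ') {i j : ℕ} (hi : i < n) (hj : j < n) (hpi : 0 < p i)
    (hpj : 0 < p j) (hle : p j * effWeight w wb c i m ≤ p i * effWeight w wb c j m) {r : ℝ}
    (hr₁ : ρ ≤ r) (hr₂ : r ≤ ρ') :
    p j * effWeight w wb c i r ≤ p i * effWeight w wb c j r := by
  have g := fun {i j τ : ℕ} => h.criticalPrice (i := i) (j := j) (τ := τ)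
  have main : ∀ A K : ℝ, (K ≠ 0 → -A / K ≤ ρ ∨ ρ' ≤ -A / K) →
      (∀ x, ρ ≤ x → x ≤ ρ' →
        p j * effWeight w wb c i x - p i * effWeight w wb c j x = A + x * K) →
      p j * effWeight w wb c i r ≤ p i * effWeight w wb c j r := by
    intro A K hroot hAK
    have h1 := hAK m hm₁.le hm₂.le
    have h2 := hAK r hr₁ hr₂
    have := affine_nonpos_of_gap hm₁ hm₂ hr₁ hr₂ (A := A) (K := K) (by linarith) hroot
    linarith
  rcases H.effWeight_eq_of_gap h hi hpi with h1 | h1 <;>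
    rcases H.effWeight_eq_of_gap h hj hpj with h2 | h2
  · refine main (p j * w i - p i * w j) 0 (fun h => absurd rfl h) fun x hx hx' => ?_
    rw [h1 x hx hx', h2 x hx hx']; ring
  · refine main (p j * w i - p i * (w j - wb j)) (-(p i * c j)) (fun _ => ?_) fun x hx hx' => ?_
    -- Here `j` is the improved item, so the root is the critical price with the roles of `i` and
    -- `j` exchanged.
    · have := g hj.le hi.le le_rfl
      rw [Greedy.criticalPrice] at this
      rw [neg_div_neg_eq]
      simpa using this
    · rw [h1 x hx hx', h2 x hx hx']; ring
  · refine main (p j * (w i - wb i) - p i * w j) (p j * c i) (fun _ => ?_) fun x hx hx' => ?_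
    · have := g hi.le hj.le le_rfl
      rw [Greedy.criticalPrice] at this
      rw [neg_sub]
      simpa using this
    · rw [h1 x hx hx', h2 x hx hx']; ring
  · refine main (p j * (w i - wb i) - p i * (w j - wb j)) (p j * c i - p i * c j) (fun _ => ?_)
      fun x hx hx' => ?_
    · have := g hi.le hj.le zero_le_one
      rw [Greedy.criticalPrice] at this
      rw [neg_sub]
      simpa [mul_sub] using this
    · rw [h1 x hx hx', h2 x hx hx']; ring

theorem ItemData.compat_of_gap (H : ItemData n p w wb c) {N : Finset ℕ} (hN : ∀ i ∈ N, i < n)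
    (hp : ∀ i ∈ N, 0 < p i) {ρ ρ' m : ℝ} (h : Gap n p w wb c ρ ρ') (hm₁ : ρ < m) (hm₂ : m < ρ')
    {π : ℕ → ℕ} (hπ : IsRank p (fun j => effWeight w wb c j m) N π) (r : ℝ) (hr₁ : ρ ≤ r)
    (hr₂ : r ≤ ρ') : Compat p (effWeight w wb c) N π r := fun i hi j hj hij =>
  H.le_of_gap h hm₁ hm₂ (hN i hi) (hN j hj) (hp i hi) (hp j hj)
    ((hπ.precedes_iff i hi j hj).2 hij).1 hr₁ hr₂

/-- Above all breakpoints `wb i / c i` the effective weights are constant, whereas `B + r * C` does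
not decrease. -/
theorem ItemData.fitsAbove_of_forall_le (H : ItemData n p w wb c) {B C : ℝ} (hC : 0 ≤ C)
    {S Z : Finset ℕ} {r : ℝ} (hr : ∀ κ ∈ criticalPrices n p w wb c, κ ≤ r)
    (hS : ∀ i ∈ S, i < n ∧ 0 < p i) (hZ : ∀ i ∈ Z, i < n ∧ 0 < p i)
    (h : Fits (effWeight w wb c) (capacity w wb c B C S) Z r) :
    FitsAbove (effWeight w wb c) (capacity w wb c B C S) Z r := by
  intro r' hr'
  have key : ∀ i, i < n ∧ 0 < p i → effWeight w wb c i r' = effWeight w wb c i r := by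
    rintro i ⟨hi, hp⟩
    rcases (H.c_nonneg i).eq_or_lt with hc | hc
    · simp [effWeight, ← hc]
    · have hκ : wb i / c i ≤ r := hr _ (mem_criticalPrices.2
        ⟨div_nonneg (H.wb_nonneg i) hc.le, i, hi.le, i, hi.le, 1, le_rfl,
          criticalPrice_self i hp⟩)
      rw [div_le_iff₀ hc] at hκ
      have hκ' := mul_le_mul_of_nonneg_right hr' hc.le
      rw [effWeight, effWeight, min_eq_left (by linarith), min_eq_left (by linarith)]
  simp only [Fits, capacity] at h ⊢
  rw [Finset.sum_congr rfl fun i hi => key i (hZ i hi),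
    Finset.sum_congr rfl fun i hi => key i (hS i hi)]
  nlinarith

/-- Sample prices suffice for the greedy selection. -/
theorem ItemData.exists_attains (H : ItemData n p w wb c) (hn : 1 ≤ n) {B C q : ℝ} (hC : 0 ≤ C)
    {S N Z' : Finset ℕ} (hS : ∀ i ∈ S, i < n ∧ 0 < p i)
    (P : Parametric n p q (effWeight w wb c) (capacity w wb c B C S) N Z') :
    ∃ g g' : ℕ → ℕ, (∀ v, g v ≤ n) ∧ (∀ v, g' v ≤ n) ∧
      Attains n p q (effWeight w wb c) (capacity w wb c B C S) N Z'
        (samplePrice p w wb c g') (samplePrice p w wb c g) := by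
  classical
  set ω := effWeight w wb c with hω
  set β := capacity w wb c B C S with hβ
  set R := criticalPrices n p w wb c with hR
  -- The dummy index `n` has profit zero, so the numerator of its critical price vanishes.
  have h0R : (0 : ℝ) ∈ R := mem_criticalPrices.2
    ⟨le_rfl, n, le_rfl, n, le_rfl, 0, zero_le_one, by simp [criticalPrice, H.p_end]⟩
  -- the sample price that follows `ρ`
  have hstep : ∀ ρ ∈ R, ∃ m ρ', ρ < m ∧ m < ρ' ∧ Gap n p w wb c ρ ρ' ∧
      (∃ g : ℕ → ℕ, (∀ v, g v ≤ n) ∧ samplePrice p w wb c g = m) ∧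
      (ρ' ∈ R ∨ ∀ κ ∈ R, κ ≤ ρ) := by
    intro ρ hρ
    obtain ⟨hρ0, i, hi, j, hj, τ, hτ, hij⟩ := mem_criticalPrices.1 hρ
    by_cases hne : (R.filter (ρ < ·)).Nonempty
    · obtain ⟨ρ', hρ', hmin⟩ := Finset.exists_min_image _ id hne
      simp only [Finset.mem_filter, id] at hρ' hmin
      obtain ⟨-, i', hi', j', hj', τ', hτ', hij'⟩ := mem_criticalPrices.1 hρ'.1
      refine ⟨(ρ + ρ') / 2, ρ', by linarith, by linarith, ⟨hρ0, fun κ hκ => ?_⟩,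
        ⟨fun v => if v = 0 then i else if v = 1 then j else if v = 2 then τ else if v = 3 then i'
          else if v = 4 then j' else if v = 5 then τ' else 0, fun v => ?_, ?_⟩, Or.inl hρ'.1⟩
      · by_cases h : ρ < κ
        · exact Or.inr (hmin κ ⟨hκ, h⟩)
        · exact Or.inl (not_lt.1 h)
      · dsimp only
        split_ifs <;> omega
      · simp [samplePrice, hij, hij']
    · have hle : ∀ κ ∈ R, κ ≤ ρ := fun κ hκ => by
        by_contra! h
        exact hne ⟨κ, Finset.mem_filter.2 ⟨hκ, h⟩⟩
      -- Behind the last critical price: the average of `ρ` with itself, shifted by the last entry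
      -- `1`, which is admissible because `n ≥ 1`.
      refine ⟨ρ + 1, ρ + 2, by linarith, by linarith, ⟨hρ0, fun κ hκ => Or.inl (hle κ hκ)⟩,
        ⟨fun v => if v = 0 then i else if v = 1 then j else if v = 2 then τ else if v = 3 then i
          else if v = 4 then j else if v = 5 then τ else 1, fun v => ?_, ?_⟩, Or.inr hle⟩
      · dsimp only
        split_ifs <;> omega
      · simp [samplePrice, hij]
  choose! m ρ' hm₁ hm₂ hgap hg hnext using hstep
  have hrank : ∀ x, ∃ π : ℕ → ℕ, IsRank p (fun j => ω j x) N π := fun x =>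
    exists_rank _ N P.p_pos
  choose π hπ using hrank
  let LM : ℝ → ℝ → Prop := fun r x => ∃ t, FitsBelow ω β (initial N (π x) (π x) 0 t) r ∧
    Maximal ω β N (π x) (π x) 0 t r
  let RM : ℝ → ℝ → Prop := fun r x => ∃ t, FitsAbove ω β (initial N (π x) (π x) 0 t) r ∧
    Maximal ω β N (π x) (π x) 0 t r
  have hmax : ∀ r x, 0 ≤ r → ∃ t, Fits ω β (initial N (π x) (π x) 0 t) r ∧
      Maximal ω β N (π x) (π x) 0 t r := fun r x hr =>
    exists_maximal 0 (hπ x).lt_card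
      (P.fits_of_subset hr (by simp [initial]) (P.fits r hr))
  have hLR : ∀ r x, 0 ≤ r → LM r x ∨ RM r x := fun r x hr => by
    obtain ⟨t, h1, h2⟩ := hmax r x hr
    exact (P.fitsBelow_or_fitsAbove _ r hr h1).imp (fun h => ⟨t, h, h2⟩) (fun h => ⟨t, h, h2⟩)
  have hL0 : LM 0 (m 0) := by
    obtain ⟨t, h1, h2⟩ := hmax 0 (m 0) le_rfl
    exact ⟨t, fun x hx hx' => by rwa [le_antisymm hx' hx], h2⟩
  -- The last critical price whose own order has a maximal selection that fits below. Price `0`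
  -- qualifies, since no smaller prices are considered.
  obtain ⟨ρ, hρ, hρmax⟩ := Finset.exists_max_image (R.filter fun ρ => LM ρ (m ρ)) id
    ⟨0, Finset.mem_filter.2 ⟨h0R, hL0⟩⟩
  simp only [Finset.mem_filter, id] at hρ hρmax
  obtain ⟨hρR, t₁, hL, hLmax⟩ := hρ
  have hρ0 : 0 ≤ ρ := (mem_criticalPrices.1 hρR).1
  -- Each order is greedy on its closed gap, hence two neighbouring orders are both greedy at the
  -- critical price that separates them.
  have hcomp : ∀ ρ ∈ R, ∀ r, ρ ≤ r → r ≤ ρ' ρ → Compat p ω N (π (m ρ)) r := fun ρ hρ r h1 h2 =>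
    H.compat_of_gap P.lt P.p_pos (hgap ρ hρ) (hm₁ ρ hρ) (hm₂ ρ hρ) (hπ _) r h1 h2
  have hlt : ∀ ρ ∈ R, ρ < ρ' ρ := fun ρ hρ => (hm₁ ρ hρ).trans (hm₂ ρ hρ)
  obtain ⟨g, hgn, hgm⟩ := hg ρ hρR
  rcases hnext ρ hρR with hρ'R | hlast
  · have hρ'0 : 0 ≤ ρ' ρ := hρ0.trans (hlt ρ hρR).le
    rcases hLR (ρ' ρ) (m ρ) hρ'0 with ⟨t₂, h2, h2max⟩ | ⟨t₂, h2, h2max⟩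
    -- By the choice of `ρ` the next order has no maximal selection at `ρ' ρ` that fits below, so it
    -- has one that fits above: the switch occurs between two orders.
    · have hnot : ¬ LM (ρ' ρ) (m (ρ' ρ)) := fun h =>
        absurd (hρmax _ ⟨hρ'R, h⟩) (not_le.2 (hlt ρ hρR))
      obtain ⟨t₃, h3, h3max⟩ := (hLR _ (m (ρ' ρ)) hρ'0).resolve_left hnot
      obtain ⟨g', hgn', hgm'⟩ := hg _ hρ'R
      rcases P.attains_of_orders hρ'0 (hπ _) (hπ _) (hcomp ρ hρR _ (hlt ρ hρR).le le_rfl)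
        (hcomp _ hρ'R _ le_rfl (hlt _ hρ'R).le) h2 h2max h3 h3max with h | h
      · exact ⟨g, g', hgn, hgn', by rwa [hgm, hgm']⟩
      · exact ⟨g', g', hgn', hgn', by rwa [hgm']⟩
    · exact ⟨g, g, hgn, hgn, by
        rw [hgm]
        exact P.attains_of_interval hρ0 (hlt ρ hρR).le (hπ _) (hcomp ρ hρR) hL hLmax h2 h2max⟩
  · obtain ⟨t₂, h2, h2max⟩ := hmax ρ (m ρ) hρ0
    have h2' := H.fitsAbove_of_forall_le hC hlast hS
      (fun i hi => ⟨P.lt i (initial_subset _ _ hi), P.p_pos i (initial_subset _ _ hi)⟩) h2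
    exact ⟨g, g, hgn, hgn, by
      rw [hgm]
      exact P.attains_of_interval hρ0 le_rfl (hπ _)
        (fun r h1 h2 => hcomp ρ hρR r h1 (h2.trans (hlt ρ hρR).le)) hL hLmax h2' h2max⟩

end Greedy

namespace Greedy

variable {n : ℕ} {p w wb c : ℕ → ℝ}

/-! ### Greedy improvements -/

/-- The items of `X` that are improved before the item `f`. -/
noncomputable def improvedSet (wb c : ℕ → ℝ) (X : Finset ℕ) (f : ℕ) : Finset ℕ :=
  open Classical in X.filter fun i => 0 < wb i ∧ Precedes wb c i f

/-- The part of the item `f` that can be improved after the items before it. -/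
noncomputable def partialImprovement (wb c : ℕ → ℝ) (C : ℝ) (X : Finset ℕ) (f : ℕ) : ℝ :=
  (C - ∑ i ∈ improvedSet wb c X f, c i) / c f

/-- If a selection is feasible for all prices of the improvement budget, then greedy improvements
make it feasible. -/
theorem ItemData.exists_improvement (H : ItemData n p w wb c) {B C : ℝ} (hC : 0 ≤ C)
    {X : Finset ℕ} (hX : ∀ i ∈ X, i < n)
    (h : ∀ r, 0 ≤ r → ∑ i ∈ X, effWeight w wb c i r ≤ B + r * C) :
    ∃ f ≤ n, (f ∈ X ∨ f = n) ∧ 0 ≤ partialImprovement wb c C X f ∧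
      (partialImprovement wb c C X f ≤ 1) ∧ (f = n → partialImprovement wb c C X f = 0) ∧
      ∑ i ∈ improvedSet wb c X f, c i + c f * partialImprovement wb c C X f ≤ C ∧
      ∑ i ∈ X, w i - ∑ i ∈ improvedSet wb c X f, wb i
        - wb f * partialImprovement wb c C X f ≤ B := by
  classical
  set X₁ := X.filter fun i => 0 < wb i with hX₁
  obtain ⟨π, hπ⟩ := exists_rank (p := wb) c X₁ fun i hi => (Finset.mem_filter.1 hi).2
  let Q : ℕ → Prop := fun t => ∑ i ∈ X₁.filter (fun i => π i < t), c i ≤ C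
  -- If the budget pays for all useful improvements, the dummy `f = n` stands for "no fractional
  -- item", and the inequality for price `0` is what is needed.
  by_cases hend : Q X₁.card
  · have hU : improvedSet wb c X n = X₁ := by
      ext i
      simp only [improvedSet, hX₁, Finset.mem_filter]
      refine and_congr_right fun hi => and_iff_left_of_imp fun _ => ?_
      simp [Precedes, H.wb_end, H.c_end, hX i hi]
    have hall : X₁.filter (fun i => π i < X₁.card) = X₁ :=
      Finset.filter_true_of_mem fun i hi => hπ.lt_card i hi
    have h0 : partialImprovement wb c C X n = 0 := by simp [partialImprovement, H.c_end]
    refine ⟨n, le_rfl, Or.inr rfl, h0.ge, h0.le.trans zero_le_one, fun _ => h0, ?_, ?_⟩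
    · rw [h0, hU]
      simpa [Q, hall] using hend
    · have hsum : ∑ i ∈ X₁, wb i = ∑ i ∈ X, wb i :=
        Finset.sum_filter_of_ne fun i _ hi => lt_of_le_of_ne (H.wb_nonneg i) hi.symm
      have := h 0 le_rfl
      have hw : ∑ i ∈ X, effWeight w wb c i 0 = ∑ i ∈ X, (w i - wb i) :=
        Finset.sum_congr rfl fun i _ => by
          rw [effWeight, zero_mul, add_zero, min_eq_right (by linarith [H.wb_nonneg i])]
      rw [hw, Finset.sum_sub_distrib] at this
      rw [h0, hU, hsum]
      linarith
  · obtain ⟨t, -, ht, ht'⟩ := exists_crossing (P := Q) (by simpa [Q] using hC) hend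
    obtain ⟨f, hf, hft⟩ : ∃ f ∈ X₁, π f = t := by
      by_contra! hne
      refine ht' ?_
      have : X₁.filter (fun i => π i < t + 1) = X₁.filter (fun i => π i < t) :=
        Finset.filter_congr fun i hi => by have := hne i hi; omega
      simpa only [Q, this] using ht
    have hfX := Finset.mem_filter.1 hf
    have hU : improvedSet wb c X f = X₁.filter fun i => π i < t := by
      rw [improvedSet, hX₁, Finset.filter_filter]
      refine Finset.filter_congr fun i hi => and_congr_right fun hi' => ?_
      rw [hπ.precedes_iff i (Finset.mem_filter.2 ⟨hi, hi'⟩) f hf, hft]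
    have hU' : X₁.filter (fun i => π i < t + 1) = insert f (improvedSet wb c X f) := by
      rw [hU]
      ext i
      simp only [Finset.mem_filter, Finset.mem_insert]
      constructor
      · rintro ⟨hi, h⟩
        by_cases hit : π i = t
        · exact Or.inl (hπ.inj i hi f hf (hit.trans hft.symm))
        · exact Or.inr ⟨hi, by omega⟩
      · rintro (rfl | ⟨hi, h⟩)
        · exact ⟨hf, by omega⟩
        · exact ⟨hi, by omega⟩
    have hfU : f ∉ improvedSet wb c X f := fun h => by
      obtain ⟨-, -, -, h⟩ := Finset.mem_filter.1 h
      simp at h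
    have hle : ∑ i ∈ improvedSet wb c X f, c i ≤ C := by rw [hU]; exact ht
    have hlt : C < ∑ i ∈ improvedSet wb c X f, c i + c f := by
      have : ¬ ∑ i ∈ X₁.filter (fun i => π i < t + 1), c i ≤ C := ht'
      rw [hU', Finset.sum_insert hfU] at this
      linarith
    have hcf : 0 < c f := by linarith
    have hy : c f * partialImprovement wb c C X f = C - ∑ i ∈ improvedSet wb c X f, c i :=
      mul_div_cancel₀ _ hcf.ne'
    refine ⟨f, (hX f hfX.1).le, Or.inl hfX.1, div_nonneg (by linarith) hcf.le,
      (div_le_one hcf).2 (by linarith), fun hfn => ?_, by linarith, ?_⟩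
    · rw [hfn, H.c_end] at hcf
      exact absurd hcf (lt_irrefl _)
    -- The optimal dual price. Improvement pays exactly for the items before `f`, up to ties, and
    -- the hypothesis at this price is the required weight bound.
    · set r := wb f / c f with hr
      have hrc : r * c f = wb f := div_mul_cancel₀ _ hcf.ne'
      have hin : ∀ i ∈ X, effWeight w wb c i r =
          w i - if i ∈ improvedSet wb c X f then wb i - r * c i else 0 := by
        intro i hi
        split_ifs with hiU
        · have h1 := (Finset.mem_filter.1 hiU).2.2.1
          have h2 : r * c i ≤ wb i := by
            rw [hr, div_mul_eq_mul_div, div_le_iff₀ hcf]; exact h1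
          rw [effWeight, min_eq_right (by linarith)]; ring
        · have h2 : wb i ≤ r * c i := by
            rw [hr, div_mul_eq_mul_div, le_div_iff₀ hcf]
            by_contra! h3
            refine hiU (Finset.mem_filter.2 ⟨hi, ?_, h3.le, Or.inl h3⟩)
            by_contra! h4
            have h5 : wb i = 0 := le_antisymm h4 (H.wb_nonneg i)
            rw [h5, zero_mul] at h3
            exact absurd h3 (not_lt.2 (mul_nonneg (H.wb_nonneg f) (H.c_nonneg i)))
          rw [effWeight, min_eq_left (by linarith), sub_zero]
      have hUX : improvedSet wb c X f ⊆ X := Finset.filter_subset _ _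
      have := h r (div_nonneg (H.wb_nonneg f) hcf.le)
      rw [Finset.sum_congr rfl hin, Finset.sum_sub_distrib, Finset.sum_ite_mem,
        Finset.inter_eq_right.2 hUX, Finset.sum_sub_distrib,
        ← Finset.mul_sum] at this
      have h3 : wb f * partialImprovement wb c C X f =
          r * (C - ∑ i ∈ improvedSet wb c X f, c i) := by
        rw [← hy, ← mul_assoc, hrc]
      rw [h3]
      linarith

/-! ### Guesses -/

theorem exists_top (p : ℕ → ℝ) (X : Finset ℕ) : ∀ k ≤ X.card, ∃ S ⊆ X, S.card = k ∧
    ∀ i ∈ S, ∀ j ∈ X, j ∉ S → p j ≤ p i := by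
  classical
  intro k
  induction k with
  | zero => exact fun _ => ⟨∅, by simp, rfl, by simp⟩
  | succ k ih =>
    intro hk
    obtain ⟨S, hS, hcard, hle⟩ := ih (by omega)
    obtain ⟨a, ha, hmax⟩ := Finset.exists_max_image (X \ S) p
      (by rw [← Finset.card_pos, Finset.card_sdiff_of_subset hS]; omega)
    rw [Finset.mem_sdiff] at ha
    refine ⟨insert a S, Finset.insert_subset ha.1 hS, by
      rw [Finset.card_insert_of_notMem ha.2, hcard], fun i hi j hj hjS => ?_⟩
    rw [Finset.mem_insert, not_or] at hjS
    rcases Finset.mem_insert.1 hi with rfl | hi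
    · exact hmax j (Finset.mem_sdiff.2 ⟨hj, hjS.2⟩)
    · exact hle i hi j hj hjS.2

theorem exists_enumeration {k : ℕ} {S : Finset ℕ} (hS : ∀ i ∈ S, i < n) (hk : S.card ≤ k) :
    ∃ σ : ℕ → ℕ, (∀ t, σ t ≤ n) ∧ ∀ i < n, (∃ t < k, i = σ t) ↔ i ∈ S := by
  -- Unused positions are padded with `n`, which is not an item.
  refine ⟨fun t => S.toList.getD t n, fun t => ?_, fun i hi => ⟨?_, fun h => ?_⟩⟩
  · by_cases h : t < S.toList.length
    · simp only [List.getD_eq_getElem _ _ h]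
      exact (hS _ (Finset.mem_toList.1 (List.getElem_mem h))).le
    · exact (List.getD_eq_default _ _ (not_lt.1 h)).le
  · rintro ⟨t, -, rfl⟩
    by_cases h : t < S.toList.length
    · simp only [List.getD_eq_getElem _ _ h]
      exact Finset.mem_toList.1 (List.getElem_mem h)
    · exact absurd (List.getD_eq_default _ n (not_lt.1 h)) hi.ne
  · obtain ⟨t, ht, h'⟩ := List.getElem_of_mem (Finset.mem_toList.2 h)
    refine ⟨t, ?_, ?_⟩
    · rw [Finset.length_toList] at ht; omega
    · simp only [List.getD_eq_getElem _ _ ht, h']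

/-- The selection that belongs to a guess `G`. Position `1` holds the item that is partially
improved, `2` and `3` the ends of the greedy initial segments, `4` the item that bounds the profits,
`5` to `11` and `12` to `18` the sample prices, and the positions from `19` on hold `k` items. -/
def Chosen (p w wb c : ℕ → ℝ) (k : ℕ) (G : ℕ → ℕ) (i : ℕ) : Prop :=
  (∃ t < k, i = G (19 + t)) ∨ (0 < p i ∧ p i ≤ p (G 4) ∧ i ≠ G 2 ∧
    (Precedes p (fun j => effWeight w wb c j (samplePrice p w wb c fun v => G (12 + v))) i (G 2) ∨
      Precedes p (fun j => effWeight w wb c j (samplePrice p w wb c fun v => G (5 + v))) i (G 3)))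

noncomputable def chosenSet (n : ℕ) (p w wb c : ℕ → ℝ) (k : ℕ) (G : ℕ → ℕ) : Finset ℕ :=
  open Classical in (Finset.range n).filter (Chosen p w wb c k G)

/-- The greedy solution for the guess `G` is feasible. -/
structure GuessFeasible (n : ℕ) (p w wb c : ℕ → ℝ) (B C : ℝ) (k : ℕ) (G : ℕ → ℕ) : Prop where
  partial_nonneg : 0 ≤ partialImprovement wb c C (chosenSet n p w wb c k G) (G 1)
  partial_le_one : partialImprovement wb c C (chosenSet n p w wb c k G) (G 1) ≤ 1
  mem : G 1 ∈ chosenSet n p w wb c k G ∨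
    partialImprovement wb c C (chosenSet n p w wb c k G) (G 1) ≤ 0
  cost_le : ∑ i ∈ improvedSet wb c (chosenSet n p w wb c k G) (G 1), c i +
    c (G 1) * partialImprovement wb c C (chosenSet n p w wb c k G) (G 1) ≤ C
  weight_le : ∑ i ∈ chosenSet n p w wb c k G, w i -
    ∑ i ∈ improvedSet wb c (chosenSet n p w wb c k G) (G 1), wb i -
    wb (G 1) * partialImprovement wb c C (chosenSet n p w wb c k G) (G 1) ≤ B

/-- Some guess leads to a feasible solution of nearly optimal profit. -/
theorem ItemData.exists_guess (H : ItemData n p w wb c) {B C : ℝ} (hC : 0 ≤ C)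
    {k : ℕ} (hk : 1 ≤ k) {X : Finset ℕ} (hX : ∀ i ∈ X, i < n ∧ 0 < p i)
    (h : ∀ r, 0 ≤ r → ∑ i ∈ X, effWeight w wb c i r ≤ B + r * C) :
    ∃ G : ℕ → ℕ, (∀ v, G v ≤ n) ∧ GuessFeasible n p w wb c B C k G ∧
      k * (∑ i ∈ X, p i - ∑ i ∈ chosenSet n p w wb c k G, p i) ≤ 2 * ∑ i ∈ X, p i := by
  classical
  -- it suffices to choose the items
  suffices hs : ∃ G : ℕ → ℕ, (∀ v, G v ≤ n) ∧
      (∀ r, 0 ≤ r → ∑ i ∈ chosenSet n p w wb c k G, effWeight w wb c i r ≤ B + r * C) ∧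
      k * (∑ i ∈ X, p i - ∑ i ∈ chosenSet n p w wb c k G, p i) ≤ 2 * ∑ i ∈ X, p i by
    obtain ⟨G, hG, hfit, hprofit⟩ := hs
    obtain ⟨f, hfn, hf, h1, h2, h3, h4, h5⟩ := H.exists_improvement hC
      (fun i hi => Finset.mem_range.1 (Finset.mem_filter.1 hi).1) hfit
    -- The selection does not read position `1`, so the fractional item may be fixed afterwards.
    have hset : chosenSet n p w wb c k (Function.update G 1 f) = chosenSet n p w wb c k G := by
      have hne : ∀ v, (Function.update G 1 f) (v + 2) = G (v + 2) := fun v => by simp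
      ext i
      simp only [chosenSet, Chosen, Finset.mem_filter, add_comm 19, add_comm 12, add_comm 5]
      simp
    refine ⟨Function.update G 1 f, fun v => ?_, ?_, by rwa [hset]⟩
    · rw [Function.update_apply]
      split_ifs
      exacts [hfn, hG v]
    · constructor <;> rw [hset] <;> simp only [Function.update_self]
      exacts [h1, h2, hf.imp id fun h => (h3 h).le, h4, h5]
  have hXp : 0 ≤ ∑ i ∈ X, p i := Finset.sum_nonneg fun i hi => (hX i hi).2.le
  rcases le_or_gt X.card k with hcard | hcard
  · obtain ⟨σ, hσ, hσX⟩ := exists_enumeration (fun i hi => (hX i hi).1) hcard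
    -- With `n` in position `4` the profit bound is `p n = 0`, which switches the greedy part off;
    -- the selection is exactly `X`.
    let G : ℕ → ℕ := fun v => if v < 19 then n else σ (v - 19)
    have hset : chosenSet n p w wb c k G = X := by
      ext i
      simp only [chosenSet, Chosen, Finset.mem_filter, Finset.mem_range]
      have h1 : ∀ t, G (19 + t) = σ t := fun t => by simp [G]
      have h4 : G 4 = n := by simp [G]
      simp only [h1, h4, H.p_end]
      constructor
      · rintro ⟨hi, h | ⟨h, h', -⟩⟩
        · exact (hσX i hi).1 h
        · exact absurd h (not_lt.2 h')
      · exact fun hi => ⟨(hX i hi).1, Or.inl ((hσX i (hX i hi).1).2 hi)⟩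
    refine ⟨G, fun v => ?_, by rwa [hset], by rw [hset]; simpa using hXp⟩
    simp only [G]
    split_ifs
    exacts [le_rfl, hσ _]
  · obtain ⟨S, hSX, hSk, hS⟩ := exists_top p X k hcard.le
    obtain ⟨b, hb, hbmin⟩ := Finset.exists_min_image S p (Finset.card_pos.1 (by omega))
    obtain ⟨σ, hσ, hσS⟩ := exists_enumeration (k := k) (fun i hi => (hX i (hSX hi)).1) hSk.le
    -- These candidates depend only on the guess, not on `X`. They contain `X \ S`, because `S`
    -- consists of the most profitable items of `X`.
    set N := (Finset.range n).filter fun i => i ∉ S ∧ 0 < p i ∧ p i ≤ p b with hN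
    have hsplit : ∀ F : ℕ → ℝ, ∑ i ∈ X \ S, F i + ∑ i ∈ S, F i = ∑ i ∈ X, F i :=
      fun F => Finset.sum_sdiff hSX
    have P : Parametric n p (p b) (effWeight w wb c) (capacity w wb c B C S) N (X \ S) := {
      p_pos := fun i hi => (Finset.mem_filter.1 hi).2.2.1
      p_le := fun i hi => (Finset.mem_filter.1 hi).2.2.2
      q_nonneg := (hX b (hSX hb)).2.le
      lt := fun i hi => Finset.mem_range.1 (Finset.mem_filter.1 hi).1
      p_end := H.p_end
      ω_end := H.effWeight_end
      ω_nonneg := fun i r hr => H.effWeight_nonneg i hr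
      fitsBelow_or_fitsAbove := fun Z r _ hZ => Greedy.fitsBelow_or_fitsAbove B C S Z hZ
      subset := fun i hi => by
        rw [Finset.mem_sdiff] at hi
        exact Finset.mem_filter.2 ⟨Finset.mem_range.2 (hX i hi.1).1, hi.2, (hX i hi.1).2,
          hS b hb i hi.1 hi.2⟩
      fits := fun r hr => by
        have := h r hr
        rw [← hsplit] at this
        simp only [Fits, capacity]
        linarith }
    have hn : 1 ≤ n := by have := (hX b (hSX hb)).1; omega
    obtain ⟨g, g', hg, hg', a, han, b', hbn', hfit, hle⟩ :=
      H.exists_attains hn hC (fun i hi => hX i (hSX hi)) P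
    let G : ℕ → ℕ := fun v => if v < 2 then n else if v = 2 then a else if v = 3 then b' else
      if v = 4 then b else if v < 12 then g (v - 5) else if v < 19 then g' (v - 12) else σ (v - 19)
    set Z := union p (effWeight w wb c) N (samplePrice p w wb c g') (samplePrice p w wb c g) a b'
      with hZ
    have hdisj : Disjoint Z S := Finset.disjoint_left.2 fun i hi =>
      (Finset.mem_filter.1 (Finset.mem_filter.1 hi).1).2.1
    have hset : chosenSet n p w wb c k G = Z ∪ S := by
      have h19 : ∀ t, G (19 + t) = σ t := fun t => by
        have h1 : ∀ m < 19, 19 + t ≠ m ∧ ¬ 19 + t < m := fun m hm => by omega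
        simp only [G, (h1 2 (by norm_num)).1, (h1 2 (by norm_num)).2, (h1 3 (by norm_num)).1,
          (h1 4 (by norm_num)).1, (h1 12 (by norm_num)).2, if_false,
          show ¬ 19 + t < 19 by omega, Nat.add_sub_cancel_left]
      have h5 : samplePrice p w wb c (fun v => G (5 + v)) = samplePrice p w wb c g := by
        simp [samplePrice, G]
      have h12 : samplePrice p w wb c (fun v => G (12 + v)) = samplePrice p w wb c g' := by
        simp [samplePrice, G]
      have h2 : G 2 = a := by simp [G]
      have h3 : G 3 = b' := by simp [G]
      have h4 : G 4 = b := by simp [G]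
      ext i
      simp only [chosenSet, Chosen, Finset.mem_filter, Finset.mem_range, Finset.mem_union, h19,
        h5, h12, h2, h3, h4, hZ, union, hN]
      constructor
      · rintro ⟨hi, hc⟩
        rw [hσS i hi] at hc
        tauto
      · rintro (⟨⟨hi, -, h1, h2⟩, h3⟩ | hi)
        · exact ⟨hi, Or.inr ⟨h1, h2, h3⟩⟩
        · exact ⟨(hX i (hSX hi)).1, Or.inl ((hσS i (hX i (hSX hi)).1).2 hi)⟩
    refine ⟨G, fun v => ?_, fun r hr => ?_, ?_⟩
    · have := (hX b (hSX hb)).1.le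
      simp only [G]
      split_ifs
      exacts [le_rfl, han, hbn', this, hg _, hg' _, hσ _]
    · rw [hset, Finset.sum_union hdisj]
      have := hfit r hr
      simp only [Fits, capacity] at this
      linarith
    · rw [hset, Finset.sum_union hdisj]
      -- This turns the additive loss `2 * p b` into a relative loss `2 / k`.
      have h1 : k * p b ≤ ∑ i ∈ S, p i := by
        rw [← hSk, ← nsmul_eq_mul]
        exact Finset.card_nsmul_le_sum _ _ _ hbmin
      have h2 : 0 ≤ ∑ i ∈ X \ S, p i :=
        Finset.sum_nonneg fun i hi => (hX i (Finset.mem_sdiff.1 hi).1).2.le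
      have h3 := hsplit p
      have h4 : (k : ℝ) * (∑ i ∈ X, p i - (∑ i ∈ Z, p i + ∑ i ∈ S, p i)) ≤ k * (2 * p b) :=
        mul_le_mul_of_nonneg_left (by linarith) (Nat.cast_nonneg k)
      linarith

end Greedy

namespace RAM

/-! ### Structured commands -/

/-- Commands whose loops run over the indices from `0` to the content of index cell `(0, 0)`,
the counter of the loop `forN v` being the index cell `(1, v)`. -/
inductive Cmd where
  | skip
  | setNum (a : ℕ) (pos : IExp) (e : NExp)
  | seq (c d : Cmd)
  | cond (b : Test) (c d : Cmd)
  | forN (v : ℕ) (c : Cmd)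

/-- The content of a loop counter. -/
abbrev IExp.var (v : ℕ) : IExp := .read 1 (.lit v)

/-- The upper end of all loops. -/
abbrev IExp.last : IExp := .read 0 (.lit 0)

/-- The loop test is inclusive, so loops also visit the index `n`: the dummy item in loops over
items, and the choice "none" in loops over guesses. -/
def Cmd.compile : Cmd → Prog
  | .skip => .skip
  | .setNum a pos e => .setNum a pos e
  | .seq c d => .seq c.compile d.compile
  | .cond b c d => .cond b c.compile d.compile
  | .forN v c => .seq (.setIdx 1 (.lit v) (.lit 0))
      (.loop (.idxLe (.var v) .last)
        (.seq c.compile (.setIdx 1 (.lit v) (.plus (.var v) (.lit 1)))))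

/-- The command changes the loop counter `v`. -/
def Cmd.Writes (v : ℕ) : Cmd → Prop
  | .skip => False
  | .setNum _ _ _ => False
  | .seq c d => c.Writes v ∨ d.Writes v
  | .cond _ c d => c.Writes v ∨ d.Writes v
  | .forN u c => v = u ∨ c.Writes v

/-- No loop changes the counter of an enclosing loop. -/
def Cmd.WellFormed : Cmd → Prop
  | .skip => True
  | .setNum _ _ _ => True
  | .seq c d => c.WellFormed ∧ d.WellFormed
  | .cond _ c d => c.WellFormed ∧ d.WellFormed
  | .forN v c => ¬ c.Writes v ∧ c.WellFormed

/-- The first `k` steps of a loop. -/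
def forSteps {α : Type} (f : ℕ → α → α) : ℕ → α → α
  | 0, s => s
  | k + 1, s => f k (forSteps f k s)

theorem forSteps_induction {α : Type} {f : ℕ → α → α} {P : ℕ → α → Prop} {s : α} (h0 : P 0 s)
    {m : ℕ} (hs : ∀ k < m, ∀ s, P k s → P (k + 1) (f k s)) : P m (forSteps f m s) := by
  induction m with
  | zero => exact h0
  | succ m ih => exact hs m m.lt_succ_self _ (ih fun k hk => hs k (hk.trans m.lt_succ_self))

section Store

variable {K : Type}

@[simp] theorem Store.setIdx_idx_self (s : Store K) (a i m : ℕ) : (s.setIdx a i m).idx a i = m := by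
  simp [Store.setIdx]

theorem Store.setIdx_idx_of_ne (s : Store K) {a i m b j : ℕ} (h : b = a → j ≠ i) :
    (s.setIdx a i m).idx b j = s.idx b j := by
  by_cases hb : b = a
  · subst hb; simp [Store.setIdx, h rfl]
  · simp [Store.setIdx, hb]

@[simp] theorem Store.setIdx_num (s : Store K) (a i m : ℕ) : (s.setIdx a i m).num = s.num := rfl

@[simp] theorem Store.setNum_num_self (s : Store K) (a i : ℕ) (r : K) :
    (s.setNum a i r).num a i = r := by simp [Store.setNum]

theorem Store.setNum_num_of_ne (s : Store K) {a i b j : ℕ} {r : K} (h : b = a → j ≠ i) :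
    (s.setNum a i r).num b j = s.num b j := by
  by_cases hb : b = a
  · subst hb; simp [Store.setNum, h rfl]
  · simp [Store.setNum, hb]

end Store

/-! ### Functional semantics of commands -/

section Run

variable {K : Type} [Field K] [LinearOrder K]

/-- The effect of a command. -/
noncomputable def Cmd.run : Cmd → Store K → Store K
  | .skip, s => s
  | .setNum a pos e, s => s.setNum a (pos.eval s) (e.eval s)
  | .seq c d, s => d.run (c.run s)
  | .cond b c d, s => open Classical in if b.holds s then c.run s else d.run s
  | .forN v c, s =>
    (forSteps (fun k s' => c.run (s'.setIdx 1 v k)) (s.idx 0 0 + 1) s).setIdx 1 v (s.idx 0 0 + 1)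

theorem Cmd.run_idx (c : Cmd) {a v : ℕ} (h : a = 1 → ¬ c.Writes v) (s : Store K) :
    (c.run s).idx a v = s.idx a v := by
  induction c generalizing s with
  | skip => rfl
  | setNum => rfl
  | seq c d hc hd =>
    simp only [Cmd.Writes, not_or] at h
    rw [Cmd.run, hd fun e => (h e).2, hc fun e => (h e).1]
  | cond b c d hc hd =>
    simp only [Cmd.Writes, not_or] at h
    rw [Cmd.run]
    split_ifs
    · exact hc (fun e => (h e).1) s
    · exact hd (fun e => (h e).2) s
  | forN u c hc =>
    simp only [Cmd.Writes, not_or] at h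
    rw [Cmd.run, Store.setIdx_idx_of_ne _ fun e => (h e).1]
    refine forSteps_induction (P := fun _ (s' : Store K) => s'.idx a v = s.idx a v) rfl fun k _ s' hs' => ?_
    rw [hc fun e => (h e).2, Store.setIdx_idx_of_ne _ fun e => (h e).1, hs']

theorem Cmd.run_idx_zero (c : Cmd) (s : Store K) : (c.run s).idx 0 0 = s.idx 0 0 :=
  c.run_idx (fun h => absurd h (by norm_num)) s

end Run

/-! ### Sizes -/

/-- A literal counts with its value, so that every index expression has value at most `nodes * (N +
1)`. -/
def IExp.nodes : IExp → ℕ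
  | .lit m => m + 1
  | .read _ pos => pos.nodes + 1
  | .plus e f => e.nodes + f.nodes + 1
  | .minus e f => e.nodes + f.nodes + 1

def NExp.nodes : NExp → ℕ
  | .ofIdx e => e.nodes + 1
  | .read _ pos => pos.nodes + 1
  | .plus e f => e.nodes + f.nodes + 1
  | .minus e f => e.nodes + f.nodes + 1
  | .times e f => e.nodes + f.nodes + 1
  | .quot e f => e.nodes + f.nodes + 1

def Test.nodes : Test → ℕ
  | .idxLe e f => e.nodes + f.nodes + 1
  | .numLe e f => e.nodes + f.nodes + 1
  | .neg b => b.nodes + 1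
  | .conj b d => b.nodes + d.nodes + 1

/-- All arrays that the expression reads have level at most `L`. -/
def NExp.ReadsBelow (lvl : ℕ → ℕ) (L : ℕ) : NExp → Prop
  | .ofIdx _ => True
  | .read a _ => lvl a ≤ L
  | .plus e f => e.ReadsBelow lvl L ∧ f.ReadsBelow lvl L
  | .minus e f => e.ReadsBelow lvl L ∧ f.ReadsBelow lvl L
  | .times e f => e.ReadsBelow lvl L ∧ f.ReadsBelow lvl L
  | .quot e f => e.ReadsBelow lvl L ∧ f.ReadsBelow lvl L

/-- `h` measures numbers in such a way that the cost model charges at most `2 * h` for them. -/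
structure SizeMeasure {K : Type} [Field K] (M : CostModel K) (h : K → ℕ) : Prop where
  add : ∀ x y, h (x + y) ≤ h x + h y + 1
  sub : ∀ x y, h (x - y) ≤ h x + h y + 1
  mul : ∀ x y, h (x * y) ≤ h x + h y + 1
  div : ∀ x y, h (x / y) ≤ h x + h y + 1
  natCast : ∀ m : ℕ, h m ≤ m + 1
  numSize_le : ∀ x, M.numSize x ≤ 2 * h x
  idxSize_le : ∀ m, M.idxSize m ≤ m

/-- All indices are at most `N + 1`, and the numbers are bounded by `β`. -/
structure Bounded {K : Type} (h : K → ℕ) (N : ℕ) (β : ℕ → ℕ → ℕ) (s : Store K) : Prop where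
  last_le : s.idx 0 0 ≤ N
  idx_le : ∀ a i, s.idx a i ≤ N + 1
  num_le : ∀ a i, h (s.num a i) ≤ β a i

/-- All assignments respect the bounds `β`. -/
def Cmd.Safe {K : Type} [Field K] [LinearOrder K] (h : K → ℕ) (N : ℕ) (β : ℕ → ℕ → ℕ) :
    Cmd → Prop
  | .skip => True
  | .setNum a pos e => ∀ s : Store K, Bounded h N β s → h (e.eval s) ≤ β a (pos.eval s)
  | .seq c d => c.Safe h N β ∧ d.Safe h N β
  | .cond _ c d => c.Safe h N β ∧ d.Safe h N β
  | .forN _ c => c.Safe h N β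

/-- A bound for the cost of a command, in terms of the number of items and the sizes of all
numbers. -/
def Cmd.time (N X : ℕ) : Cmd → ℕ
  | .skip => 1
  | .setNum _ pos e => 3 * pos.nodes ^ 2 * X + 3 * e.nodes ^ 2 * X + 1
  | .seq c d => c.time N X + d.time N X
  | .cond b c d => 3 * b.nodes ^ 2 * X + (c.time N X + d.time N X) + 1
  -- At most `N + 1` passes, and one more share for the initialization and the final test. In a pass
  -- the test, the position and the increment are evaluated; `v + 5` bounds their node counts.
  | .forN v c => (N + 2) * (c.time N X + 3 * (3 * (v + 5) ^ 2 * X) + 2)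

theorem Cmd.exists_polynomial_time (c : Cmd) (X : Polynomial ℕ) :
    ∃ T : Polynomial ℕ, ∀ N, c.time N (X.eval N) = T.eval N := by
  open Polynomial in
  induction c with
  | skip => exact ⟨1, fun N => by simp [Cmd.time]⟩
  | setNum a pos e =>
    exact ⟨C (3 * pos.nodes ^ 2) * X + C (3 * e.nodes ^ 2) * X + 1, fun N => by simp [Cmd.time]⟩
  | seq c d hc hd =>
    obtain ⟨S, hS⟩ := hc
    obtain ⟨T, hT⟩ := hd
    exact ⟨S + T, fun N => by simp [Cmd.time, hS, hT]⟩
  | cond b c d hc hd =>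
    obtain ⟨S, hS⟩ := hc
    obtain ⟨T, hT⟩ := hd
    exact ⟨C (3 * b.nodes ^ 2) * X + (S + T) + 1, fun N => by simp [Cmd.time, hS, hT]⟩
  | forN v c hc =>
    obtain ⟨T, hT⟩ := hc
    exact ⟨(Polynomial.X + 2) * (T + 3 * (C (3 * (v + 5) ^ 2) * X) + 2), fun N => by
      simp [Cmd.time, hT]⟩

theorem Bounded.setIdx {K : Type} {h : K → ℕ} {N : ℕ} {β : ℕ → ℕ → ℕ} {s : Store K}
    (hs : Bounded h N β s) {v m : ℕ} (hm : m ≤ N + 1) :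
    Bounded h N β (s.setIdx 1 v m) where
  last_le := by
    rw [Store.setIdx_idx_of_ne _ (by norm_num)]
    exact hs.last_le
  idx_le a i := by
    by_cases hai : a = 1 ∧ i = v
    · rw [hai.1, hai.2, Store.setIdx_idx_self]
      exact hm
    · rw [Store.setIdx_idx_of_ne _ fun ha hi => hai ⟨ha, hi⟩]
      exact hs.idx_le a i
  num_le := hs.num_le

/-! ### Cost bounds for expressions and commands -/

section Cost

variable {K : Type} [Field K] {M : CostModel K} {h : K → ℕ} {N X : ℕ}
  {β : ℕ → ℕ → ℕ} {s : Store K}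

theorem IExp.eval_le {K : Type} {h : K → ℕ} {s : Store K} (hs : Bounded h N β s) (e : IExp) : e.eval s ≤ e.nodes * (N + 1) := by
  induction e with
  | lit m => simp only [IExp.eval, IExp.nodes]; nlinarith
  | read a pos _ => simp only [IExp.eval, IExp.nodes]; nlinarith [hs.idx_le a (pos.eval s)]
  | plus e f he hf => simp only [IExp.eval, IExp.nodes]; nlinarith
  | minus e f he hf =>
    simp only [IExp.eval, IExp.nodes]
    have := Nat.sub_le (e.eval s) (f.eval s)
    nlinarith

theorem NExp.size_eval_le (hM : SizeMeasure M h) (hs : Bounded h N β s) {lvl : ℕ → ℕ} {L Y : ℕ}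
    (hN : N + 1 ≤ Y) (hY : ∀ a, lvl a ≤ L → ∀ i, β a i ≤ Y) (e : NExp)
    (he : e.ReadsBelow lvl L) : h (e.eval s) ≤ e.nodes * (Y + 1) := by
  induction e with
  | ofIdx e =>
    simp only [NExp.eval, NExp.nodes]
    have h1 := hM.natCast (e.eval s)
    have h2 := e.eval_le hs
    nlinarith [Nat.mul_le_mul_left e.nodes hN]
  | read a pos =>
    simp only [NExp.eval, NExp.nodes]
    have h1 := hs.num_le a (pos.eval s)
    have h2 := hY a he (pos.eval s)
    nlinarith
  | plus e f ie jf =>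
    simp only [NExp.eval, NExp.nodes]
    have h1 := hM.add (e.eval s) (f.eval s)
    nlinarith [ie he.1, jf he.2]
  | minus e f ie jf =>
    simp only [NExp.eval, NExp.nodes]
    have h1 := hM.sub (e.eval s) (f.eval s)
    nlinarith [ie he.1, jf he.2]
  | times e f ie jf =>
    simp only [NExp.eval, NExp.nodes]
    have h1 := hM.mul (e.eval s) (f.eval s)
    nlinarith [ie he.1, jf he.2]
  | quot e f ie jf =>
    simp only [NExp.eval, NExp.nodes]
    have h1 := hM.div (e.eval s) (f.eval s)
    nlinarith [ie he.1, jf he.2]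

theorem IExp.cost_le (hM : SizeMeasure M h) (hs : Bounded h N β s) (hN : N + 2 ≤ X) (e : IExp) :
    e.cost M s ≤ 3 * e.nodes ^ 2 * X := by
  have size : ∀ e : IExp, M.idxSize (e.eval s) ≤ e.nodes * X := fun e =>
    (hM.idxSize_le _).trans ((e.eval_le hs).trans (Nat.mul_le_mul_left _ (by omega)))
  induction e with
  | lit m =>
    have := size (.lit m)
    simp only [IExp.cost, IExp.nodes, IExp.eval] at this ⊢
    nlinarith [Nat.zero_le (m * X), Nat.zero_le (m * m * X)]
  | read a pos ih =>
    have := size (.read a pos)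
    simp only [IExp.cost, IExp.nodes, IExp.eval] at this ⊢
    nlinarith [Nat.zero_le (pos.nodes * X)]
  | plus e f he hf =>
    have := size (.plus e f)
    simp only [IExp.cost, IExp.nodes, IExp.eval] at this ⊢
    nlinarith [Nat.zero_le (e.nodes * f.nodes * X), Nat.zero_le (e.nodes * X),
      Nat.zero_le (f.nodes * X)]
  | minus e f he hf =>
    have := size (.minus e f)
    simp only [IExp.cost, IExp.nodes, IExp.eval] at this ⊢
    nlinarith [Nat.zero_le (e.nodes * f.nodes * X), Nat.zero_le (e.nodes * X),
      Nat.zero_le (f.nodes * X)]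

/-- A node is charged for a value whose size may be proportional to the number of nodes below it;
the quadratic bound absorbs this charge. -/
theorem cost_step {x y X c₁ c₂ z : ℕ} (hX : 1 ≤ X) (h₁ : c₁ ≤ 3 * x ^ 2 * X)
    (h₂ : c₂ ≤ 3 * y ^ 2 * X) (hz : z ≤ 2 * ((x + y + 1) * X)) :
    c₁ + c₂ + 1 + z ≤ 3 * (x + y + 1) ^ 2 * X := by
  nlinarith [Nat.zero_le (x * y * X), Nat.zero_le (x * X), Nat.zero_le (y * X)]

theorem NExp.readsBelow_of_forall_le {lvl : ℕ → ℕ} {L : ℕ} (h : ∀ a, lvl a ≤ L) (e : NExp) :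
    e.ReadsBelow lvl L := by
  induction e with
  | ofIdx e => trivial
  | read a pos => exact h a
  | plus e f he hf => exact ⟨he, hf⟩
  | minus e f he hf => exact ⟨he, hf⟩
  | times e f he hf => exact ⟨he, hf⟩
  | quot e f he hf => exact ⟨he, hf⟩

theorem NExp.cost_le (hM : SizeMeasure M h) (hs : Bounded h N β s) (hN : N + 2 ≤ X)
    (hX : ∀ a i, β a i + 1 ≤ X) (e : NExp) : e.cost M s ≤ 3 * e.nodes ^ 2 * X := by
  have size : ∀ e : NExp, M.numSize (e.eval s) ≤ 2 * (e.nodes * X) := fun e => by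
    have h1 := e.size_eval_le hM hs (lvl := fun _ => 0) (L := 0) (Y := X - 1) (by omega)
      (fun a _ i => by have := hX a i; omega) (e.readsBelow_of_forall_le fun _ => le_rfl)
    rw [show X - 1 + 1 = X by omega] at h1
    exact (hM.numSize_le _).trans (Nat.mul_le_mul_left _ h1)
  have h1X : 1 ≤ X := by omega
  induction e with
  | ofIdx e =>
    have h1 := size (.ofIdx e)
    have h2 := e.cost_le hM hs hN
    exact cost_step (y := 0) (c₂ := 0) h1X h2 (by simp) h1
  | read a pos =>
    have h1 := size (.read a pos)
    have h2 := pos.cost_le hM hs hN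
    exact cost_step (y := 0) (c₂ := 0) h1X h2 (by simp) h1
  | plus e f he hf => exact cost_step h1X he hf (size (.plus e f))
  | minus e f he hf => exact cost_step h1X he hf (size (.minus e f))
  | times e f he hf => exact cost_step h1X he hf (size (.times e f))
  | quot e f he hf => exact cost_step h1X he hf (size (.quot e f))

theorem Test.cost_le (hM : SizeMeasure M h) (hs : Bounded h N β s) (hN : N + 2 ≤ X)
    (hX : ∀ a i, β a i + 1 ≤ X) (b : Test) : b.cost M s ≤ 3 * b.nodes ^ 2 * X := by
  have h1X : 1 ≤ X := by omega
  induction b with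
  | idxLe e f =>
    exact cost_step (z := 0) h1X (e.cost_le hM hs hN) (f.cost_le hM hs hN) (Nat.zero_le _)
  | numLe e f =>
    exact cost_step (z := 0) h1X (e.cost_le hM hs hN hX) (f.cost_le hM hs hN hX) (Nat.zero_le _)
  | neg b hb => exact cost_step (y := 0) (c₂ := 0) (z := 0) h1X hb (by simp) (Nat.zero_le _)
  | conj b d hb hd => exact cost_step (z := 0) h1X hb hd (Nat.zero_le _)

variable [LinearOrder K]

theorem Cmd.bounded_run {c : Cmd} (hc : c.Safe h N β) (hs : Bounded h N β s) :
    Bounded h N β (c.run s) := by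
  induction c generalizing s with
  | skip => exact hs
  | setNum a pos e =>
    refine ⟨hs.last_le, hs.idx_le, fun b i => ?_⟩
    by_cases hb : b = a ∧ i = pos.eval s
    · rw [hb.1, hb.2, Cmd.run, Store.setNum_num_self]
      exact hc s hs
    · rw [Cmd.run, Store.setNum_num_of_ne _ fun h1 h2 => hb ⟨h1, h2⟩]
      exact hs.num_le b i
  | seq c d ic id => exact id hc.2 (ic hc.1 hs)
  | cond b c d ic id =>
    rw [Cmd.run]
    split_ifs
    exacts [ic hc.1 hs, id hc.2 hs]
  | forN v c ic =>
    have hn := hs.last_le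
    refine Bounded.setIdx ?_ (by omega)
    refine forSteps_induction (P := fun _ s' => Bounded h N β s') hs fun k hk s' hs' => ?_
    exact ic hc (hs'.setIdx (by omega))

/-- Commands are executed in the time bound. -/
theorem Cmd.exec (hM : SizeMeasure M h) (hN : N + 2 ≤ X) (hX : ∀ a i, β a i + 1 ≤ X) {c : Cmd}
    (hw : c.WellFormed) (hc : c.Safe h N β) (hs : Bounded h N β s) :
    ∃ t, Exec M c.compile s (c.run s) t ∧ t ≤ c.time N X := by
  induction c generalizing s with
  | skip => exact ⟨_, Exec.skip s, le_rfl⟩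
  | setNum a pos e =>
    refine ⟨_, Exec.setNum s a pos e, ?_⟩
    have h1 := pos.cost_le hM hs hN
    have h2 := e.cost_le hM hs hN hX
    simp only [Cmd.time]
    omega
  | seq c d ic id =>
    obtain ⟨t₁, h₁, h₁'⟩ := ic hw.1 hc.1 hs
    obtain ⟨t₂, h₂, h₂'⟩ := id hw.2 hc.2 (Cmd.bounded_run hc.1 hs)
    exact ⟨_, Exec.seq h₁ h₂, Nat.add_le_add h₁' h₂'⟩
  | cond b c d ic id =>
    have hb := b.cost_le hM hs hN hX
    rw [Cmd.run]
    split_ifs with hbs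
    · obtain ⟨t, h₁, h₁'⟩ := ic hw.1 hc.1 hs
      exact ⟨_, Exec.condTrue hbs h₁, by simp only [Cmd.time]; omega⟩
    · obtain ⟨t, h₁, h₁'⟩ := id hw.2 hc.2 hs
      exact ⟨_, Exec.condFalse hbs h₁, by simp only [Cmd.time]; omega⟩
  | forN v c ic =>
    set n := s.idx 0 0 with hn
    have hnN : n ≤ N := hs.last_le
    set f : ℕ → Store K → Store K := fun k s' => c.run (s'.setIdx 1 v k) with hf
    set E := 3 * (v + 5) ^ 2 * X with hE
    have hmono : ∀ x ≤ v + 5, 3 * x ^ 2 * X ≤ E := fun x hx =>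
      Nat.mul_le_mul_right _ (Nat.mul_le_mul_left _ (Nat.pow_le_pow_left hx 2))
    have bnd : ∀ k ≤ n + 1, Bounded h N β (forSteps f k s) ∧ (forSteps f k s).idx 0 0 = n := by
      intro k hk
      refine forSteps_induction (P := fun _ s' => Bounded h N β s' ∧ s'.idx 0 0 = n) ⟨hs, rfl⟩
        fun j hj s' hs' => ⟨Cmd.bounded_run hc (hs'.1.setIdx (by omega)), ?_⟩
      rw [hf, Cmd.run_idx_zero, Store.setIdx_idx_of_ne _ (by norm_num), hs'.2]
    -- Induction on the number `m` of remaining passes, because execution unrolls a loop from the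
    -- front while `forSteps` adds steps at the end.
    have loop : ∀ m ≤ n + 1, ∃ t,
        Exec M (.loop (.idxLe (.var v) .last)
          (.seq c.compile (.setIdx 1 (.lit v) (.plus (.var v) (.lit 1)))))
          ((forSteps f (n + 1 - m) s).setIdx 1 v (n + 1 - m))
          ((forSteps f (n + 1) s).setIdx 1 v (n + 1)) t ∧
        t ≤ m * (c.time N X + 3 * E + 2) + E + 1 := by
      intro m
      induction m with
      | zero =>
        intro _
        obtain ⟨hb, hn0⟩ := bnd (n + 1) le_rfl
        have hb' := hb.setIdx (v := v) (m := n + 1) (by omega)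
        refine ⟨_, Exec.loopFalse ?_, ?_⟩
        · simp [Test.holds, IExp.eval, Store.setIdx_idx_of_ne, hn0]
        · have := (Test.idxLe (.var v) .last).cost_le hM hb' hN hX
          have := hmono (Test.idxLe (.var v) .last).nodes (by simp [Test.nodes, IExp.nodes])
          simp only [Nat.sub_zero] at *
          omega
      | succ m im =>
        intro hm
        obtain ⟨t, ht, ht'⟩ := im (by omega)
        obtain ⟨k, hk⟩ : ∃ k, k = n + 1 - (m + 1) := ⟨_, rfl⟩
        have hk1 : n + 1 - m = k + 1 := by omega
        rw [hk1] at ht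
        rw [← hk]
        obtain ⟨hb, hn0⟩ := bnd k (by omega)
        have hb' := hb.setIdx (v := v) (m := k) (by omega)
        obtain ⟨t', hbody, hbody'⟩ := ic hw.2 hc hb'
        have hb'' := Cmd.bounded_run (c := c) hc hb'
        have hkv : (c.run ((forSteps f k s).setIdx 1 v k)).idx 1 v = k := by
          rw [c.run_idx (fun _ => hw.1), Store.setIdx_idx_self]
        have hinc := Exec.setIdx (M := M) (c.run ((forSteps f k s).setIdx 1 v k)) 1 (.lit v)
          (.plus (.var v) (.lit 1))
        simp only [IExp.eval, hkv] at hinc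
        refine ⟨_, Exec.loopTrue ?_ (Exec.seq hbody hinc) ht, ?_⟩
        · simp only [Test.holds, IExp.eval, Store.setIdx_idx_self]
          rw [Store.setIdx_idx_of_ne _ (by norm_num), hn0]
          omega
        · have h1 := (Test.idxLe (.var v) .last).cost_le hM hb' hN hX
          have h2 := hmono (Test.idxLe (.var v) .last).nodes (by simp [Test.nodes, IExp.nodes])
          have h3 := (IExp.lit v).cost_le hM hb'' hN
          have h4 := hmono (IExp.lit v).nodes (by simp [IExp.nodes])
          have h5 := (IExp.plus (.var v) (.lit 1)).cost_le hM hb'' hN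
          have h6 := hmono (IExp.plus (.var v) (.lit 1)).nodes (by simp [IExp.nodes])
          have h7 : (m + 1) * (c.time N X + 3 * E + 2) =
            m * (c.time N X + 3 * E + 2) + (c.time N X + 3 * E + 2) := by ring
          omega
    obtain ⟨t, ht, ht'⟩ := loop (n + 1) le_rfl
    rw [Nat.sub_self] at ht
    have hinit := Exec.setIdx (M := M) s 1 (.lit v) (.lit 0)
    refine ⟨_, Exec.seq hinit ht, ?_⟩
    have h1 := (IExp.lit v).cost_le hM hs hN
    have h2 := hmono (IExp.lit v).nodes (by simp [IExp.nodes])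
    have h3 := (IExp.lit 0).cost_le hM hs hN
    have h4 := hmono (IExp.lit 0).nodes (by simp [IExp.nodes])
    have h5 : (n + 2) * (c.time N X + 3 * E + 2) ≤ (N + 2) * (c.time N X + 3 * E + 2) :=
      Nat.mul_le_mul_right _ (by omega)
    simp only [Cmd.time, ← hE]
    have h6 : (n + 2) * (c.time N X + 3 * E + 2) =
      (n + 1) * (c.time N X + 3 * E + 2) + (c.time N X + 3 * E + 2) := by ring
    omega

end Cost

/-! ### Bounds by levels -/

/-- The size of the numbers on the level `L`, for expressions with at most `κ` nodes. -/
def levelSize (κ N : ℕ) : ℕ → ℕ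
  | 0 => N + 2
  -- The factor `N + 3` covers the growth of partial sums along an array of level at most `L`.
  | L + 1 => κ * ((N + 3) * levelSize κ N L + 1) + levelSize κ N L

/-- Numbers in an array of level `L` may grow linearly with their position. -/
def levelBound (κ N : ℕ) (lvl : ℕ → ℕ) (a i : ℕ) : ℕ :=
  (min i (N + 2) + 1) * levelSize κ N (lvl a)

theorem levelSize_mono (κ N : ℕ) : Monotone (levelSize κ N) :=
  monotone_nat_of_le_succ fun L => by simp only [levelSize]; omega

theorem le_levelSize (κ N L : ℕ) : N + 2 ≤ levelSize κ N L := levelSize_mono κ N L.zero_le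

theorem exists_polynomial_levelSize (κ L : ℕ) :
    ∃ T : Polynomial ℕ, ∀ N, levelSize κ N L = T.eval N := by
  induction L with
  | zero => exact ⟨Polynomial.X + 2, fun N => by simp [levelSize]⟩
  | succ L ih =>
    obtain ⟨T, hT⟩ := ih
    exact ⟨Polynomial.C κ * ((Polynomial.X + 3) * T + 1) + T, fun N => by simp [levelSize, hT]⟩

theorem levelBound_le {κ N : ℕ} {lvl : ℕ → ℕ} {a L : ℕ} (h : lvl a ≤ L) (i : ℕ) :
    levelBound κ N lvl a i ≤ (N + 3) * levelSize κ N L :=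
  Nat.mul_le_mul (by omega) (levelSize_mono κ N h)

/-- All assignments either read lower levels only, or accumulate such expressions. -/
def Cmd.Leveled (κ : ℕ) (lvl : ℕ → ℕ) : Cmd → Prop
  | .skip => True
  | .setNum a pos e => (∃ L < lvl a, e.ReadsBelow lvl L ∧ e.nodes ≤ κ) ∨
      ∃ e' v, pos = .plus (.var v) (.lit 1) ∧ e = .plus (.read a (.var v)) e' ∧
        ∃ L < lvl a, e'.ReadsBelow lvl L ∧ e'.nodes + 1 ≤ κ
  | .seq c d => c.Leveled κ lvl ∧ d.Leveled κ lvl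
  | .cond _ c d => c.Leveled κ lvl ∧ d.Leveled κ lvl
  | .forN _ c => c.Leveled κ lvl

/-- The bounds are an invariant of the memory, whatever the number of passes: an overwritten number
is bounded by lower levels alone, and a partial sum at a position exceeds the one before it by at
most one unit `levelSize`. -/
theorem Cmd.Leveled.safe {K : Type} [Field K] [LinearOrder K] {M : CostModel K} {h : K → ℕ}
    (hM : SizeMeasure M h) {κ : ℕ} (N : ℕ) {lvl : ℕ → ℕ} {c : Cmd} (hc : c.Leveled κ lvl) :
    c.Safe h N (levelBound κ N lvl) := by
  induction c with
  | skip => trivial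
  | setNum a pos e =>
    intro s hs
    have size : ∀ (e : NExp) (L : ℕ), e.ReadsBelow lvl L →
        h (e.eval s) ≤ e.nodes * ((N + 3) * levelSize κ N L + 1) := fun e L he =>
      e.size_eval_le hM hs (by nlinarith [le_levelSize κ N L]) (fun a ha i => levelBound_le ha i) he
    rcases hc with ⟨L, hL, he, hκ⟩ | ⟨e', v, rfl, rfl, L, hL, he, hκ⟩
    · calc h (e.eval s) ≤ e.nodes * ((N + 3) * levelSize κ N L + 1) := size e L he
        _ ≤ κ * ((N + 3) * levelSize κ N L + 1) := Nat.mul_le_mul_right _ hκ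
        _ ≤ levelSize κ N (L + 1) := by simp only [levelSize]; omega
        _ ≤ levelSize κ N (lvl a) := levelSize_mono κ N hL
        _ ≤ _ := Nat.le_mul_of_pos_left _ (Nat.succ_pos _)
    · have h1 : h (e'.eval s) + 1 ≤ levelSize κ N (lvl a) := by
        calc h (e'.eval s) + 1 ≤ e'.nodes * ((N + 3) * levelSize κ N L + 1) + 1 :=
              Nat.add_le_add_right (size e' L he) 1
          _ ≤ (e'.nodes + 1) * ((N + 3) * levelSize κ N L + 1) := by
              nlinarith [Nat.zero_le ((N + 3) * levelSize κ N L)]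
          _ ≤ κ * ((N + 3) * levelSize κ N L + 1) := Nat.mul_le_mul_right _ hκ
          _ ≤ levelSize κ N (L + 1) := by simp only [levelSize]; omega
          _ ≤ levelSize κ N (lvl a) := levelSize_mono κ N hL
      have h2 := hs.num_le a (s.idx 1 v)
      have h3 := hM.add (s.num a (s.idx 1 v)) (e'.eval s)
      have h4 := hs.idx_le 1 v
      simp only [NExp.eval, IExp.eval, levelBound] at h2 ⊢
      -- Counters are at most `N + 1`, so the cap `N + 2` in `levelBound` is not active at the
      -- position being written.
      rw [min_eq_left (by omega)] at h2 ⊢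
      nlinarith
  | seq c d ic id => exact ⟨ic hc.1, id hc.2⟩
  | cond b c d ic id => exact ⟨ic hc.1, id hc.2⟩
  | forN v c ic => exact ic hc

/-- A leveled command runs in polynomial time. -/
theorem Cmd.exists_polynomial_exec {c : Cmd} (hw : c.WellFormed) {κ : ℕ} {lvl : ℕ → ℕ}
    (hc : c.Leveled κ lvl) {L : ℕ} (hL : ∀ a, lvl a ≤ L) :
    ∃ T : Polynomial ℕ, ∀ (K : Type) [Field K] [LinearOrder K] (M : CostModel K) (h : K → ℕ),
      SizeMeasure M h → ∀ (N : ℕ) (s : Store K), s.idx 0 0 ≤ N → (∀ a i, s.idx a i ≤ N + 1) →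
        (∀ a i, h (s.num a i) ≤ N + 1) →
        ∃ t, Exec M c.compile s (c.run s) t ∧ t ≤ T.eval N := by
  obtain ⟨S, hS⟩ := exists_polynomial_levelSize κ L
  obtain ⟨T, hT⟩ := c.exists_polynomial_time ((Polynomial.X + 3) * S + 1)
  refine ⟨T, fun K _ _ M h hM N s h0 hidx hnum => ?_⟩
  rw [← hT]
  refine Cmd.exec hM ?_ (fun a i => ?_) hw (hc.safe hM N) ⟨h0, hidx, fun a i => ?_⟩
  · have := le_levelSize κ N L
    simp only [Polynomial.eval_add, Polynomial.eval_mul, Polynomial.eval_X, Polynomial.eval_ofNat,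
      Polynomial.eval_one, ← hS]
    nlinarith
  · have := levelBound_le (κ := κ) (N := N) (hL a) i
    simpa [← hS] using this
  · have := le_levelSize κ N (lvl a)
    have h1 := hnum a i
    simp only [levelBound]
    nlinarith [Nat.zero_le (min i (N + 2))]

/-! ### Size measures -/

theorem sizeMeasure_unit (K : Type) [Field K] :
    SizeMeasure (CostModel.unit K) (fun _ => 0) := by
  constructor <;> simp [CostModel.unit]

/-- The larger one of the bit lengths of numerator and denominator. -/
def ratHeight (r : ℚ) : ℕ := max r.num.natAbs.size r.den.size

/-- Reduction to lowest terms replaces numerator and denominator by divisors. -/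
theorem ratHeight_divInt_le {a : ℤ} {b : ℤ} {m : ℕ} (ha : a.natAbs < 2 ^ m) (hb : b.natAbs < 2 ^ m)
    (hb0 : b ≠ 0) : ratHeight (a / b) ≤ max m 1 := by
  have h1 : ((a : ℚ) / b).num ∣ a := by
    rw [← Rat.divInt_eq_div]; exact Rat.num_dvd a hb0
  have h2 : (((a : ℚ) / b).den : ℤ) ∣ b := by
    rw [← Rat.divInt_eq_div]; exact Rat.den_dvd a b
  refine max_le ?_ ?_
  · by_cases ha0 : a = 0
    · simp [ha0]
    · refine le_max_of_le_left (Nat.size_le.2 (lt_of_le_of_lt ?_ ha))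
      exact Nat.le_of_dvd (Int.natAbs_pos.2 ha0) (Int.natAbs_dvd_natAbs.2 h1)
  · refine le_max_of_le_left (Nat.size_le.2 (lt_of_le_of_lt ?_ hb))
    exact Nat.le_of_dvd (Int.natAbs_pos.2 hb0) (Int.natCast_dvd.1 h2)

theorem natAbs_num_lt (r : ℚ) : r.num.natAbs < 2 ^ ratHeight r :=
  Nat.size_le.1 (le_max_left _ _)

theorem den_lt (r : ℚ) : r.den < 2 ^ ratHeight r := Nat.size_le.1 (le_max_right _ _)

theorem ratHeight_pos (r : ℚ) : 1 ≤ ratHeight r :=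
  Nat.succ_le_of_lt ((Nat.size_pos.2 r.den_pos).trans_le (le_max_right _ _))

theorem ratHeight_neg (r : ℚ) : ratHeight (-r) = ratHeight r := by simp [ratHeight]

/-- The cross-multiplied numerator is a sum of two products below `2 ^ (h + h')`, which costs one
extra bit. `ratSize` is not subadditive in this sense: in `1 / d + 1 / d'` the denominators
contribute to the numerator as well. -/
theorem ratHeight_add_le (x y : ℚ) : ratHeight (x + y) ≤ ratHeight x + ratHeight y + 1 := by
  have h : x + y = ((x.num * y.den + y.num * x.den : ℤ) : ℚ) / ((x.den * y.den : ℤ) : ℚ) := by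
    conv_lhs => rw [← x.num_div_den, ← y.num_div_den]
    push_cast
    rw [div_add_div _ _ (by simp) (by simp)]
    ring
  rw [h]
  refine (ratHeight_divInt_le (m := ratHeight x + ratHeight y + 1) ?_ ?_ (by simp)).trans (by simp)
  · have h1 := Nat.mul_lt_mul'' (natAbs_num_lt x) (den_lt y)
    have h2 := Nat.mul_lt_mul'' (natAbs_num_lt y) (den_lt x)
    have h3 := Int.natAbs_add_le (x.num * y.den) (y.num * x.den)
    simp only [Int.natAbs_mul, Int.natAbs_natCast] at h3
    rw [pow_succ, pow_add]
    linarith [mul_comm (2 ^ ratHeight x) (2 ^ ratHeight y)]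
  · have h1 := Nat.mul_lt_mul'' (den_lt x) (den_lt y)
    simp only [Int.natAbs_mul, Int.natAbs_natCast]
    rw [pow_succ, pow_add]
    omega

theorem ratHeight_mul_le (x y : ℚ) : ratHeight (x * y) ≤ ratHeight x + ratHeight y := by
  have h : x * y = ((x.num * y.num : ℤ) : ℚ) / ((x.den * y.den : ℤ) : ℚ) := by
    conv_lhs => rw [← x.num_div_den, ← y.num_div_den]
    push_cast
    rw [div_mul_div_comm]
  have := ratHeight_pos x
  rw [h]
  refine (ratHeight_divInt_le (m := ratHeight x + ratHeight y) ?_ ?_ (by simp)).trans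
    (max_le le_rfl (by omega))
  · simpa only [Int.natAbs_mul, pow_add] using
      Nat.mul_lt_mul'' (natAbs_num_lt x) (natAbs_num_lt y)
  · simpa only [Int.natAbs_mul, Int.natAbs_natCast, pow_add] using
      Nat.mul_lt_mul'' (den_lt x) (den_lt y)

theorem ratHeight_inv (x : ℚ) : ratHeight x⁻¹ ≤ ratHeight x := by
  by_cases hx : x = 0
  · simp [hx]
  have h : x⁻¹ = ((x.den : ℤ) : ℚ) / ((x.num : ℤ) : ℚ) := by
    conv_lhs => rw [← x.num_div_den]
    push_cast
    rw [inv_div]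
  rw [h]
  refine (ratHeight_divInt_le (m := ratHeight x) ?_ (natAbs_num_lt x) (by simpa using hx)).trans
    (max_le le_rfl (ratHeight_pos x))
  simpa using den_lt x

theorem sizeMeasure_bits : SizeMeasure CostModel.bits ratHeight where
  add := ratHeight_add_le
  sub x y := by
    rw [sub_eq_add_neg, ← ratHeight_neg y]
    exact ratHeight_add_le x (-y)
  mul x y := (ratHeight_mul_le x y).trans (Nat.le_succ _)
  div x y := by
    rw [div_eq_mul_inv]
    have h1 := ratHeight_mul_le x y⁻¹
    have h2 := ratHeight_inv y
    omega
  natCast m := by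
    have : m.size ≤ m := Nat.size_le.2 Nat.lt_two_pow_self
    simp [ratHeight]
    omega
  numSize_le x := by
    simp only [CostModel.bits, ratSize, ratHeight]
    omega
  idxSize_le m := Nat.size_le.2 Nat.lt_two_pow_self

/-! ### Rational data as real data -/

/-- A memory state of rational numbers regarded as one of real numbers. -/
def Store.toReal (s : Store ℚ) : Store ℝ where
  idx := s.idx
  num a i := (s.num a i : ℝ)

theorem IExp.eval_toReal (s : Store ℚ) (e : IExp) : e.eval s.toReal = e.eval s := by
  induction e with
  | lit m => rfl
  | read a pos ih => simp only [IExp.eval, ih]; rfl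
  | plus e f he hf => simp only [IExp.eval, he, hf]
  | minus e f he hf => simp only [IExp.eval, he, hf]

theorem NExp.eval_toReal (s : Store ℚ) (e : NExp) : e.eval s.toReal = ((e.eval s : ℚ) : ℝ) := by
  induction e with
  | ofIdx e => simp [NExp.eval, IExp.eval_toReal]
  | read a pos => simp only [NExp.eval, IExp.eval_toReal]; rfl
  | plus e f he hf => simp only [NExp.eval, he, hf, Rat.cast_add]
  | minus e f he hf => simp only [NExp.eval, he, hf, Rat.cast_sub]
  | times e f he hf => simp only [NExp.eval, he, hf, Rat.cast_mul]
  | quot e f he hf => simp only [NExp.eval, he, hf, Rat.cast_div]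

theorem Test.holds_toReal (s : Store ℚ) (b : Test) : b.holds s.toReal ↔ b.holds s := by
  induction b with
  | idxLe e f => simp only [Test.holds, IExp.eval_toReal]
  | numLe e f => simp only [Test.holds, NExp.eval_toReal, Rat.cast_le]
  | neg b hb => simp only [Test.holds, hb]
  | conj b d hb hd => simp only [Test.holds, hb, hd]

/-- Field operations, including `x / 0 = 0`, and comparisons commute with the embedding, so the two
runs take the same branches. -/
theorem Cmd.run_toReal (s : Store ℚ) (c : Cmd) : c.run s.toReal = (c.run s).toReal := by
  induction c generalizing s with
  | skip => rfl
  | setNum a pos e =>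
    simp only [Cmd.run, IExp.eval_toReal, NExp.eval_toReal]
    simp only [Store.toReal, Store.setNum]
    congr 1
    ext b i
    by_cases hb : b = a
    · subst hb
      by_cases hi : i = pos.eval s <;> simp [hi]
    · simp [hb]
  | seq c d hc hd => simp only [Cmd.run, hc, hd]
  | cond b c d hc hd =>
    by_cases h : b.holds s
    · simp only [Cmd.run, (b.holds_toReal s).2 h, h, if_true, hc]
    · simp only [Cmd.run, mt (b.holds_toReal s).1 h, h, if_false, hd]
  | forN v c hc =>
    have key : ∀ m, forSteps (fun k s' => c.run (s'.setIdx 1 v k)) m s.toReal =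
        (forSteps (fun k s' => c.run (s'.setIdx 1 v k)) m s).toReal := by
      intro m
      induction m with
      | zero => rfl
      | succ m ih =>
        simp only [forSteps, ih]
        exact hc (Store.setIdx _ 1 v m)
    simp only [Cmd.run]
    exact congrArg (fun s' => Store.setIdx s' 1 v (s.idx 0 0 + 1)) (key (s.idx 0 0 + 1))

end RAM

namespace RAM

/-! ### The program -/

namespace Scheme

/-- The entry of the number array `a` whose position is the counter `v`. -/
abbrev entry (a v : ℕ) : NExp := .read a (.var v)

abbrev nat (m : ℕ) : NExp := .ofIdx (.lit m)

abbrev or (b d : Test) : Test := .neg (.conj (.neg b) (.neg d))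

abbrev idxEq (u v : ℕ) : Test := .conj (.idxLe (.var u) (.var v)) (.idxLe (.var v) (.var u))

def priceExp (i j τ : ℕ) : NExp :=
  .quot (.minus (.minus (.times (entry 1 i) (entry 2 j))
      (.times (.ofIdx (.minus (.lit 1) (.var τ))) (.times (entry 1 i) (entry 3 j))))
      (.times (entry 1 j) (.minus (entry 2 i) (entry 3 i))))
    (.minus (.times (entry 1 j) (entry 4 i))
      (.times (.ofIdx (.minus (.lit 1) (.var τ))) (.times (entry 1 i) (entry 4 j))))

def sampleExp (o : ℕ) : NExp :=
  .plus (.quot (.plus (priceExp o (o + 1) (o + 2)) (priceExp (o + 3) (o + 4) (o + 5))) (nat 2))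
    (.ofIdx (.var (o + 6)))

/-- The test for the order by the ratio of the arrays `e` and `a`. -/
def precedesTest (a e u v : ℕ) : Test :=
  .conj (.numLe (.times (entry a v) (entry e u)) (.times (entry a u) (entry e v)))
    (or (.neg (.numLe (.times (entry a u) (entry e v)) (.times (entry a v) (entry e u))))
      (.neg (.idxLe (.var v) (.var u))))

def memberTest : ℕ → Test
  | 0 => .neg (.idxLe (.lit 0) (.lit 0))
  | k + 1 => or (memberTest k) (idxEq 0 (19 + k))

def chosenTest (k : ℕ) : Test :=
  or (memberTest k) (.conj (.neg (.numLe (entry 1 0) (nat 0)))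
    (.conj (.numLe (entry 1 0) (entry 1 4)) (.conj (.neg (idxEq 0 2))
      (or (precedesTest 1 8 0 2) (precedesTest 1 7 0 3)))))

def improvedTest : Test :=
  .conj (.numLe (nat 1) (entry 10 0)) (.conj (.neg (.numLe (entry 3 0) (nat 0)))
    (precedesTest 3 4 0 1))

/-- Store the effective weights for the price in position `m` of array `9` in the array `a`. -/
def effWeightCmd (a m : ℕ) : Cmd :=
  let e : NExp := .plus (.minus (entry 2 0) (entry 3 0)) (.times (.read 9 (.lit m)) (entry 4 0))
  .forN 0 (.cond (.numLe (entry 2 0) e) (.setNum a (.var 0) (entry 2 0)) (.setNum a (.var 0) e))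

/-- Store the indicator function of the test `b` in the array `a`. -/
def indicatorCmd (a : ℕ) (b : Test) : Cmd :=
  .forN 0 (.cond b (.setNum a (.var 0) (nat 1)) (.setNum a (.var 0) (nat 0)))

/-- Store the partial sums of the expression `e` in the array `a`. -/
def sumCmd (a : ℕ) (e : NExp) : Cmd :=
  .seq (.setNum a (.lit 0) (nat 0))
    (.forN 0 (.setNum a (.plus (.var 0) (.lit 1)) (.plus (entry a 0) e)))

/-- The last partial sum in the array `a`. -/
abbrev total (a : ℕ) : NExp := .read a (.plus .last (.lit 1))

def improvementCmd : Cmd :=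
  .forN 0 (.cond (idxEq 0 1)
    (.setNum 13 (.var 0) (.quot (.minus (.read 0 (.lit 1)) (total 12)) (entry 4 0)))
    (.setNum 13 (.var 0) (entry 11 0)))

def copyCmd (a b : ℕ) : Cmd := .forN 0 (.setNum a (.var 0) (entry b 0))

/-- The solution for the current guess is feasible, and better than the best one so far. -/
def acceptTest : Test :=
  .conj (.numLe (nat 0) (entry 13 1)) (.conj (.numLe (entry 13 1) (entry 10 1))
    (.conj (.numLe (total 15) (.read 0 (.lit 1))) (.conj (.numLe (total 16) (.read 0 (.lit 0)))
      (.neg (.numLe (total 17) (.read 18 (.lit 0)))))))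

/-- Compute the solution for the current guess. -/
def solveCmd (k : ℕ) : Cmd :=
  .seq (.setNum 9 (.lit 0) (sampleExp 5)) <| .seq (.setNum 9 (.lit 1) (sampleExp 12)) <|
  .seq (effWeightCmd 7 0) <| .seq (effWeightCmd 8 1) <|
  .seq (indicatorCmd 10 (chosenTest k)) <| .seq (indicatorCmd 11 improvedTest) <|
  .seq (sumCmd 12 (.times (entry 11 0) (entry 4 0))) <| .seq improvementCmd <|
  .seq (sumCmd 15 (.times (entry 4 0) (entry 13 0))) <|
  .seq (sumCmd 16 (.minus (.times (entry 2 0) (entry 10 0)) (.times (entry 3 0) (entry 13 0)))) <|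
  sumCmd 17 (.times (entry 1 0) (entry 10 0))

/-- Keep the solution for the current guess if it is feasible and better than the best one. -/
def updateCmd : Cmd :=
  .cond acceptTest (.seq (.setNum 18 (.lit 0) (total 17)) (.seq (copyCmd 5 10) (copyCmd 6 13))) .skip

/-- Run the command `c` for all contents of the counters `1` to `m`. -/
def guessLoops (c : Cmd) : ℕ → Cmd
  | 0 => c
  | m + 1 => .forN (m + 1) (guessLoops c m)

def mainCmd (k : ℕ) : Cmd := guessLoops (.seq (solveCmd k) updateCmd) (18 + k)

/-! ### Running time -/

/-- The levels of the number arrays. -/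
def level (a : ℕ) : ℕ := [0, 0, 0, 0, 0, 7, 7, 2, 2, 1, 3, 3, 4, 5, 6, 6, 6, 6, 7].getD a 7

theorem level_le (a : ℕ) : level a ≤ 7 := by
  by_cases h : a < 19
  · have : ∀ a < 19, level a ≤ 7 := by decide
    exact this a h
  · rw [level, List.getD_eq_default _ _ (by simpa using h)]

theorem leveled_setNum {κ a : ℕ} {pos : IExp} {e : NExp} (L : ℕ) (hL : L < level a)
    (he : e.ReadsBelow level L) (hκ : e.nodes ≤ κ) : (Cmd.setNum a pos e).Leveled κ level :=
  Or.inl ⟨L, hL, he, hκ⟩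

theorem leveled_sumCmd {κ a : ℕ} {e : NExp} (L : ℕ) (hL : L < level a)
    (he : e.ReadsBelow level L) (hκ : e.nodes + 2 ≤ κ) : (sumCmd a e).Leveled κ level :=
  ⟨leveled_setNum L hL trivial (by simp only [NExp.nodes, IExp.nodes]; omega),
    Or.inr ⟨e, 0, rfl, rfl, L, hL, he, by omega⟩⟩

theorem leveled_effWeightCmd {a m : ℕ} (ha : level a = 2) (hm : m ≤ 1) :
    (effWeightCmd a m).Leveled 2000 level := by
  constructor
  · exact leveled_setNum 1 (by omega) (by simp [NExp.ReadsBelow, level])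
      (by simp [NExp.nodes, IExp.nodes])
  · exact leveled_setNum 1 (by omega) (by simp [NExp.ReadsBelow, level])
      (by simp [NExp.nodes, IExp.nodes]; omega)

/-- Only constants are stored, so the test may read any array and may be arbitrarily large; hence
the node bound need not depend on `k`. -/
theorem leveled_indicatorCmd {a : ℕ} (b : Test) (ha : 0 < level a) :
    (indicatorCmd a b).Leveled 2000 level :=
  ⟨leveled_setNum 0 ha trivial (by simp [NExp.nodes, IExp.nodes]),
    leveled_setNum 0 ha trivial (by simp [NExp.nodes, IExp.nodes])⟩

theorem leveled_mainCmd (k : ℕ) : (mainCmd k).Leveled 2000 level := by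
  have hloops : ∀ c : Cmd, c.Leveled 2000 level → ∀ m, (guessLoops c m).Leveled 2000 level := by
    intro c hc m
    induction m with
    | zero => exact hc
    | succ m ih => exact ih
  -- The bound `2000` is a generous count of the nodes of stored expressions, with literals counted
  -- by value.
  refine hloops (.seq (solveCmd k) updateCmd) ⟨⟨?_, ?_, ?_, ?_, ?_, ?_, ?_, ?_, ?_, ?_, ?_⟩, ?_⟩ _
  · exact leveled_setNum 0 (by decide)
      (by simp [sampleExp, priceExp, NExp.ReadsBelow, level]) (by decide)
  · exact leveled_setNum 0 (by decide)
      (by simp [sampleExp, priceExp, NExp.ReadsBelow, level]) (by decide)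
  · exact leveled_effWeightCmd rfl (by norm_num)
  · exact leveled_effWeightCmd rfl (by norm_num)
  · exact leveled_indicatorCmd _ (by decide)
  · exact leveled_indicatorCmd _ (by decide)
  · exact leveled_sumCmd 3 (by decide) (by simp [NExp.ReadsBelow, level]) (by decide)
  · exact ⟨leveled_setNum 4 (by decide) (by simp [NExp.ReadsBelow, level]) (by decide),
      leveled_setNum 4 (by decide) (by simp [NExp.ReadsBelow, level]) (by decide)⟩
  · exact leveled_sumCmd 5 (by decide) (by simp [NExp.ReadsBelow, level]) (by decide)
  · exact leveled_sumCmd 5 (by decide) (by simp [NExp.ReadsBelow, level]) (by decide)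
  · exact leveled_sumCmd 5 (by decide) (by simp [NExp.ReadsBelow, level]) (by decide)
  · exact ⟨⟨leveled_setNum 6 (by decide) (by simp [NExp.ReadsBelow, level]) (by decide),
      leveled_setNum 6 (by decide) (by simp [NExp.ReadsBelow, level]) (by decide),
      leveled_setNum 6 (by decide) (by simp [NExp.ReadsBelow, level]) (by decide)⟩, trivial⟩

theorem writes_guessLoops {c : Cmd} (hc : ∀ v, c.Writes v → v = 0) {m v : ℕ}
    (h : (guessLoops c m).Writes v) : v ≤ m := by
  induction m with
  | zero => exact (hc v h).le
  | succ m ih =>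
    rcases h with rfl | h
    · exact le_rfl
    · exact (ih h).trans m.le_succ

theorem writes_body {k v : ℕ} (h : (Cmd.seq (solveCmd k) updateCmd).Writes v) : v = 0 := by
  simpa [solveCmd, updateCmd, effWeightCmd, indicatorCmd, sumCmd, improvementCmd, copyCmd,
    Cmd.Writes] using h

theorem wellFormed_mainCmd (k : ℕ) : (mainCmd k).WellFormed := by
  have hloops : ∀ c : Cmd, (∀ v, c.Writes v → v = 0) → c.WellFormed → ∀ m,
      (guessLoops c m).WellFormed := by
    intro c hc hw m
    induction m with
    | zero => exact hw
    | succ m ih => exact ⟨fun h => absurd (writes_guessLoops hc h) (by omega), ih⟩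
  refine hloops (.seq (solveCmd k) updateCmd) (fun v => writes_body) ?_ _
  simp [solveCmd, updateCmd, effWeightCmd, indicatorCmd, sumCmd, improvementCmd, copyCmd,
    Cmd.Writes, Cmd.WellFormed]

end Scheme

end RAM

namespace RAM

open Greedy

namespace Scheme

/-! ### Effects of the loops over the items -/

/-- The states agree up to the number array `a` and the loop counter `0`. -/
structure Frame (a : ℕ) (s s' : Store ℝ) : Prop where
  last : s'.idx 0 0 = s.idx 0 0
  var : ∀ v, v ≠ 0 → s'.idx 1 v = s.idx 1 v
  num : ∀ b, b ≠ a → s'.num b = s.num b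

theorem Frame.refl (a : ℕ) (s : Store ℝ) : Frame a s s := ⟨rfl, fun _ _ => rfl, fun _ _ => rfl⟩

theorem Frame.trans {a : ℕ} {s s' s'' : Store ℝ} (h : Frame a s s') (h' : Frame a s' s'') :
    Frame a s s'' :=
  ⟨h'.last.trans h.last, fun v hv => (h'.var v hv).trans (h.var v hv),
    fun b hb => (h'.num b hb).trans (h.num b hb)⟩

theorem frame_setIdx (a : ℕ) (s : Store ℝ) (m : ℕ) : Frame a s (s.setIdx 1 0 m) :=
  ⟨Store.setIdx_idx_of_ne _ (by norm_num), fun _ hv => Store.setIdx_idx_of_ne _ fun _ => hv,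
    fun _ _ => rfl⟩

theorem frame_setNum (a : ℕ) (s : Store ℝ) (i : ℕ) (x : ℝ) : Frame a s (s.setNum a i x) :=
  ⟨rfl, fun _ _ => rfl, fun _ hb => funext fun _ => Store.setNum_num_of_ne _ fun h => absurd h hb⟩

/-- Earlier passes have changed the array `a`, so the body is required to behave as stated in all
states that agree with `s` elsewhere. -/
theorem run_forN_map {a : ℕ} {c : Cmd} {s : Store ℝ} (F : ℕ → ℝ)
    (h : ∀ s', Frame a s s' → ∀ i ≤ s.idx 0 0, s'.idx 1 0 = i → c.run s' = s'.setNum a i (F i)) :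
    Frame a s ((Cmd.forN 0 c).run s) ∧
      ∀ i ≤ s.idx 0 0, ((Cmd.forN 0 c).run s).num a i = F i := by
  have key := forSteps_induction (f := fun k s' => c.run (Store.setIdx s' 1 0 k)) (s := s)
    (P := fun k s' => Frame a s s' ∧ ∀ j < k, s'.num a j = F j) (m := s.idx 0 0 + 1)
    ⟨Frame.refl a s, fun j hj => absurd hj (Nat.not_lt_zero j)⟩ fun k hk s' hs' => ?_
  · exact ⟨key.1.trans (frame_setIdx _ _ _), fun i hi => key.2 i (by omega)⟩
  · have hfr := hs'.1.trans (frame_setIdx a s' k)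
    rw [h _ hfr k (by omega) (Store.setIdx_idx_self _ _ _ _)]
    refine ⟨hfr.trans (frame_setNum _ _ _ _), fun j hj => ?_⟩
    by_cases hjk : j = k
    · rw [hjk, Store.setNum_num_self]
    · rw [Store.setNum_num_of_ne _ fun _ => hjk]
      exact hs'.2 j (by omega)

/-- Cell `j` holds the sum of the first `j` terms. As the loop includes the index `n`, the total is
in cell `n + 1`. -/
theorem run_sumCmd {a : ℕ} {e : NExp} {s : Store ℝ} (F : ℕ → ℝ)
    (h : ∀ s', Frame a s s' → ∀ i ≤ s.idx 0 0, s'.idx 1 0 = i → e.eval s' = F i) :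
    Frame a s ((sumCmd a e).run s) ∧
      (total a).eval ((sumCmd a e).run s) = ∑ i ∈ Finset.range (s.idx 0 0 + 1), F i := by
  have hs₀ : ((sumCmd a e).run s) = (Cmd.forN 0 (.setNum a (.plus (.var 0) (.lit 1))
      (.plus (entry a 0) e))).run (s.setNum a 0 0) := by
    simp [sumCmd, Cmd.run, IExp.eval, NExp.eval]
  set s₀ := s.setNum a 0 0 with hs₀'
  have hfr₀ : Frame a s s₀ := frame_setNum _ _ _ _
  have key := forSteps_induction
    (f := fun k s' => (Cmd.setNum a (.plus (.var 0) (.lit 1)) (.plus (entry a 0) e)).run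
      (Store.setIdx s' 1 0 k)) (s := s₀)
    (P := fun k s' => Frame a s s' ∧ s'.num a k = ∑ i ∈ Finset.range k, F i)
    (m := s.idx 0 0 + 1) ⟨hfr₀, by simp [hs₀']⟩ fun k hk s' hs' => ?_
  · have hfr := key.1.trans (frame_setIdx a _ (s.idx 0 0 + 1))
    rw [hs₀]
    refine ⟨hfr, ?_⟩
    have := key.2
    simp only [NExp.eval, IExp.eval, Cmd.run_idx_zero]
    exact this
  · have hfr := hs'.1.trans (frame_setIdx a s' k)
    have he := h _ hfr k (by omega) (Store.setIdx_idx_self _ _ _ _)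
    simp only [Cmd.run, IExp.eval, NExp.eval, he, Store.setIdx_idx_self, Store.setIdx_num]
    refine ⟨hfr.trans (frame_setNum _ _ _ _), ?_⟩
    rw [Store.setNum_num_self, hs'.2, Finset.sum_range_succ]

/-! ### The solution for a guess -/

/-- The truth value of a proposition as a real number. -/
noncomputable def indicator (P : Prop) : ℝ := open Classical in if P then 1 else 0

section Guess

variable (n : ℕ) (p w wb c : ℕ → ℝ) (B C : ℝ) (k : ℕ) (G : ℕ → ℕ)

noncomputable def xval (i : ℕ) : ℝ := indicator (Chosen p w wb c k G i)

noncomputable def uval (i : ℕ) : ℝ :=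
  indicator (Chosen p w wb c k G i ∧ 0 < wb i ∧ Precedes wb c i (G 1))

/-- For `G 1 = n` the denominator is zero in the loaded data, so the quotient is zero and no item is
improved fractionally. -/
noncomputable def yval (i : ℕ) : ℝ :=
  if i = G 1 then (C - ∑ j ∈ Finset.range (n + 1), uval p w wb c k G j * c j) / c i
  else uval p w wb c k G i

noncomputable def profit : ℝ := ∑ i ∈ Finset.range (n + 1), p i * xval p w wb c k G i

/-- The bounds `0 ≤ y ≤ x` need a test for the item `G 1` only; elsewhere `y` is an indicator
dominated by `x`. -/
structure Passes : Prop where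
  nonneg : 0 ≤ yval n p w wb c C k G (G 1)
  le : yval n p w wb c C k G (G 1) ≤ xval p w wb c k G (G 1)
  cost_le : ∑ i ∈ Finset.range (n + 1), c i * yval n p w wb c C k G i ≤ C
  weight_le : ∑ i ∈ Finset.range (n + 1),
    (w i * xval p w wb c k G i - wb i * yval n p w wb c C k G i) ≤ B

/-- The memory contains the instance. -/
structure Inputs (s : Store ℝ) : Prop where
  last : s.idx 0 0 = n
  budget : s.num 0 0 = B
  improvement : s.num 0 1 = C
  p_eq : s.num 1 = p
  w_eq : s.num 2 = w
  wb_eq : s.num 3 = wb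
  c_eq : s.num 4 = c

/-- The loop counters contain the guess. -/
structure AtGuess (s : Store ℝ) : Prop where
  var : ∀ v, v ≠ 0 → v ≤ 18 + k → s.idx 1 v = G v
  le : ∀ v, v ≠ 0 → v ≤ 18 + k → G v ≤ n

end Guess

variable {n : ℕ} {p w wb c : ℕ → ℝ} {B C : ℝ} {k : ℕ} {G : ℕ → ℕ} {s s' : Store ℝ}

theorem Inputs.frame {a : ℕ} (h : Inputs n p w wb c B C s) (hf : Frame a s s') (ha : 4 < a) :
    Inputs n p w wb c B C s' where
  last := hf.last.trans h.last
  budget := by rw [hf.num 0 (by omega), h.budget]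
  improvement := by rw [hf.num 0 (by omega), h.improvement]
  p_eq := by rw [hf.num 1 (by omega), h.p_eq]
  w_eq := by rw [hf.num 2 (by omega), h.w_eq]
  wb_eq := by rw [hf.num 3 (by omega), h.wb_eq]
  c_eq := by rw [hf.num 4 (by omega), h.c_eq]

theorem AtGuess.frame {a : ℕ} (h : AtGuess n k G s) (hf : Frame a s s') : AtGuess n k G s' where
  var v hv hv' := (hf.var v hv).trans (h.var v hv hv')
  le := h.le

theorem holds_or (b d : Test) (s : Store ℝ) : (or b d).holds s ↔ b.holds s ∨ d.holds s := by
  simp only [Test.holds]; tauto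

theorem holds_idxEq (u v : ℕ) (s : Store ℝ) : (idxEq u v).holds s ↔ s.idx 1 u = s.idx 1 v := by
  simp only [Test.holds, IExp.eval]; omega

theorem holds_precedesTest (a e u v : ℕ) (s : Store ℝ) :
    (precedesTest a e u v).holds s ↔ Precedes (s.num a) (s.num e) (s.idx 1 u) (s.idx 1 v) := by
  simp only [precedesTest, Precedes, Test.holds, IExp.eval, NExp.eval, not_le]
  tauto

theorem precedes_congr {p e e' : ℕ → ℝ} {i j : ℕ} (hi : e i = e' i) (hj : e j = e' j) :
    Precedes p e i j ↔ Precedes p e' i j := by simp only [Precedes, hi, hj]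

theorem eval_sampleExp (hs : Inputs n p w wb c B C s) (hG : AtGuess n k G s) {o : ℕ} (ho : o ≠ 0)
    (ho' : o + 6 ≤ 18 + k) : (sampleExp o).eval s = samplePrice p w wb c fun v => G (o + v) := by
  have hv : ∀ v ≤ 6, s.idx 1 (o + v) = G (o + v) := fun v hv =>
    hG.var _ (by omega) (by omega)
  have h0 := hv 0 (by norm_num)
  rw [Nat.add_zero] at h0
  simp only [sampleExp, priceExp, NExp.eval, IExp.eval, hs.p_eq, hs.w_eq, hs.wb_eq, hs.c_eq,
    samplePrice, criticalPrice, h0, hv 1 (by norm_num), hv 2 (by norm_num), hv 3 (by norm_num),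
    hv 4 (by norm_num), hv 5 (by norm_num), hv 6 (by norm_num), Nat.add_zero]

theorem run_effWeightCmd (hs : Inputs n p w wb c B C s) {a m : ℕ} (ha : 9 ≠ a) (ha' : 4 < a) :
    Frame a s ((effWeightCmd a m).run s) ∧
      ∀ i ≤ n, ((effWeightCmd a m).run s).num a i = effWeight w wb c i (s.num 9 m) := by
  have := run_forN_map (a := a) (s := s) (fun i => effWeight w wb c i (s.num 9 m))
    (c := .cond (.numLe (entry 2 0) (.plus (.minus (entry 2 0) (entry 3 0))
      (.times (.read 9 (.lit m)) (entry 4 0)))) (.setNum a (.var 0) (entry 2 0))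
      (.setNum a (.var 0) (.plus (.minus (entry 2 0) (entry 3 0))
      (.times (.read 9 (.lit m)) (entry 4 0))))) fun s' hf i hi hi' => ?_
  · rwa [hs.last] at this
  · have hs' := hs.frame hf ha'
    simp only [Cmd.run, Test.holds, NExp.eval, IExp.eval, hs'.w_eq, hs'.wb_eq, hs'.c_eq, hi',
      hf.num 9 ha, effWeight, min_def]
    split_ifs <;> rfl

theorem run_indicatorCmd (hs : s.idx 0 0 = n) {a : ℕ} {b : Test} {P : ℕ → Prop}
    (h : ∀ s', Frame a s s' → ∀ i ≤ n, s'.idx 1 0 = i → (b.holds s' ↔ P i)) :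
    Frame a s ((indicatorCmd a b).run s) ∧
      ∀ i ≤ n, ((indicatorCmd a b).run s).num a i = indicator (P i) := by
  classical
  have := run_forN_map (a := a) (s := s) (fun i => indicator (P i))
    (c := .cond b (.setNum a (.var 0) (nat 1)) (.setNum a (.var 0) (nat 0))) fun s' hf i hi hi' => ?_
  · rw [hs] at this
    exact ⟨this.1, fun i hi => by rw [indicatorCmd, this.2 i hi]⟩
  · simp only [Cmd.run, NExp.eval, IExp.eval, hi', h s' hf i (hs ▸ hi) hi', Nat.cast_one,
      Nat.cast_zero, indicator]
    split_ifs <;> rfl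

theorem holds_memberTest (hG : AtGuess n k G s) {m : ℕ} (hm : m ≤ k) :
    (memberTest m).holds s ↔ ∃ t < m, s.idx 1 0 = G (19 + t) := by
  induction m with
  | zero => simp [memberTest, Test.holds]
  | succ m ih =>
    have hv := hG.var (19 + m) (by omega) (by omega)
    rw [memberTest, holds_or, ih (by omega), holds_idxEq, hv]
    constructor
    · rintro (⟨t, ht, h⟩ | h)
      exacts [⟨t, by omega, h⟩, ⟨m, by omega, h⟩]
    · rintro ⟨t, ht, h⟩
      rcases Nat.lt_succ_iff_lt_or_eq.1 ht with h' | rfl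
      exacts [Or.inl ⟨t, h', h⟩, Or.inr h]

theorem holds_chosenTest (hs : Inputs n p w wb c B C s) (hG : AtGuess n k G s)
    (h7 : ∀ i ≤ n, s.num 7 i = effWeight w wb c i (samplePrice p w wb c fun v => G (5 + v)))
    (h8 : ∀ i ≤ n, s.num 8 i = effWeight w wb c i (samplePrice p w wb c fun v => G (12 + v)))
    {i : ℕ} (hi : i ≤ n) (hi' : s.idx 1 0 = i) :
    (chosenTest k).holds s ↔ Chosen p w wb c k G i := by
  have g2 := hG.var 2 (by omega) (by omega)
  have g3 := hG.var 3 (by omega) (by omega)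
  have g4 := hG.var 4 (by omega) (by omega)
  have l2 := hG.le 2 (by omega) (by omega)
  have l3 := hG.le 3 (by omega) (by omega)
  simp only [chosenTest, holds_or, Test.holds, holds_memberTest hG le_rfl, holds_precedesTest,
    Chosen, g2, g3, hs.p_eq, hi', NExp.eval, IExp.eval, g4, not_le, Nat.cast_zero]
  rw [precedes_congr (e' := fun j => effWeight w wb c j (samplePrice p w wb c fun v => G (12 + v)))
      (h8 i hi) (h8 _ l2),
    precedes_congr (e' := fun j => effWeight w wb c j (samplePrice p w wb c fun v => G (5 + v)))
      (h7 i hi) (h7 _ l3)]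
  have : ¬ (i ≤ G 2 ∧ G 2 ≤ i) ↔ i ≠ G 2 := by omega
  rw [this, or_iff_not_and_not (a := Precedes _ _ _ _)]

theorem run_solveCmd (hs : Inputs n p w wb c B C s) (hG : AtGuess n k G s) :
    Inputs n p w wb c B C ((solveCmd k).run s) ∧ AtGuess n k G ((solveCmd k).run s) ∧
      (∀ a, a = 5 ∨ a = 6 ∨ a = 18 → ((solveCmd k).run s).num a = s.num a) ∧
      (∀ i ≤ n, ((solveCmd k).run s).num 10 i = xval p w wb c k G i) ∧
      (∀ i ≤ n, ((solveCmd k).run s).num 13 i = yval n p w wb c C k G i) ∧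
      (total 15).eval ((solveCmd k).run s) =
        ∑ i ∈ Finset.range (n + 1), c i * yval n p w wb c C k G i ∧
      (total 16).eval ((solveCmd k).run s) = ∑ i ∈ Finset.range (n + 1),
        (w i * xval p w wb c k G i - wb i * yval n p w wb c C k G i) ∧
      (total 17).eval ((solveCmd k).run s) = profit n p w wb c k G := by
  simp only [solveCmd, Cmd.run]
  set m := samplePrice p w wb c fun v => G (5 + v) with hm
  set m' := samplePrice p w wb c fun v => G (12 + v) with hm'
  -- the sample prices
  rw [eval_sampleExp hs hG (by norm_num) (by omega), ← hm]
  simp only [IExp.eval]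
  set s₁ := s.setNum 9 0 m with hs₁
  have f₁ : Frame 9 s s₁ := frame_setNum _ _ _ _
  have i₁ := hs.frame f₁ (by norm_num)
  have G₁ := hG.frame f₁
  rw [eval_sampleExp i₁ G₁ (by norm_num) (by omega), ← hm']
  set s₂ := s₁.setNum 9 1 m' with hs₂
  have f₂ : Frame 9 s₁ s₂ := frame_setNum _ _ _ _
  have i₂ := i₁.frame f₂ (by norm_num)
  have G₂ := G₁.frame f₂
  have e90 : s₂.num 9 0 = m := by
    rw [hs₂, Store.setNum_num_of_ne _ (by norm_num), hs₁, Store.setNum_num_self]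
  have e91 : s₂.num 9 1 = m' := by rw [hs₂, Store.setNum_num_self]
  -- the effective weights
  obtain ⟨f₃, e₃⟩ := run_effWeightCmd i₂ (a := 7) (m := 0) (by norm_num) (by norm_num)
  set s₃ := (effWeightCmd 7 0).run s₂
  have i₃ := i₂.frame f₃ (by norm_num)
  have G₃ := G₂.frame f₃
  obtain ⟨f₄, e₄⟩ := run_effWeightCmd i₃ (a := 8) (m := 1) (by norm_num) (by norm_num)
  set s₄ := (effWeightCmd 8 1).run s₃
  have i₄ := i₃.frame f₄ (by norm_num)
  have G₄ := G₃.frame f₄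
  rw [f₃.num 9 (by norm_num), e91] at e₄
  rw [e90] at e₃
  -- the selection
  obtain ⟨f₅, e₅⟩ := run_indicatorCmd (a := 10) (b := chosenTest k) i₄.last
    (P := Chosen p w wb c k G) fun s' hf i hi hi' =>
      holds_chosenTest (i₄.frame hf (by norm_num)) (G₄.frame hf)
        (fun j hj => by rw [hf.num 7 (by norm_num), f₄.num 7 (by norm_num), e₃ j hj])
        (fun j hj => by rw [hf.num 8 (by norm_num), e₄ j hj]) hi hi'
  set s₅ := (indicatorCmd 10 (chosenTest k)).run s₄
  have i₅ := i₄.frame f₅ (by norm_num)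
  have G₅ := G₄.frame f₅
  -- the improvements
  obtain ⟨f₆, e₆⟩ := run_indicatorCmd (a := 11) (b := improvedTest) i₅.last
    (P := fun i => Chosen p w wb c k G i ∧ 0 < wb i ∧ Precedes wb c i (G 1))
    fun s' hf i hi hi' => by
      have hs' := i₅.frame hf (by norm_num)
      have hG' := G₅.frame hf
      simp only [improvedTest, Test.holds, holds_precedesTest, NExp.eval, IExp.eval, hi',
        hs'.wb_eq, hs'.c_eq, hG'.var 1 (by omega) (by omega), hf.num 10 (by norm_num), e₅ i hi,
        not_le, Nat.cast_zero, Nat.cast_one]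
      refine and_congr_left fun _ => ?_
      by_cases h : Chosen p w wb c k G i <;> simp [indicator, h]
  set s₆ := (indicatorCmd 11 improvedTest).run s₅
  have i₆ := i₅.frame f₆ (by norm_num)
  have G₆ := G₅.frame f₆
  obtain ⟨f₇, e₇⟩ := run_sumCmd (a := 12) (e := .times (entry 11 0) (entry 4 0)) (s := s₆)
    (fun i => uval p w wb c k G i * c i) fun s' hf i hi hi' => by
      rw [i₆.last] at hi
      simp only [NExp.eval, IExp.eval, hi', (i₆.frame hf (by norm_num)).c_eq,
        hf.num 11 (by norm_num), e₆ i hi, uval]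
  rw [i₆.last] at e₇
  set s₇ := (sumCmd 12 (.times (entry 11 0) (entry 4 0))).run s₆
  have i₇ := i₆.frame f₇ (by norm_num)
  have G₇ := G₆.frame f₇
  obtain ⟨f₈, e₈⟩ := run_forN_map (a := 13) (s := s₇) (yval n p w wb c C k G)
    (c := .cond (idxEq 0 1)
    (.setNum 13 (.var 0) (.quot (.minus (.read 0 (.lit 1)) (total 12)) (entry 4 0)))
    (.setNum 13 (.var 0) (entry 11 0))) fun s' hf i hi hi' => by
      rw [i₇.last] at hi
      have hs' := i₇.frame hf (by norm_num)
      have hG' := G₇.frame hf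
      have h12 : s'.num 12 (n + 1) = ∑ j ∈ Finset.range (n + 1), uval p w wb c k G j * c j := by
        rw [← e₇, hf.num 12 (by norm_num)]
        simp only [NExp.eval, IExp.eval, i₇.last]
      have h11 : s'.num 11 i = uval p w wb c k G i := by
        rw [hf.num 11 (by norm_num), f₇.num 11 (by norm_num), e₆ i hi, uval]
      simp only [Cmd.run, holds_idxEq, NExp.eval, IExp.eval, hi', hG'.var 1 (by omega) (by omega),
        hs'.last, hs'.improvement, hs'.c_eq, h12, h11, yval]
      split_ifs <;> rfl
  rw [i₇.last] at e₈
  change Frame 13 s₇ (improvementCmd.run s₇) at f₈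
  change ∀ i ≤ n, (improvementCmd.run s₇).num 13 i = _ at e₈
  set s₈ := improvementCmd.run s₇
  have i₈ := i₇.frame f₈ (by norm_num)
  have G₈ := G₇.frame f₈
  have e10 : ∀ i ≤ n, s₈.num 10 i = xval p w wb c k G i := fun i hi => by
    rw [f₈.num 10 (by norm_num), f₇.num 10 (by norm_num), f₆.num 10 (by norm_num), e₅ i hi, xval]
  -- the totals
  obtain ⟨f₉, e₉⟩ := run_sumCmd (a := 15) (e := .times (entry 4 0) (entry 13 0)) (s := s₈)
    (fun i => c i * yval n p w wb c C k G i) fun s' hf i hi hi' => by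
      rw [i₈.last] at hi
      simp only [NExp.eval, IExp.eval, hi', (i₈.frame hf (by norm_num)).c_eq,
        hf.num 13 (by norm_num), e₈ i hi]
  rw [i₈.last] at e₉
  set s₉ := (sumCmd 15 (.times (entry 4 0) (entry 13 0))).run s₈
  have i₉ := i₈.frame f₉ (by norm_num)
  have G₉ := G₈.frame f₉
  obtain ⟨f₁₀, e₁₀⟩ := run_sumCmd (a := 16) (e := .minus (.times (entry 2 0) (entry 10 0))
    (.times (entry 3 0) (entry 13 0))) (s := s₉)
    (fun i => w i * xval p w wb c k G i - wb i * yval n p w wb c C k G i)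
    fun s' hf i hi hi' => by
      rw [i₉.last] at hi
      have hs' := i₉.frame hf (by norm_num)
      simp only [NExp.eval, IExp.eval, hi', hs'.w_eq, hs'.wb_eq, hf.num 13 (by norm_num),
        hf.num 10 (by norm_num), f₉.num 13 (by norm_num), f₉.num 10 (by norm_num), e₈ i hi, e10 i hi]
  rw [i₉.last] at e₁₀
  set s₁₀ := (sumCmd 16 (.minus (.times (entry 2 0) (entry 10 0))
    (.times (entry 3 0) (entry 13 0)))).run s₉
  have i₁₀ := i₉.frame f₁₀ (by norm_num)
  have G₁₀ := G₉.frame f₁₀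
  obtain ⟨f₁₁, e₁₁⟩ := run_sumCmd (a := 17) (e := .times (entry 1 0) (entry 10 0)) (s := s₁₀)
    (fun i => p i * xval p w wb c k G i) fun s' hf i hi hi' => by
      rw [i₁₀.last] at hi
      simp only [NExp.eval, IExp.eval, hi', (i₁₀.frame hf (by norm_num)).p_eq,
        hf.num 10 (by norm_num), f₁₀.num 10 (by norm_num), f₉.num 10 (by norm_num), e10 i hi]
  rw [i₁₀.last] at e₁₁
  set s₁₁ := (sumCmd 17 (.times (entry 1 0) (entry 10 0))).run s₁₀
  have i₁₁ := i₁₀.frame f₁₁ (by norm_num)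
  refine ⟨i₁₁, G₁₀.frame f₁₁, fun a ha => ?_, fun i hi => ?_, fun i hi => ?_, ?_, ?_, e₁₁⟩
  · rw [f₁₁.num a (by omega), f₁₀.num a (by omega), f₉.num a (by omega), f₈.num a (by omega),
      f₇.num a (by omega), f₆.num a (by omega), f₅.num a (by omega), f₄.num a (by omega),
      f₃.num a (by omega), f₂.num a (by omega), f₁.num a (by omega)]
  · rw [f₁₁.num 10 (by norm_num), f₁₀.num 10 (by norm_num), f₉.num 10 (by norm_num), e10 i hi]
  · rw [f₁₁.num 13 (by norm_num), f₁₀.num 13 (by norm_num), f₉.num 13 (by norm_num), e₈ i hi]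
  · rw [← e₉]
    simp only [NExp.eval, IExp.eval, f₁₁.num 15 (by norm_num), f₁₀.num 15 (by norm_num), i₁₁.last,
      i₉.last]
  · rw [← e₁₀]
    simp only [NExp.eval, IExp.eval, f₁₁.num 16 (by norm_num), i₁₁.last, i₁₀.last]

theorem run_copyCmd (a b : ℕ) (hab : b ≠ a) (s : Store ℝ) :
    Frame a s ((copyCmd a b).run s) ∧
      ∀ i ≤ s.idx 0 0, ((copyCmd a b).run s).num a i = s.num b i :=
  run_forN_map (s.num b) fun s' hf i _ hi' => by
    simp only [Cmd.run, NExp.eval, IExp.eval, hi', hf.num b hab]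

/-- The effect of the program for one guess. -/
theorem run_body (hs : Inputs n p w wb c B C s) (hG : AtGuess n k G s) (r : Store ℝ)
    (hr : r = (Cmd.seq (solveCmd k) updateCmd).run s) :
    Inputs n p w wb c B C r ∧
      (Passes n p w wb c B C k G ∧ s.num 18 0 < profit n p w wb c k G →
        r.num 18 0 = profit n p w wb c k G ∧
        ∀ i ≤ n, r.num 5 i = xval p w wb c k G i ∧ r.num 6 i = yval n p w wb c C k G i) ∧
      (¬ (Passes n p w wb c B C k G ∧ s.num 18 0 < profit n p w wb c k G) →
        r.num 18 0 = s.num 18 0 ∧ r.num 5 = s.num 5 ∧ r.num 6 = s.num 6) := by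
  obtain ⟨h₁, hG₁, hold, h10, h13, h15, h16, h17⟩ := run_solveCmd hs hG
  simp only [Cmd.run, updateCmd] at hr
  set s₁ := (solveCmd k).run s
  have g1 := hG₁.var 1 (by omega) (by omega)
  have l1 := hG₁.le 1 (by omega) (by omega)
  have haccept : acceptTest.holds s₁ ↔
      Passes n p w wb c B C k G ∧ s.num 18 0 < profit n p w wb c k G := by
    simp only [acceptTest, Test.holds, h15, h16, h17]
    simp only [NExp.eval, IExp.eval, g1, h10 _ l1, h13 _ l1, h₁.budget, h₁.improvement,
      hold 18 (by omega), not_le, Nat.cast_zero]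
    exact ⟨fun ⟨a, b, c, d, e⟩ => ⟨⟨a, b, c, d⟩, e⟩, fun ⟨⟨a, b, c, d⟩, e⟩ => ⟨a, b, c, d, e⟩⟩
  split_ifs at hr with hacc
  · set s₂ := s₁.setNum 18 (IExp.eval s₁ (.lit 0)) ((total 17).eval s₁) with hs₂
    have f₂ : Frame 18 s₁ s₂ := frame_setNum _ _ _ _
    obtain ⟨f₃, e₃⟩ := run_copyCmd 5 10 (by norm_num) s₂
    obtain ⟨f₄, e₄⟩ := run_copyCmd 6 13 (by norm_num) ((copyCmd 5 10).run s₂)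
    rw [← hr] at f₄ e₄
    have h₂ := h₁.frame f₂ (by norm_num)
    have h₃ := h₂.frame f₃ (by norm_num)
    rw [h₂.last] at e₃
    rw [h₃.last] at e₄
    refine ⟨h₃.frame f₄ (by norm_num), fun _ => ⟨?_, fun i hi => ⟨?_, ?_⟩⟩,
      fun h => absurd (haccept.1 hacc) h⟩
    · rw [f₄.num 18 (by norm_num), f₃.num 18 (by norm_num), hs₂, ← h17]
      exact Store.setNum_num_self _ _ _ _
    · rw [f₄.num 5 (by norm_num), e₃ i hi, f₂.num 10 (by norm_num), h10 i hi]
    · rw [e₄ i hi, f₃.num 13 (by norm_num), f₂.num 13 (by norm_num), h13 i hi]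
  · subst hr
    refine ⟨h₁, fun h => absurd (haccept.2 h) hacc, fun _ => ⟨?_, ?_, ?_⟩⟩
    · rw [hold 18 (by omega)]
    · rw [hold 5 (by omega)]
    · rw [hold 6 (by omega)]

end Scheme

end RAM

/-! ### Correctness of the search over all guesses -/

namespace RAM

open Greedy

namespace Scheme

variable {n : ℕ} {p w wb c : ℕ → ℝ} {B C : ℝ} {k : ℕ} {G : ℕ → ℕ} {s : Store ℝ}

theorem indicator_mul (P : Prop) [Decidable P] (x : ℝ) :
    indicator P * x = if P then x else 0 := by
  by_cases h : P <;> simp [indicator, h]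

theorem sum_mul_xval {F : ℕ → ℝ} (hF : F n = 0) :
    ∑ i ∈ Finset.range (n + 1), F i * xval p w wb c k G i =
      ∑ i ∈ chosenSet n p w wb c k G, F i := by
  classical
  rw [Finset.sum_range_succ, hF, zero_mul, add_zero, chosenSet, Finset.sum_filter]
  refine Finset.sum_congr rfl fun i _ => ?_
  rw [mul_comm, xval, indicator_mul]

theorem sum_mul_uval (hwb : wb n = 0) (F : ℕ → ℝ) :
    ∑ i ∈ Finset.range (n + 1), F i * uval p w wb c k G i =
      ∑ i ∈ improvedSet wb c (chosenSet n p w wb c k G) (G 1), F i := by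
  classical
  rw [Finset.sum_range_succ, improvedSet, chosenSet, Finset.filter_filter, Finset.sum_filter]
  have h : uval p w wb c k G n = 0 := by simp [uval, indicator, hwb]
  rw [h, mul_zero, add_zero]
  refine Finset.sum_congr rfl fun i _ => ?_
  rw [mul_comm, uval, indicator_mul]

theorem uval_self : uval p w wb c k G (G 1) = 0 := by
  have : ¬ Precedes wb c (G 1) (G 1) := fun h => by simp [Precedes] at h
  simp [uval, indicator, this]

theorem yval_self (hwb : wb n = 0) : yval n p w wb c C k G (G 1) =
    partialImprovement wb c C (chosenSet n p w wb c k G) (G 1) := by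
  rw [yval, if_pos rfl, partialImprovement, ← sum_mul_uval hwb c]
  simp only [mul_comm]

/-- The item `G 1` does not precede itself, so `uval` vanishes there and `yval` differs from it by
this single term. -/
theorem sum_mul_yval (hwb : wb n = 0) (hG : G 1 ≤ n) (F : ℕ → ℝ) :
    ∑ i ∈ Finset.range (n + 1), F i * yval n p w wb c C k G i =
      ∑ i ∈ improvedSet wb c (chosenSet n p w wb c k G) (G 1), F i +
      F (G 1) * partialImprovement wb c C (chosenSet n p w wb c k G) (G 1) := by
  classical
  have hmem : G 1 ∈ Finset.range (n + 1) := Finset.mem_range.2 (by omega)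
  rw [← sum_mul_uval hwb, ← yval_self hwb, ← Finset.add_sum_erase _ _ hmem,
    ← Finset.add_sum_erase (Finset.range (n + 1)) (fun i => F i * uval p w wb c k G i) hmem,
    uval_self, mul_zero, zero_add, add_comm]
  congr 1
  refine Finset.sum_congr rfl fun i hi => ?_
  rw [yval, if_neg (Finset.ne_of_mem_erase hi)]

theorem profit_eq (hp : p n = 0) :
    profit n p w wb c k G = ∑ i ∈ chosenSet n p w wb c k G, p i := sum_mul_xval hp

theorem passes_of_guessFeasible (H : ItemData n p w wb c) (hG : G 1 ≤ n)
    (h : GuessFeasible n p w wb c B C k G) : Passes n p w wb c B C k G where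
  nonneg := by rw [yval_self H.wb_end]; exact h.partial_nonneg
  le := by
    rw [yval_self H.wb_end]
    rcases h.mem with hm | hm
    · classical
      have : Chosen p w wb c k G (G 1) := (Finset.mem_filter.1 hm).2
      simpa [xval, indicator, this] using h.partial_le_one
    · refine hm.trans ?_
      rw [xval, indicator]
      split_ifs <;> norm_num
  cost_le := by rw [sum_mul_yval H.wb_end hG]; exact h.cost_le
  weight_le := by
    rw [Finset.sum_sub_distrib, sum_mul_xval H.w_end, sum_mul_yval H.wb_end hG]
    linarith [h.weight_le]

/-- The output arrays contain a feasible solution, whose profit is stored. -/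
structure Good (n : ℕ) (p w wb c : ℕ → ℝ) (B C : ℝ) (s : Store ℝ) : Prop where
  inputs : Inputs n p w wb c B C s
  best : s.num 18 0 = ∑ i ∈ Finset.range (n + 1), p i * s.num 5 i
  binary : ∀ i ≤ n, s.num 5 i = 0 ∨ s.num 5 i = 1
  nonneg : ∀ i ≤ n, 0 ≤ s.num 6 i
  le : ∀ i ≤ n, s.num 6 i ≤ s.num 5 i
  cost_le : ∑ i ∈ Finset.range (n + 1), c i * s.num 6 i ≤ C
  weight_le : ∑ i ∈ Finset.range (n + 1), (w i * s.num 5 i - wb i * s.num 6 i) ≤ B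

theorem good_body (hs : Good n p w wb c B C s) (hG : AtGuess n k G s) (r : Store ℝ)
    (hr : r = (Cmd.seq (solveCmd k) updateCmd).run s) :
    Good n p w wb c B C r ∧ s.num 18 0 ≤ r.num 18 0 ∧
      (Passes n p w wb c B C k G → profit n p w wb c k G ≤ r.num 18 0) := by
  obtain ⟨h₁, h₂, h₃⟩ := run_body hs.inputs hG r hr
  by_cases h : Passes n p w wb c B C k G ∧ s.num 18 0 < profit n p w wb c k G
  · obtain ⟨hbest, hout⟩ := h₂ h
    have hsum : ∀ i ∈ Finset.range (n + 1), r.num 5 i = xval p w wb c k G i ∧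
        r.num 6 i = yval n p w wb c C k G i := fun i hi => hout i (by
      rw [Finset.mem_range] at hi; omega)
    refine ⟨⟨h₁, ?_, fun i hi => ?_, fun i hi => ?_, fun i hi => ?_, ?_, ?_⟩,
      hbest ▸ h.2.le, fun _ => hbest.ge⟩
    · rw [hbest, profit]
      exact Finset.sum_congr rfl fun i hi => by rw [(hsum i hi).1]
    · rw [(hout i hi).1, xval, indicator]
      split_ifs <;> simp
    · rw [(hout i hi).2]
      by_cases hi1 : i = G 1
      · rw [hi1]; exact h.1.nonneg
      · rw [yval, if_neg hi1, uval, indicator]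
        split_ifs <;> norm_num
    · rw [(hout i hi).1, (hout i hi).2]
      by_cases hi1 : i = G 1
      · rw [hi1]; exact h.1.le
      · rw [yval, if_neg hi1, uval, xval, indicator, indicator]
        split_ifs with h1 h2
        exacts [le_rfl, absurd h1.1 h2, zero_le_one, le_rfl]
    · rw [Finset.sum_congr rfl fun i hi => by rw [(hsum i hi).2]]
      exact h.1.cost_le
    · rw [Finset.sum_congr rfl fun i hi => by rw [(hsum i hi).1, (hsum i hi).2]]
      exact h.1.weight_le
  · obtain ⟨e₁, e₂, e₃⟩ := h₃ h
    refine ⟨⟨h₁, ?_, ?_, ?_, ?_, ?_, ?_⟩, e₁.ge, fun hp => ?_⟩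
    · rw [e₁, e₂]; exact hs.best
    · rw [e₂]; exact hs.binary
    · rw [e₃]; exact hs.nonneg
    · rw [e₂, e₃]; exact hs.le
    · rw [e₃]; exact hs.cost_le
    · rw [e₂, e₃]; exact hs.weight_le
    · rw [e₁]
      by_contra hlt
      exact h ⟨hp, not_le.1 hlt⟩

theorem Good.setIdx (hs : Good n p w wb c B C s) (v m : ℕ) :
    Good n p w wb c B C (s.setIdx 1 v m) where
  inputs := ⟨(Store.setIdx_idx_of_ne _ (by norm_num)).trans hs.inputs.last, hs.inputs.budget,
    hs.inputs.improvement, hs.inputs.p_eq, hs.inputs.w_eq, hs.inputs.wb_eq, hs.inputs.c_eq⟩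
  best := hs.best
  binary := hs.binary
  nonneg := hs.nonneg
  le := hs.le
  cost_le := hs.cost_le
  weight_le := hs.weight_le

/-- The loops over the guesses keep the best solution. -/
theorem good_guessLoops (m : ℕ) : ∀ s : Store ℝ, Good n p w wb c B C s →
    (∀ v, m < v → v ≤ 18 + k → s.idx 1 v ≤ n) →
    Good n p w wb c B C ((guessLoops (.seq (solveCmd k) updateCmd) m).run s) ∧
      s.num 18 0 ≤ ((guessLoops (.seq (solveCmd k) updateCmd) m).run s).num 18 0 ∧
      ∀ G : ℕ → ℕ, (∀ v, G v ≤ n) → (∀ v, m < v → v ≤ 18 + k → s.idx 1 v = G v) →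
        Passes n p w wb c B C k G → profit n p w wb c k G ≤
          ((guessLoops (.seq (solveCmd k) updateCmd) m).run s).num 18 0 := by
  induction m with
  | zero =>
    intro s hs hle
    have h := fun G (hG : AtGuess n k G s) => good_body hs hG _ rfl
    have h0 := h (s.idx 1) ⟨fun _ _ _ => rfl, fun v hv hv' => hle v (Nat.pos_of_ne_zero hv) hv'⟩
    exact ⟨h0.1, h0.2.1, fun G hG hGs => (h G ⟨fun v hv hv' => hGs v (Nat.pos_of_ne_zero hv) hv',
      fun v _ _ => hG v⟩).2.2⟩
  | succ m ih =>
    intro s hs hle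
    set d := guessLoops (.seq (solveCmd k) updateCmd) m with hd
    have hw : ∀ v, m < v → ¬ d.Writes v := fun v hv h =>
      absurd (writes_guessLoops (fun _ => writes_body) h) (by omega)
    -- The invariant covers the guesses that agree with the outer counters and whose entry `m + 1`
    -- has already been tried.
    have key := forSteps_induction (f := fun j s' => d.run (Store.setIdx s' 1 (m + 1) j)) (s := s)
      (P := fun j s' => Good n p w wb c B C s' ∧ s.num 18 0 ≤ s'.num 18 0 ∧
        (∀ v, m + 1 < v → s'.idx 1 v = s.idx 1 v) ∧
        ∀ G : ℕ → ℕ, (∀ v, G v ≤ n) → (∀ v, m + 1 < v → v ≤ 18 + k → s.idx 1 v = G v) →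
          G (m + 1) < j → Passes n p w wb c B C k G → profit n p w wb c k G ≤ s'.num 18 0)
      (m := s.idx 0 0 + 1)
      ⟨hs, le_rfl, fun _ _ => rfl, fun G _ _ h => absurd h (Nat.not_lt_zero _)⟩
      fun j hj s' hs' => ?_
    · obtain ⟨h₁, h₂, -, h₃⟩ := key
      refine ⟨h₁.setIdx _ _, h₂, fun G hG hGs => h₃ G hG hGs ?_⟩
      rw [hs.inputs.last]
      exact Nat.lt_succ_of_le (hG _)
    · obtain ⟨h₁, h₂, h₃, h₄⟩ := hs'
      rw [hs.inputs.last] at hj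
      have hidx : ∀ v, m + 1 < v → (s'.setIdx 1 (m + 1) j).idx 1 v = s.idx 1 v := fun v hv => by
        rw [Store.setIdx_idx_of_ne _ fun _ => by omega, h₃ v hv]
      obtain ⟨g₁, g₂, g₃⟩ := ih (s'.setIdx 1 (m + 1) j) (h₁.setIdx _ _) fun v hv hv' => by
        rcases Nat.lt_or_eq_of_le (Nat.succ_le_of_lt hv) with h | h
        · rw [hidx v h]; exact hle v h hv'
        · rw [← h, Store.setIdx_idx_self]; omega
      refine ⟨g₁, h₂.trans g₂, fun v hv => ?_, fun G hG hGs hGj hpass => ?_⟩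
      · rw [d.run_idx (fun _ => hw v (by omega)), hidx v hv]
      · rcases Nat.lt_or_eq_of_le (Nat.le_of_lt_succ hGj) with h | h
        · exact (h₄ G hG hGs h hpass).trans g₂
        · refine g₃ G hG (fun v hv hv' => ?_) hpass
          rcases Nat.lt_or_eq_of_le (Nat.succ_le_of_lt hv) with h' | h'
          · rw [hidx v h']; exact hGs v h' hv'
          · rw [← h', Store.setIdx_idx_self, h]

end Scheme

end RAM

/-! ### From the knapsack problem to the program and back -/

namespace KnapsackInstance

open RAM Greedy

variable {n : ℕ} {I : KnapsackInstance ℝ n}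

theorem fill_apply {K : Type} [Zero K] (f : Fin n → K) (i : Fin n) : fill f i = f i := by
  simp [fill]

theorem fill_end {K : Type} [Zero K] (f : Fin n → K) : fill f n = 0 := by simp [fill]

theorem itemData (hI : I.Valid) :
    ItemData n (fill I.p) (fill I.w) (fill I.wbar) (fill I.c) where
  wb_nonneg i := by unfold fill; split_ifs; exacts [hI.wbar_nonneg _, le_rfl]
  wb_le i := by unfold fill; split_ifs; exacts [hI.wbar_le _, le_rfl]
  c_nonneg i := by unfold fill; split_ifs; exacts [hI.c_nonneg _, le_rfl]
  p_end := fill_end _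
  w_end := fill_end _
  wb_end := fill_end _
  c_end := fill_end _

theorem sum_fill_mul (f : Fin n → ℝ) (x : ℕ → ℝ) :
    ∑ i ∈ Finset.range (n + 1), fill f i * x i = ∑ i, f i * x i := by
  rw [Finset.sum_range_succ, fill_end, zero_mul, add_zero, Finset.sum_range]
  simp only [fill_apply]

open Scheme in
theorem good_load (hI : I.Valid) : Good n (fill I.p) (fill I.w) (fill I.wbar) (fill I.c) I.B I.C
    I.load where
  inputs := ⟨rfl, by simp [load, fill], by simp [load, fill], rfl, rfl, rfl, rfl⟩
  best := by simp [load]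
  binary i _ := Or.inl rfl
  nonneg i _ := le_rfl
  le i _ := le_rfl
  cost_le := by simpa [load] using hI.C_nonneg
  weight_le := by simpa [load] using hI.B_nonneg

open Scheme in
theorem feasible_of_good {s : Store ℝ}
    (h : Good n (fill I.p) (fill I.w) (fill I.wbar) (fill I.c) I.B I.C s) :
    I.Feasible (s.outX n) (s.outY n) ∧ s.num 18 0 = I.profit (s.outX n) := by
  refine ⟨⟨?_, ?_, fun i => h.le i i.2.le, fun i => h.nonneg i i.2.le,
    fun i => h.binary i i.2.le⟩, ?_⟩
  · have := h.weight_le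
    rwa [Finset.sum_sub_distrib, sum_fill_mul, sum_fill_mul] at this
  · have := h.cost_le
    rwa [sum_fill_mul] at this
  · rw [h.best, sum_fill_mul]
    rfl

/-- The optimal value is attained, by the profitable items of an optimal solution. -/
theorem exists_isGreatest (hI : I.Valid) : ∃ opt, IsGreatest I.values opt ∧ ∃ x y,
    I.Feasible x y ∧ opt = I.profit x := by
  have hfin : I.values.Finite := by
    refine ((Set.finite_range fun x : Fin n → Bool =>
      I.profit fun i => if x i then 1 else 0)).subset ?_
    rintro v ⟨x, y, hxy, rfl⟩
    refine ⟨fun i => decide (x i = 1), ?_⟩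
    simp only [decide_eq_true_eq]
    congr 1
    funext i
    rcases hxy.x_binary i with h | h <;> simp [h]
  have hne : I.values.Nonempty := ⟨_, fun _ => 0, fun _ => 0,
    ⟨by simpa using hI.B_nonneg, by simpa using hI.C_nonneg, fun _ => le_rfl, fun _ => le_rfl,
      fun _ => Or.inl rfl⟩, rfl⟩
  obtain ⟨opt, hopt, hmax⟩ := Set.exists_max_image _ id hfin hne
  exact ⟨opt, ⟨hopt, fun v hv => hmax v hv⟩, hopt⟩

/-- The profitable items of a feasible solution fit for all prices of the improvement budget. -/
theorem exists_profitable (hI : I.Valid) {x y : Fin n → ℝ} (hxy : I.Feasible x y) :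
    ∃ X : Finset ℕ, (∀ i ∈ X, i < n ∧ 0 < fill I.p i) ∧
      I.profit x ≤ ∑ i ∈ X, fill I.p i ∧ ∀ r, 0 ≤ r →
        ∑ i ∈ X, effWeight (fill I.w) (fill I.wbar) (fill I.c) i r ≤ I.B + r * I.C := by
  classical
  have hsum : ∀ F : ℕ → ℝ, ∑ i ∈ (Finset.univ.filter fun i : Fin n => x i = 1 ∧ 0 < I.p i).map
      Fin.valEmbedding, F i = ∑ i : Fin n, if x i = 1 ∧ 0 < I.p i then F i else 0 := fun F => by
    rw [Finset.sum_map, Finset.sum_filter]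
    rfl
  refine ⟨(Finset.univ.filter fun i : Fin n => x i = 1 ∧ 0 < I.p i).map Fin.valEmbedding,
    fun i hi => ?_, ?_, fun r hr => ?_⟩
  · obtain ⟨j, hj, rfl⟩ := Finset.mem_map.1 hi
    refine ⟨j.2, ?_⟩
    simpa only [Fin.valEmbedding_apply, fill_apply] using (Finset.mem_filter.1 hj).2.2
  · rw [hsum]
    refine Finset.sum_le_sum fun i _ => ?_
    rw [fill_apply]
    rcases hxy.x_binary i with h | h
    · simp [h]
    · by_cases hp : 0 < I.p i
      · simp [h, hp]
      · simpa [h, hp] using not_lt.1 hp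
  · rw [hsum]
    -- Weak duality, item by item: the minimum is at most the average of `w` and `w - wbar + r * c`
    -- with weights `1 - y` and `y`. Omitted items contribute a nonnegative term on the right.
    have hle : ∀ i, (if x i = 1 ∧ 0 < I.p i then
        effWeight (fill I.w) (fill I.wbar) (fill I.c) (i : ℕ) r else 0) ≤
        I.w i * x i - I.wbar i * y i + r * (I.c i * y i) := by
      intro i
      have h1 := hI.wbar_nonneg i
      have h2 := hI.wbar_le i
      have h3 := hxy.y_nonneg i
      have h4 := hxy.y_le i
      have h5 := mul_nonneg hr (mul_nonneg (hI.c_nonneg i) h3)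
      have h6 : 0 ≤ I.w i * x i - I.wbar i * y i := by nlinarith
      split_ifs with h
      · rw [effWeight, fill_apply, fill_apply, fill_apply]
        rw [h.1] at h4 ⊢
        have h7 := mul_le_mul_of_nonneg_right
          (min_le_left (I.w i) (I.w i - I.wbar i + r * I.c i)) (sub_nonneg.2 h4)
        have h8 := mul_le_mul_of_nonneg_right
          (min_le_right (I.w i) (I.w i - I.wbar i + r * I.c i)) h3
        linarith
      · linarith
    calc _ ≤ ∑ i, (I.w i * x i - I.wbar i * y i + r * (I.c i * y i)) :=
          Finset.sum_le_sum fun i _ => hle i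
      _ = (∑ i, I.w i * x i - ∑ i, I.wbar i * y i) + r * ∑ i, I.c i * y i := by
          rw [Finset.sum_add_distrib, Finset.sum_sub_distrib, Finset.mul_sum]
      _ ≤ I.B + r * I.C :=
          add_le_add hxy.weight_le (mul_le_mul_of_nonneg_left hxy.cost_le hr)

/-- The output of the program is nearly optimal. -/
theorem isApproxSolution_run (hI : I.Valid) {ε : ℝ} {k : ℕ} (hk : 1 ≤ k) (hkε : 2 ≤ ε * k) :
    I.IsApproxSolution ε (((Scheme.mainCmd k).run I.load).outX n)
      (((Scheme.mainCmd k).run I.load).outY n) := by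
  obtain ⟨opt, hopt, x, y, hxy, rfl⟩ := exists_isGreatest hI
  obtain ⟨X, hX, hprofit, hfit⟩ := exists_profitable hI hxy
  have H := itemData hI
  obtain ⟨G, hG, hfeas, hle⟩ := H.exists_guess hI.C_nonneg hk hX hfit
  obtain ⟨h₁, h₀, h₂⟩ := Scheme.good_guessLoops (k := k) (18 + k) I.load (good_load hI)
    fun v hv hv' => absurd hv (not_lt.2 hv')
  obtain ⟨hf, hbest⟩ := feasible_of_good h₁
  refine ⟨hf, _, hopt, ?_⟩
  have h₃ := h₂ G hG (fun v hv hv' => absurd hv (not_lt.2 hv'))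
    (Scheme.passes_of_guessFeasible H (hG 1) hfeas)
  rw [Scheme.profit_eq H.p_end, hbest] at h₃
  rw [hbest] at h₀
  change 0 ≤ I.profit (((Scheme.mainCmd k).run I.load).outX n) at h₀
  change _ ≤ I.profit (((Scheme.mainCmd k).run I.load).outX n) at h₃
  change (1 - ε) * I.profit x ≤ I.profit (((Scheme.mainCmd k).run I.load).outX n)
  have hk0 : (0 : ℝ) < k := by exact_mod_cast hk
  have hε : 0 < ε := by
    by_contra! h
    nlinarith
  have hX0 : 0 ≤ ∑ i ∈ X, fill I.p i := Finset.sum_nonneg fun i hi => (hX i hi).2.le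
  set P := ∑ i ∈ X, fill I.p i
  set Q := ∑ i ∈ chosenSet n (fill I.p) (fill I.w) (fill I.wbar) (fill I.c) k G, fill I.p i
  have h₄ : P - Q ≤ ε * P := by
    have : k * (P - Q) ≤ k * (ε * P) := by nlinarith
    exact le_of_mul_le_mul_left this hk0
  rcases le_total ε 1 with h | h
  · have := mul_le_mul_of_nonneg_left hprofit (sub_nonneg.2 h)
    linarith
  -- For `ε ≥ 1` the factor `1 - ε` is nonpositive; then the zero solution shows that the optimum is
  -- nonnegative, and any output of nonnegative profit is good enough.
  · have hopt0 : 0 ≤ I.profit x := hopt.2 ⟨fun _ => 0, fun _ => 0, ⟨by simpa using hI.B_nonneg,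
      by simpa using hI.C_nonneg, fun _ => le_rfl, fun _ => le_rfl, fun _ => Or.inl rfl⟩, by
        simp [KnapsackInstance.profit]⟩
    nlinarith

/-! ### Rational instances and their encoding length -/

theorem load_toReal (J : KnapsackInstance ℚ n) : J.toReal.load = J.load.toReal := by
  have hfill : ∀ f : Fin n → ℚ, fill (fun i => (f i : ℝ)) = fun j => ((fill f j : ℚ) : ℝ) := by
    intro f
    funext j
    by_cases h : j < n <;> simp [fill, h]
  have hbudget : fill ![(J.B : ℝ), (J.C : ℝ)] = fun j => ((fill ![J.B, J.C] j : ℚ) : ℝ) := by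
    funext j
    by_cases h : j < 2
    · interval_cases j <;> simp [fill]
    · simp [fill, h]
  have hnum : ∀ a, J.toReal.load.num a = J.load.toReal.num a := fun a =>
    match a with
    | 0 => hbudget
    | 1 => hfill J.p
    | 2 => hfill J.w
    | 3 => hfill J.wbar
    | 4 => hfill J.c
    | _ + 5 => funext fun _ => Rat.cast_zero.symm
  exact congrArg (Store.mk J.load.idx) (funext hnum)

theorem load_idx_le {K : Type} [Field K] (J : KnapsackInstance K n) (a i : ℕ) :
    J.load.idx a i ≤ n := by
  rcases a with _ | a
  · rcases i with _ | i
    · exact le_rfl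
    · exact Nat.zero_le n
  · exact Nat.zero_le n

theorem ratHeight_le_ratSize (r : ℚ) : ratHeight r ≤ ratSize r := by
  simp only [ratHeight, ratSize]
  omega

theorem ratHeight_load_le (J : KnapsackInstance ℚ n) (a i : ℕ) :
    ratHeight (J.load.num a i) ≤ J.bitSize + 1 := by
  have h0 : ratHeight 0 ≤ J.bitSize + 1 := by simp [ratHeight]
  have hfill : ∀ f : Fin n → ℚ, (∀ j, ratSize (f j) ≤ ratSize (J.p j) + ratSize (J.w j) +
      ratSize (J.wbar j) + ratSize (J.c j)) → ratHeight (fill f i) ≤ J.bitSize + 1 := by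
    intro f hf
    rw [fill]
    split_ifs with h
    · have h1 := Finset.single_le_sum (f := fun j => ratSize (J.p j) + ratSize (J.w j) +
        ratSize (J.wbar j) + ratSize (J.c j)) (fun _ _ => Nat.zero_le _)
        (Finset.mem_univ (⟨i, h⟩ : Fin n))
      have h2 := ratHeight_le_ratSize (f ⟨i, h⟩)
      have h3 := hf ⟨i, h⟩
      rw [bitSize]
      omega
    · exact h0
  match a with
  | 0 =>
    change ratHeight (fill ![J.B, J.C] i) ≤ _
    by_cases h : i < 2
    · have h1 := ratHeight_le_ratSize J.B
      have h2 := ratHeight_le_ratSize J.C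
      have h3 : ratSize J.B + ratSize J.C ≤ J.bitSize := by rw [bitSize]; omega
      interval_cases i <;> simp [fill] <;> omega
    · simpa [fill, h] using h0
  | 1 => exact hfill J.p fun j => by omega
  | 2 => exact hfill J.w fun j => by omega
  | 3 => exact hfill J.wbar fun j => by omega
  | 4 => exact hfill J.c fun j => by omega
  | _ + 5 => exact h0

theorem Valid.toReal {J : KnapsackInstance ℚ n} (hJ : J.Valid) : J.toReal.Valid where
  B_nonneg := Rat.cast_nonneg.2 hJ.B_nonneg
  C_nonneg := Rat.cast_nonneg.2 hJ.C_nonneg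
  c_nonneg i := Rat.cast_nonneg.2 (hJ.c_nonneg i)
  wbar_nonneg i := Rat.cast_nonneg.2 (hJ.wbar_nonneg i)
  wbar_le i := Rat.cast_le.2 (hJ.wbar_le i)

end KnapsackInstance

/-! ### The approximation scheme -/

theorem mainTheorem1 (ε : ℝ) (hε : 0 < ε) :
    ∃ prog : RAM.Prog,
      (∃ T : Polynomial ℕ, ∀ (n : ℕ) (I : KnapsackInstance ℝ n), I.Valid →
        ∃ (s : RAM.Store ℝ) (t : ℕ),
          RAM.Exec (RAM.CostModel.unit ℝ) prog I.load s t ∧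
          t ≤ T.eval n ∧
          I.IsApproxSolution ε (s.outX n) (s.outY n)) ∧
      (∃ T : Polynomial ℕ, ∀ (n : ℕ) (I : KnapsackInstance ℚ n), I.Valid →
        ∃ (s : RAM.Store ℚ) (t : ℕ),
          RAM.Exec RAM.CostModel.bits prog I.load s t ∧
          t ≤ T.eval I.bitSize ∧
          I.toReal.IsApproxSolution ε 
            (fun i => ((s.outX n i : ℚ) : ℝ)) (fun i => ((s.outY n i : ℚ) : ℝ))) := by
  -- With `k ≥ 2 / ε` guessed items the relative loss `2 / k` is at most `ε`.
  obtain ⟨k, hk⟩ := exists_nat_ge (2 / ε)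
  have hkε : 2 ≤ ε * k := by rwa [div_le_iff₀' hε] at hk
  have hk1 : 1 ≤ k := Nat.one_le_iff_ne_zero.2 fun h => by
    rw [h, Nat.cast_zero, mul_zero] at hkε
    norm_num at hkε
  obtain ⟨T, hT⟩ := RAM.Cmd.exists_polynomial_exec (RAM.Scheme.wellFormed_mainCmd k)
    (RAM.Scheme.leveled_mainCmd k) RAM.Scheme.level_le
  refine ⟨(RAM.Scheme.mainCmd k).compile, ⟨T, fun n I hI => ?_⟩, T, fun n I hI => ?_⟩
  · obtain ⟨t, ht, htT⟩ := hT ℝ _ _ (RAM.sizeMeasure_unit ℝ) n I.load (I.load_idx_le 0 0)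
      (fun a i => (I.load_idx_le a i).trans n.le_succ) (fun _ _ => Nat.zero_le _)
    exact ⟨_, t, ht, htT, KnapsackInstance.isApproxSolution_run hI hk1 hkε⟩
  · have hn : n ≤ I.bitSize := by rw [KnapsackInstance.bitSize]; omega
    obtain ⟨t, ht, htT⟩ := hT ℚ _ _ RAM.sizeMeasure_bits I.bitSize I.load
      ((I.load_idx_le 0 0).trans hn)
      (fun a i => (I.load_idx_le a i).trans (hn.trans (Nat.le_succ _)))
      (fun a i => I.ratHeight_load_le a i)
    refine ⟨_, t, ht, htT, ?_⟩
    have h := KnapsackInstance.isApproxSolution_run hI.toReal hk1 hkε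
    rwa [I.load_toReal, RAM.Cmd.run_toReal] at h
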